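/- **The task.** For a finite alphabet $\Sigma$, a sequence $X\in\Sigma^N$ and $1\le i\le N$, let $\mathrm{find}^1_X(i)$ be the largest $j$ with $2\le j\le i$ and $X_{j-1}=X_i$ ($0$ if there is none), with $\mathrm{find}^1_X(0)=0$, and let $\mathrm{find}^k_X(i)=\mathrm{find}^1_X(\mathrm{find}^{k-1}_X(i))$ for $k\ge 2$. The map $\mathrm{hop}_k:\Sigma^N\to(\Sigma\cup\{\bot\})^N$ is given by $\mathrm{hop}_k(X)_i=X_{\mathrm{find}^k_X(i)}$ if $\mathrm{find}^k_X(i)\neq 0$, and $\bot$ otherwise. The elements of $\Sigma\cup\{\bot\}$ are represented by distinct real numbers. **Transformers.** A causally-masked transformer with context length $N$, embedding dimension $m$, depth $L$, $H$ heads per layer and precision $p$ maps $X\in\mathbb R^{N}$ to $\psi(X^L)\in\mathbb R^N$, where $X^0\in\mathbb R^{N\times m}$ has first column $X$ and is zero elsewhere, $X^{\ell}=X^{\ell-1}+\sum_{h=1}^H\rho\big(f_{\ell,h}(X^{\ell-1})\big)$, and $f_{\ell,h}(Y)=\mathrm{softmax}(Q(Y)K(Y)^{\mathsf T}+\Gamma)V(Y)$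 with $\Gamma_{i,j}=0$ for $i\ge j$ and $\Gamma_{i,j}=-\infty$ otherwise. Here $Q,K,V$ (depending on $\ell,h$) and $\psi$ are arbitrary maps applied row by row, possibly different for each row; all entries $z$ of $Q,K,V$ satisfy $|z|\le 2^p$ and $2^pz\in\mathbb Z$; and $\rho:\mathbb R\to 2^{-p}\mathbb Z$, applied entrywise, is any fixed monotone rounding, $|\rho(x)-x|<2^{-p}$ (for example rounding to nearest). **Conjecture (one versus two cycles).** For $\gamma>0$ and $0<\delta<1$, a (deterministic) $(\gamma,\delta)$-MPC protocol on $n_{\mathrm{in}}$ input words has $q=\Theta(n_{\mathrm{in}}^{1+\gamma-\delta})$ machines, each with a local memory of $s=O(n_{\mathrm{in}}^{\delta})$ words of $\Theta(\log n_{\mathrm{in}})$ bits. Initially the input words, with their indices, are distributed in consecutive blocks of $s$ words. In each round every machine computes, by an arbitrary function of its local memory, a set of nonempty messages to other machines, with at most $s$ words in total; every machine receives at most $s$ words, and the messages received, with their sources, are its new memory. After the last round the first machine holds the output word. The conjecture states that for all constants $\gamma>0$, $0<\delta<1$ and even $n$, every $(\gamma,\delta)$-MPC protocol that distinguishes a single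 cycle on $n$ vertices from a disjoint union of two cycles on $n/2$ vertices each, given as an arbitrarily labelled and ordered list of $n$ edges ($n_{\mathrm{in}}=2n$ words, each vertex being one word), uses $\Omega(\log n)$ rounds, where the implied constant and the threshold for $n$ depend only on $\gamma,\delta$ and the constants in the bounds on $q$, $s$ and the word size. **Corollary.** Assume the one-versus-two-cycle conjecture. For all constants $\xi\in(0,1/2]$, $\varepsilon\in(0,1)$ and $a,b,C,B>0$ there are $c>0$ and $N_0$ such that the following holds for all $N\ge N_0$. Let $k$ be even with $aN^{\xi}\le k\le bN^{\xi}$, and let $|\Sigma|\ge k+3$. Then every causally-masked transformer with context length $N$, embedding dimension $m$, depth $L$, $H$ heads per layer, $mH\le Ck^{1-\varepsilon}$ and precision $p\le B\log N$ that computes $\mathrm{hop}_k:\Sigma^N\to(\Sigma\cup\{\bot\})^N$ satisfies $L\ge c\log k$. -/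

import Mathlib

open scoped BigOperators

noncomputable section

/-! ### The `k`-hop induction heads task -/

/-- `find¹_X(i)`: the largest position `j ≤ i` such that position `j - 1` exists and
`X_{j-1} = X_i`; `none` (the value `0` of `find`) if there is no such `j`. -/
def findOne {N : ℕ} {A : Type*} (X : Fin N → A) (i : Fin N) : Option (Fin N) :=
  open Classical in
  let S : Finset (Fin N) :=
    Finset.univ.filter (fun j => j ≤ i ∧ ∃ j' : Fin N, j'.val + 1 = j.val ∧ X j' = X i)
  if h : S.Nonempty then some (S.max' h) else none

/-- `find^k_X(i) = find¹_X(find^{k-1}_X(i))`, where `find⁰_X(i) = i`. -/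
def findHop {N : ℕ} {A : Type*} (X : Fin N → A) : ℕ → Fin N → Option (Fin N)
  | 0, i => some i
  | k + 1, i => (findHop X k i).bind (findOne X)

/-- `hop_k(X)_i`, with `none` in the role of `⊥`. -/
def hop {N : ℕ} {A : Type*} (k : ℕ) (X : Fin N → A) (i : Fin N) : Option A :=
  (findHop X k i).map X

/-! ### Causally-masked transformers with `p`-bit precision -/

/-- Scalars that are representable with `p` integer and `p` fractional bits. -/
def IsFixedPoint (p : ℕ) (z : ℝ) : Prop :=
  |z| ≤ 2 ^ p ∧ ∃ t : ℤ, z * 2 ^ p = t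

/-- A rounding mode for `p` fractional bits: a monotone map to the multiples of `2⁻ᵖ` that moves
every real by less than `2⁻ᵖ` (rounding down, up, or to nearest with any rule for ties). -/
def IsRounding (p : ℕ) (ρ : ℝ → ℝ) : Prop :=
  Monotone ρ ∧ ∀ x, (∃ t : ℤ, ρ x * 2 ^ p = t) ∧ |ρ x - x| < ((2 : ℝ) ^ p)⁻¹

/-- Causally-masked softmax attention `softmax(Q Kᵀ + Γ) V`, where `Γ i j = 0` for `j ≤ i` and
`Γ i j = -∞` for `j > i`, so that row `i` of the softmax is supported on the `j ≤ i`. -/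
def causalAttention {N m : ℕ} (Q K V : Fin N → Fin m → ℝ) (i : Fin N) (c : Fin m) : ℝ :=
  (∑ j ∈ Finset.Iic i, Real.exp (∑ d, Q i d * K j d) * V j c) /
    ∑ j ∈ Finset.Iic i, Real.exp (∑ d, Q i d * K j d)

/-- A causally-masked transformer with context length `N`, embedding dimension `m`, depth `L`, and
`H` heads per layer, with one-dimensional input and output tokens. The query, key and value
embeddings and the output map are arbitrary functions, applied separately at each position. -/
structure CausalTransformer (N m L H : ℕ) where
  query : Fin L → Fin H → Fin N → (Fin m → ℝ) → Fin m → ℝ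
  key : Fin L → Fin H → Fin N → (Fin m → ℝ) → Fin m → ℝ
  value : Fin L → Fin H → Fin N → (Fin m → ℝ) → Fin m → ℝ
  output : Fin N → (Fin m → ℝ) → ℝ

/-- All query, key and value embeddings are `p`-bit numbers. -/
def CausalTransformer.HasPrecision {N m L H : ℕ} (T : CausalTransformer N m L H) (p : ℕ) : Prop :=
  ∀ l h i y c, IsFixedPoint p (T.query l h i y c) ∧ IsFixedPoint p (T.key l h i y c) ∧
    IsFixedPoint p (T.value l h i y c)

/-- The intermediate embeddings `X^0, X^1, …, X^L` (constant from `L` on): `X^0` is the input,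
as the first of the `m` coordinates, and
`X^{l+1} = X^l + ∑ h, f_{l,h}(X^l)` with the outputs of the heads rounded by `ρ`. -/
def CausalTransformer.embedding {N m L H : ℕ} (T : CausalTransformer N m L H) (ρ : ℝ → ℝ)
    (X : Fin N → ℝ) : ℕ → Fin N → Fin m → ℝ
  | 0 => fun i c => if c.val = 0 then X i else 0
  | l + 1 => fun i c =>
      T.embedding ρ X l i c +
        if hl : l < L then
          ∑ h : Fin H, ρ (causalAttention
            (fun j => T.query ⟨l, hl⟩ h j (T.embedding ρ X l j))
            (fun j => T.key ⟨l, hl⟩ h j (T.embedding ρ X l j))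
            (fun j => T.value ⟨l, hl⟩ h j (T.embedding ρ X l j)) i c)
        else 0

/-- The output `T(X)`. -/
def CausalTransformer.eval {N m L H : ℕ} (T : CausalTransformer N m L H) (ρ : ℝ → ℝ)
    (X : Fin N → ℝ) (i : Fin N) : ℝ :=
  T.output i (T.embedding ρ X L i)

/-- `T` computes `hop_k : Σ^N → (Σ ∪ {⊥})^N` for the alphabet `Σ = Fin σ`, where `code` represents
the elements of `Σ ∪ {⊥}` by real numbers. -/
def CausalTransformer.ComputesHop {N m L H : ℕ} (T : CausalTransformer N m L H) (ρ : ℝ → ℝ)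
    (k : ℕ) {σ : ℕ} (code : Option (Fin σ) → ℝ) : Prop :=
  ∀ (X : Fin N → Fin σ) (i : Fin N),
    T.eval ρ (fun j => code (some (X j))) i = code (hop k X i)

/-! ### Massively parallel computation -/

/-- Words of `p` bits. -/
abbrev Word (p : ℕ) : Type := ZMod (2 ^ p)

/-- Contents of a local memory: a set of pairs (message, source). In the initial memory,
an input word is paired with its index instead. -/
abbrev MachineMemory (p : ℕ) : Type := Finset (List (Word p) × ℕ)

/-- A deterministic protocol on `q` machines with words of `p` bits: a number of rounds, and for each
round and machine an arbitrary function from the contents of its memory to the set of outgoing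
messages with their destinations. -/
structure MPCProtocol (q p : ℕ) where
  rounds : ℕ
  step : ℕ → Fin q → MachineMemory p → Finset (List (Word p) × Fin q)

/-- The memory of machine `i` after `r` rounds. Initially it holds the `i`-th block of `s` input
words; after a round it holds the messages that were just received, each with its source. -/
def MPCProtocol.memory {q p : ℕ} (π : MPCProtocol q p) (s : ℕ) {nin : ℕ} (x : Fin nin → Word p) :
    ℕ → Fin q → MachineMemory p
  | 0, i => (Finset.univ.filter
      (fun ι : Fin nin => s * i.val ≤ ι.val ∧ ι.val < s * (i.val + 1))).image
        (fun ι => ([x ι], ι.val))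
  | r + 1, i => Finset.univ.biUnion (fun src : Fin q =>
      ((π.step r src (π.memory s x r src)).filter (fun md => md.2 = i)).image
        (fun md => (md.1, src.val)))

/-- On every input of `nin` words, in every round, every message has at least one word, and every
machine sends at most `s` words and receives at most `s` words. -/
def MPCProtocol.RespectsMemory {q p : ℕ} (π : MPCProtocol q p) (nin s : ℕ) : Prop :=
  ∀ (x : Fin nin → Word p) (r : ℕ), r < π.rounds → ∀ i : Fin q,
    (∀ md ∈ π.step r i (π.memory s x r i), md.1 ≠ []) ∧
    ∑ md ∈ π.step r i (π.memory s x r i), md.1.length ≤ s ∧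
    ∑ md ∈ π.memory s x (r + 1) i, md.1.length ≤ s

/-- After the last round, the memory of the first machine consists of the single output word `w`. -/
def MPCProtocol.Outputs {q p : ℕ} (π : MPCProtocol q p) (s : ℕ) {nin : ℕ} (x : Fin nin → Word p)
    (w : Word p) : Prop :=
  ∃ i : Fin q, i.val = 0 ∧ ∃ src : ℕ, π.memory s x π.rounds i = {([w], src)}

/-- The sequence `x` of `2n` words lists the edges of the graph `G` on `n` vertices and `n` edges,
each edge once and as a pair of vertices, with an arbitrary order of the edges and of the two
endpoints of each edge. -/
def SerializesGraph {n p : ℕ} (G : SimpleGraph (Fin n)) (x : Fin (2 * n) → Word p) : Prop :=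
  ∃ u v : Fin n → Fin n,
    Function.Injective (fun j => s(u j, v j)) ∧
    Set.range (fun j => s(u j, v j)) = G.edgeSet ∧
    ∀ j : Fin n,
      x ⟨2 * j.val, by omega⟩ = ((u j).val : Word p) ∧
      x ⟨2 * j.val + 1, by omega⟩ = ((v j).val : Word p)

/-- The protocol distinguishes a single cycle on `n` vertices from a disjoint union of two cycles on
`n / 2` vertices each, for all vertex labelings and all serializations. -/
def MPCProtocol.DistinguishesCycles {q p : ℕ} (π : MPCProtocol q p) (s n : ℕ) : Prop :=
  ∃ w₁ w₂ : Word p, w₁ ≠ w₂ ∧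
    ∀ (G : SimpleGraph (Fin n)) (x : Fin (2 * n) → Word p), SerializesGraph G x →
      (Nonempty (G ≃g SimpleGraph.cycleGraph n) → π.Outputs s x w₁) ∧
      (Nonempty (G ≃g (SimpleGraph.cycleGraph (n / 2) ⊕g SimpleGraph.cycleGraph (n / 2))) →
        π.Outputs s x w₂)

/-- The one-versus-two-cycle conjecture: for all `γ > 0` and `0 < δ < 1`, every `(γ, δ)`-MPC protocol
(`Θ(nin^{1+γ-δ})` machines with `O(nin^δ)` words of `Θ(log nin)` bits, for `nin = 2n` input words)
that distinguishes a cycle on `n` vertices from two cycles on `n / 2` vertices uses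
`Ω(log n)` rounds. -/
def OneVersusTwoCycleConjecture : Prop :=
  ∀ γ δ : ℝ, 0 < γ → 0 < δ → δ < 1 →
  ∀ a₁ a₂ b c₁ c₂ : ℝ, 0 < a₁ → 0 < a₂ → 0 < b → 0 < c₁ → 0 < c₂ →
  ∃ c : ℝ, 0 < c ∧ ∃ n₀ : ℕ, ∀ n : ℕ, n₀ ≤ n → Even n →
  ∀ q s p : ℕ,
    a₁ * ((2 * n : ℕ) : ℝ) ^ (1 + γ - δ) ≤ q → (q : ℝ) ≤ a₂ * ((2 * n : ℕ) : ℝ) ^ (1 + γ - δ) →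
    (s : ℝ) ≤ b * ((2 * n : ℕ) : ℝ) ^ δ →
    c₁ * Real.log ((2 * n : ℕ) : ℝ) ≤ p → (p : ℝ) ≤ c₂ * Real.log ((2 * n : ℕ) : ℝ) →
    n ≤ 2 ^ p →
  ∀ π : MPCProtocol q p, π.RespectsMemory (2 * n) s → π.DistinguishesCycles s n →
    c * Real.log n ≤ π.rounds

end

/-! A shallow transformer for `hop_k` yields a fast protocol for one versus two cycles.

Reduction. Take `n` to be a small constant times `k`. An edge list has `2 * n` half-edges, and
`nextHalfEdge` permutes them by walking along the cycles. From half-edge `0`, exactly `n / 2` steps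
lead back to the start for two cycles but not for one (`SerializesGraph.walk`). Hopping performs
this walk: the sequence consists of `k` blocks, each listing all pairs of a half-edge and its image,
and every hop moves one block to the left (`hop_seqToken`). The length is about `4 * n * k`, of
order `k ^ 2`, which fits into `N` because `ξ ≤ 1 / 2`.

Simulation. The machines are the cells of a grid of side `F`, about `(2 * n) ^ δ`, and in one round
a cell reads a line of `F` words (`gridProtocol_outputs`, `gridProtocol_respectsMemory`). Since `m <
F`, a line can hold a whole embedding. An index of polynomial size is spread over constantly many
coordinates, so fetching a value at a computed index, or taking a sum or maximum over an index,
costs constantly many rounds (`computes_lookup`, `computes_reduce`). The grid has polynomially many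
cells, which a large constant `γ` allows.

Softmax. The sums in a softmax are real numbers, while words have `O(log n)` bits. A rounded output
is determined by its comparisons with the multiples of `2⁻ᵖ` in its range, and each comparison is
the sign of a sum of terms `exp(s) * (v - θ)`. Only polynomially many pairs `(s, v)` occur, so
simultaneous Diophantine approximation replaces these weights by integers with polynomially many
bits without changing any sign (`exists_integer_weights`). These integers are still too long for a
word, but the sign of their sum can be read off from residues of the sums of `W / 2 ^ r`, computed
for all levels `r` in parallel (`codeSign_sup_levelCode`). Thus a layer costs `O(1)` rounds
(`computes_layers`), and the lower bound on rounds becomes one on `L`. -/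

/-! ### Computations on a grid -/

/-- One synchronous round on the grid `α → Fin F`: every cell computes its new value from the
values on its line in the direction `dir`. -/
structure LineStep (α : Type) (F : ℕ) (W : Type) where
  dir : α
  op : (α → Fin F) → (Fin F → W) → W

/-- The values after one round. -/
def LineStep.apply {α W : Type} {F : ℕ} [DecidableEq α] (S : LineStep α F W)
    (v : (α → Fin F) → W) (y : α → Fin F) : W :=
  S.op y fun u => v (Function.update y S.dir u)

/-- The values after several rounds. -/
def runSteps {α W : Type} {F : ℕ} [DecidableEq α] (S : ℕ → LineStep α F W)
    (v : (α → Fin F) → W) : ℕ → (α → Fin F) → W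
  | 0 => v
  | t + 1 => (S t).apply (runSteps S v t)

open Classical in
/-- The initial values on the grid: the `ι`-th input word is loaded at the cell `place ι`. -/
noncomputable def gridInit {α W : Type} {F nin p : ℕ} (place : Fin nin → α → Fin F)
    (load : Word p → W) (w₀ : W) (x : Fin nin → Word p) (y : α → Fin F) : W :=
  if h : ∃ ι, place ι = y then load (x h.choose) else w₀

theorem gridInit_place {α W : Type} {F nin p : ℕ} {place : Fin nin → α → Fin F}
    (hplace : Function.Injective place) (load : Word p → W) (w₀ : W) (x : Fin nin → Word p)
    (ι : Fin nin) : gridInit place load w₀ x (place ι) = load (x ι) := by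
  have h : ∃ ι', place ι' = place ι := ⟨ι, rfl⟩
  rw [gridInit, dif_pos h, hplace h.choose_spec]

theorem gridInit_of_forall_ne {α W : Type} {F nin p : ℕ} {place : Fin nin → α → Fin F}
    (load : Word p → W) (w₀ : W) (x : Fin nin → Word p)
    {y : α → Fin F} (hy : ∀ ι, place ι ≠ y) : gridInit place load w₀ x y = w₀ := by
  rw [gridInit, dif_neg]
  rintro ⟨ι, h⟩
  exact hy ι h

/-! ### Realising a grid computation by a protocol -/

section Protocol

variable {α W : Type} {F nin p q : ℕ} [DecidableEq α]

open Classical in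
/-- The value of the cell `y` after `t` rounds, read off from the memory of its machine. -/
noncomputable def decodeMem (S : ℕ → LineStep α F W) (e : (α → Fin F) → Fin q) (dec : Word p → W)
    (load : Word p → W) (w₀ : W) (y : α → Fin F) : ℕ → MachineMemory p → W
  | 0, mem => if h : ∃ w src, ([w], src) ∈ mem then load h.choose else w₀
  | t + 1, mem => (S t).op y fun u =>
      if h : ∃ w, ([w], (e (Function.update y (S t).dir u)).val) ∈ mem then dec h.choose else w₀

open Classical in
/-- The protocol with one machine for each cell of the grid. The first round loads the input words
and the last one sends the output to the first machine. -/
noncomputable def gridProtocol (S : ℕ → LineStep α F W) (r : ℕ) (e : (α → Fin F) → Fin q)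
    (enc : W → Word p) (dec : Word p → W) (place : Fin nin → α → Fin F) (load : Word p → W) (w₀ : W)
    (y₀ : α → Fin F) (out : W → Word p) : MPCProtocol q p where
  rounds := r + 2
  step
    | 0, i, mem => mem.image fun md =>
        (md.1, if h : md.2 < nin then e (place ⟨md.2, h⟩) else i)
    | t + 1, i, mem =>
        if t < r then
          if h : ∃ y, e y = i then
            Finset.univ.image fun u : Fin F =>
              ([enc (decodeMem S e dec load w₀ h.choose t mem)],
                e (Function.update h.choose (S t).dir u))
          else ∅
        else if i = e y₀ then
          {([out (decodeMem S e dec load w₀ y₀ t mem)], ⟨0, (e y₀).pos⟩)}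
        else ∅

theorem MPCProtocol.mem_memory_succ (π : MPCProtocol q p) (s : ℕ) (x : Fin nin → Word p) (r : ℕ)
    (i : Fin q) (l : List (Word p)) (src : ℕ) :
    (l, src) ∈ π.memory s x (r + 1) i ↔
      ∃ j : Fin q, (l, i) ∈ π.step r j (π.memory s x r j) ∧ j.val = src := by
  simp only [MPCProtocol.memory, Finset.mem_biUnion, Finset.mem_univ, true_and, Finset.mem_image,
    Finset.mem_filter, Prod.mk.injEq, Prod.exists]
  constructor
  · rintro ⟨j, l', i', ⟨h, rfl⟩, rfl, rfl⟩
    exact ⟨j, h, rfl⟩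
  · rintro ⟨j, h, rfl⟩
    exact ⟨j, l, i, ⟨h, rfl⟩, rfl, rfl⟩

theorem sum_length_le_card {β : Type*} (A : Finset (List (Word p) × β))
    (hA : ∀ md ∈ A, md.1.length = 1) : ∑ md ∈ A, md.1.length = A.card := by
  rw [Finset.sum_congr rfl hA]; simp

section

variable (S : ℕ → LineStep α F W) (r : ℕ) (e : (α → Fin F) → Fin q)
    (enc : W → Word p) (dec : Word p → W) (place : Fin nin → α → Fin F) (load : Word p → W) (w₀ : W)
    (y₀ : α → Fin F) (out : W → Word p)

local notation "Π₀" => gridProtocol S r e enc dec place load w₀ y₀ out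

theorem gridProtocol_memory_one {s : ℕ} (hs : 0 < s) (hq : nin ≤ q)
    (x : Fin nin → Word p) (i : Fin q) (l : List (Word p)) (src : ℕ) :
    (l, src) ∈ (Π₀).memory s x 1 i ↔
      ∃ ι : Fin nin, l = [x ι] ∧ e (place ι) = i ∧ src = ι.val / s := by
  rw [MPCProtocol.mem_memory_succ]
  simp only [MPCProtocol.memory, gridProtocol, Finset.mem_image, Finset.mem_filter,
    Finset.mem_univ, true_and, Prod.mk.injEq, Prod.exists]
  constructor
  · rintro ⟨j, ⟨_, _, ⟨ι, ⟨h1, h2⟩, rfl, rfl⟩, rfl, h⟩, rfl⟩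
    refine ⟨ι, rfl, ?_, ?_⟩
    · simpa using h
    · exact (Nat.div_eq_of_lt_le (by rw [mul_comm]; exact h1) (by rw [mul_comm]; exact h2)).symm
  · rintro ⟨ι, rfl, rfl, rfl⟩
    have hj : ι.val / s < q := lt_of_le_of_lt (Nat.div_le_self _ _) (ι.isLt.trans_le hq)
    refine ⟨⟨ι.val / s, hj⟩, ⟨_, _, ⟨ι, ⟨Nat.mul_div_le _ _, ?_⟩, rfl, rfl⟩, rfl, ?_⟩, rfl⟩
    · exact Nat.lt_mul_div_succ _ hs
    · simp

theorem gridProtocol_memory_succ (he : Function.Injective e) {s : ℕ}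
    (x : Fin nin → Word p) {t : ℕ} (ht : t < r) (i : Fin q) (l : List (Word p)) (src : ℕ) :
    (l, src) ∈ (Π₀).memory s x (t + 2) i ↔
      ∃ y u, e (Function.update y (S t).dir u) = i ∧ src = (e y).val ∧
        l = [enc (decodeMem S e dec load w₀ y t ((Π₀).memory s x (t + 1) (e y)))] := by
  rw [MPCProtocol.mem_memory_succ]
  constructor
  · rintro ⟨j, h, rfl⟩
    simp only [gridProtocol, ht, if_true] at h
    split_ifs at h with hj
    · simp only [Finset.mem_image, Finset.mem_univ, true_and, Prod.mk.injEq] at h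
      obtain ⟨u, rfl, rfl⟩ := h
      refine ⟨hj.choose, u, rfl, ?_, ?_⟩
      · rw [hj.choose_spec]
      · rw [hj.choose_spec]; rfl
    · simp at h
  · rintro ⟨y, u, rfl, rfl, rfl⟩
    refine ⟨e y, ?_, rfl⟩
    have hj : ∃ y', e y' = e y := ⟨y, rfl⟩
    have hy : hj.choose = y := he hj.choose_spec
    simp only [gridProtocol, ht, if_true]
    rw [dif_pos hj, hy]
    simp only [Finset.mem_image, Finset.mem_univ, true_and, Prod.mk.injEq]
    exact ⟨u, rfl⟩

/-- Lying on a common line is symmetric, so a cell that sends its value along its line also hears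
from every cell of that line. As `e` is injective, the source of a message identifies the sending
cell. -/
theorem decodeMem_gridProtocol (he : Function.Injective e) (hplace : Function.Injective place)
    (hdec : ∀ w, dec (enc w) = w) {s : ℕ} (hs : 0 < s) (hq : nin ≤ q) (x : Fin nin → Word p) :
    ∀ t, t ≤ r → ∀ y, decodeMem S e dec load w₀ y t ((Π₀).memory s x (t + 1) (e y)) =
      runSteps S (gridInit place load w₀ x) t y := by
  intro t
  induction t with
  | zero =>
    intro _ y
    simp only [decodeMem, runSteps, zero_add]
    split_ifs with h
    · have h' := h.choose_spec
      obtain ⟨src, h'⟩ := h'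
      rw [gridProtocol_memory_one S r e enc dec place load w₀ y₀ out hs hq] at h'
      obtain ⟨ι, h1, h2, -⟩ := h'
      have h3 := gridInit_place hplace load w₀ x ι
      rw [he h2] at h3
      rw [h3]
      exact congrArg load (by simpa using h1)
    · rw [gridInit_of_forall_ne]
      rintro ι rfl
      exact h ⟨x ι, _, (gridProtocol_memory_one S r e enc dec place load w₀ y₀ out hs hq x _ _ _).2
        ⟨ι, rfl, rfl, rfl⟩⟩
  | succ t ih =>
    intro ht y
    simp only [decodeMem, runSteps, LineStep.apply]
    congr 1
    funext u
    have hex : ∃ w, ([w], (e (Function.update y (S t).dir u)).val) ∈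
        (Π₀).memory s x (t + 1 + 1) (e y) := by
      refine ⟨_, (gridProtocol_memory_succ S r e enc dec place load w₀ y₀ out he x ht _ _ _).2
        ⟨Function.update y (S t).dir u, y (S t).dir, ?_, rfl, rfl⟩⟩
      simp
    rw [dif_pos hex]
    obtain ⟨y', u', h1, h2, h3⟩ :=
      (gridProtocol_memory_succ S r e enc dec place load w₀ y₀ out he x ht _ _ _).1 hex.choose_spec
    have hy' : y' = Function.update y (S t).dir u := he (Fin.ext h2.symm)
    have h4 := List.singleton_inj.1 h3
    rw [h4, hdec, ih (by omega), hy']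

theorem gridProtocol_outputs (he : Function.Injective e) (hplace : Function.Injective place)
    (hdec : ∀ w, dec (enc w) = w) {s : ℕ} (hs : 0 < s) (hq : nin ≤ q) (x : Fin nin → Word p) :
    (Π₀).Outputs s x (out (runSteps S (gridInit place load w₀ x) r y₀)) := by
  refine ⟨⟨0, (e y₀).pos⟩, rfl, (e y₀).val, ?_⟩
  ext ⟨l, src⟩
  change (l, src) ∈ (Π₀).memory s x (r + 1 + 1) _ ↔ _
  rw [MPCProtocol.mem_memory_succ, Finset.mem_singleton, Prod.mk.injEq]
  have key : ∀ j, (Π₀).step (r + 1) j ((Π₀).memory s x (r + 1) j) = if j = e y₀ then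
      {([out (runSteps S (gridInit place load w₀ x) r y₀)], ⟨0, (e y₀).pos⟩)} else ∅ := by
    intro j
    by_cases hj : j = e y₀
    · subst hj
      rw [← decodeMem_gridProtocol S r e enc dec place load w₀ y₀ out he hplace hdec hs hq x r le_rfl]
      simp [gridProtocol]
    · simp [gridProtocol, hj]
  constructor
  · rintro ⟨j, h, rfl⟩
    rw [key] at h
    split_ifs at h with hj
    · rw [Finset.mem_singleton, Prod.mk.injEq] at h
      exact ⟨h.1, by rw [hj]⟩
    · simp at h
  · rintro ⟨rfl, rfl⟩
    exact ⟨e y₀, by rw [key, if_pos rfl]; simp, rfl⟩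

/-- Every message is a single word, so it suffices to count messages: a block of `s` input words
when loading, at most `F` on a line, one for the output. In the loading round each machine receives
at most one word because `place` and `e` are injective. -/
theorem gridProtocol_respectsMemory (he : Function.Injective e) (hplace : Function.Injective place)
    {s : ℕ} (hs : 0 < s) (hF : F ≤ s) (hq : nin ≤ q) :
    (Π₀).RespectsMemory nin s := by
  intro x t ht i
  have hlen : ∀ t' < r + 2, ∀ j, ∀ md ∈ (Π₀).step t' j ((Π₀).memory s x t' j), md.1.length = 1 := by
    intro t' ht' j md hmd
    match t', ht', hmd with
    | 0, _, hmd =>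
      simp only [gridProtocol, MPCProtocol.memory, Finset.mem_image] at hmd
      obtain ⟨_, ⟨ι, -, rfl⟩, rfl⟩ := hmd
      rfl
    | t + 1, ht', hmd =>
      simp only [gridProtocol] at hmd
      split_ifs at hmd
      · simp only [Finset.mem_image] at hmd
        obtain ⟨u, -, rfl⟩ := hmd
        rfl
      · simp at hmd
      · rw [Finset.mem_singleton] at hmd
        rw [hmd]; rfl
      · simp at hmd
  refine ⟨fun md hmd h => ?_, ?_, ?_⟩
  · have := hlen t ht i md hmd
    rw [h] at this
    simp at this
  · rw [sum_length_le_card _ (hlen t ht i)]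
    match t, ht with
    | 0, _ =>
      simp only [gridProtocol, MPCProtocol.memory]
      refine Finset.card_image_le.trans (Finset.card_image_le.trans ?_)
      have : ((Finset.univ.filter (fun ι : Fin nin => s * i.val ≤ ι.val ∧
          ι.val < s * (i.val + 1))).map Fin.valEmbedding) ⊆
          Finset.Ico (s * i.val) (s * (i.val + 1)) := by
        intro a ha
        simp only [Finset.mem_map, Finset.mem_filter, Finset.mem_univ, true_and] at ha
        obtain ⟨ι, h, rfl⟩ := ha
        exact Finset.mem_Ico.2 h
      have := Finset.card_le_card this
      rw [Finset.card_map, Nat.card_Ico, ← Nat.mul_sub] at this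
      simpa using this
    | t + 1, _ =>
      simp only [gridProtocol]
      split_ifs
      · exact Finset.card_image_le.trans (by simpa using hF)
      · simp
      · simpa using Nat.succ_le_of_lt hs
      · simp
  · have hlen' : ∀ md ∈ (Π₀).memory s x (t + 1) i, md.1.length = 1 := by
      rintro ⟨l, src⟩ hmd
      obtain ⟨j, hj, -⟩ := (MPCProtocol.mem_memory_succ _ _ _ _ _ _ _).1 hmd
      exact hlen t ht j _ hj
    rw [sum_length_le_card _ hlen']
    match t, ht with
    | 0, _ =>
      refine le_trans (Finset.card_le_one.2 ?_) hs
      rintro ⟨l, src⟩ h ⟨l', src'⟩ h'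
      rw [gridProtocol_memory_one S r e enc dec place load w₀ y₀ out hs hq] at h h'
      obtain ⟨ι, rfl, h1, rfl⟩ := h
      obtain ⟨ι', rfl, h2, rfl⟩ := h'
      rw [hplace (he (h1.trans h2.symm))]
    | t + 1, ht =>
      rcases Nat.lt_or_ge t r with htr | htr
      · by_cases hi : ∃ z, e z = i
        · obtain ⟨z, rfl⟩ := hi
          refine le_trans (Finset.card_le_card (t := Finset.univ.image fun u : Fin F =>
            ([enc (decodeMem S e dec load w₀ (Function.update z (S t).dir u) t
              ((Π₀).memory s x (t + 1) (e (Function.update z (S t).dir u))))],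
              (e (Function.update z (S t).dir u)).val)) ?_)
            (Finset.card_image_le.trans (by simpa using hF))
          rintro ⟨l, src⟩ h
          rw [gridProtocol_memory_succ S r e enc dec place load w₀ y₀ out he x htr] at h
          obtain ⟨y, u, h1, rfl, rfl⟩ := h
          -- A sender that reaches `z` lies on the line through `z`, so one coordinate determines it
          -- and there are at most `F` senders.
          have : Function.update z (S t).dir (y (S t).dir) = y := by
            rw [← he h1]; simp
          exact Finset.mem_image.2 ⟨y (S t).dir, Finset.mem_univ _, by rw [this]⟩
        · refine le_trans (Finset.card_le_one.2 ?_) hs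
          rintro ⟨l, src⟩ h
          rw [gridProtocol_memory_succ S r e enc dec place load w₀ y₀ out he x htr] at h
          obtain ⟨y, u, h1, -⟩ := h
          exact absurd ⟨_, h1⟩ hi
      · refine le_trans (Finset.card_le_one.2 ?_) hs
        have : ∀ l src, (l, src) ∈ (Π₀).memory s x (t + 1 + 1) i → src = (e y₀).val ∧
            l = [out (decodeMem S e dec load w₀ y₀ t ((Π₀).memory s x (t + 1) (e y₀)))] := by
          intro l src h
          obtain ⟨j, hj, rfl⟩ := (MPCProtocol.mem_memory_succ _ _ _ _ _ _ _).1 h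
          simp only [gridProtocol, htr.not_gt, if_false] at hj
          split_ifs at hj with hj'
          · rw [Finset.mem_singleton, Prod.mk.injEq] at hj
            subst hj'
            exact ⟨rfl, hj.1⟩
          · simp at hj
        rintro ⟨l, src⟩ h ⟨l', src'⟩ h'
        rw [(this _ _ h).1, (this _ _ h).2, (this _ _ h').1, (this _ _ h').2]

end

end Protocol

/-! ### Composable grid computations -/

/-- Some sequence of `r` rounds takes the values `v x` to the values `v' x`, for every `x`. -/
def Computes {X α W : Type} {F : ℕ} [DecidableEq α] (r : ℕ) (v v' : X → (α → Fin F) → W) : Prop :=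
  ∃ S : ℕ → LineStep α F W, ∀ x, runSteps S (v x) r = v' x

theorem runSteps_congr {α W : Type} {F : ℕ} [DecidableEq α] {S S' : ℕ → LineStep α F W}
    (v : (α → Fin F) → W) {r : ℕ} (h : ∀ t < r, S t = S' t) : runSteps S v r = runSteps S' v r := by
  induction r with
  | zero => rfl
  | succ r ih => simp only [runSteps]; rw [ih fun t ht => h t (by omega), h r (by omega)]

theorem runSteps_add {α W : Type} {F : ℕ} [DecidableEq α] (S : ℕ → LineStep α F W)
    (v : (α → Fin F) → W) (r t : ℕ) :
    runSteps S v (r + t) = runSteps (fun i => S (r + i)) (runSteps S v r) t := by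
  induction t with
  | zero => rfl
  | succ t ih => rw [← add_assoc]; simp only [runSteps]; rw [ih]

theorem Computes.trans {X α W : Type} {F : ℕ} [DecidableEq α] {r r' : ℕ}
    {v v' v'' : X → (α → Fin F) → W} (h : Computes r v v') (h' : Computes r' v' v'') :
    Computes (r + r') v v'' := by
  obtain ⟨S, hS⟩ := h
  obtain ⟨S', hS'⟩ := h'
  refine ⟨fun t => if t < r then S t else S' (t - r), fun x => ?_⟩
  rw [runSteps_add, ← hS', ← hS]
  rw [runSteps_congr (S' := S) (v x) (r := r) (by intro t ht; simp [ht])]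
  exact runSteps_congr _ (by intro t _; simp)

theorem Computes.congr {X α W : Type} {F : ℕ} [DecidableEq α] {r : ℕ}
    {v v' v'' : X → (α → Fin F) → W} (h : Computes r v v') (h' : ∀ x y, v' x y = v'' x y) :
    Computes r v v'' := by
  have : v' = v'' := funext fun x => funext fun y => h' x y
  exact this ▸ h

theorem Computes.iterate {X α W : Type} {F : ℕ} [DecidableEq α] [Nonempty α] [Nonempty W] {r : ℕ}
    {v : ℕ → X → (α → Fin F) → W} {L : ℕ} (h : ∀ l < L, Computes r (v l) (v (l + 1))) :
    Computes (L * r) (v 0) (v L) := by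
  induction L with
  | zero =>
    rw [Nat.zero_mul]
    -- No round is run, but a schedule is a total function of time and needs some value; this is why
    -- nonemptiness is assumed.
    exact ⟨fun _ => ⟨Classical.arbitrary α, fun _ _ => Classical.arbitrary W⟩, fun _ => rfl⟩
  | succ L ih =>
    rw [Nat.succ_mul]
    exact (ih fun l hl => h l (by omega)).trans (h L (by omega))

theorem computes_step {X α W : Type} {F : ℕ} [DecidableEq α] (v : X → (α → Fin F) → W) (d : α)
    (op : (α → Fin F) → (Fin F → W) → W) :
    Computes 1 v fun x y => op y fun u => v x (Function.update y d u) :=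
  ⟨fun _ => ⟨d, op⟩, fun _ => rfl⟩

theorem extend_castSucc_update {α β : Type} [DecidableEq α] {κ : ℕ} {b : Fin (κ + 1) → α}
    (hb : Function.Injective b) (w : Fin (κ + 1) → β) (y : α → β) :
    Function.extend (fun a : Fin κ => b a.castSucc) (fun a => w a.castSucc)
      (Function.update y (b (Fin.last κ)) (w (Fin.last κ))) = Function.extend b w y := by
  funext a
  by_cases h : ∃ i, b i = a
  · obtain ⟨i, rfl⟩ := h
    rw [hb.extend_apply]
    induction i using Fin.lastCases with
    | last =>
      rw [Function.extend_apply', Function.update_self]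
      rintro ⟨i, hi⟩
      exact absurd (hb hi) (Fin.castSucc_lt_last i).ne
    | cast i =>
      exact (hb.comp (Fin.castSucc_injective κ)).extend_apply (fun a : Fin κ => w a.castSucc) _ i
  · rw [Function.extend_apply' _ _ _ h, Function.extend_apply', Function.update_of_ne]
    · exact fun h' => h ⟨_, h'.symm⟩
    · rintro ⟨i, hi⟩
      exact h ⟨_, hi⟩

/-- The coordinates of the block are replaced one per round. The address `φ` must be insensitive to
the block, so that all cells met on the way agree on it. The first component stays in place. -/
theorem computes_block_lookup {X α P W : Type} {F : ℕ} [DecidableEq α] {κ : ℕ} {b : Fin κ → α}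
    (hb : Function.Injective b) (hne : Nonempty α) (hW : Nonempty W) (hP : Nonempty P)
    (v : X → (α → Fin F) → P × W)
    (φ : (α → Fin F) → Fin κ → Fin F) (hφ : ∀ y a u, φ (Function.update y (b a) u) = φ y) :
    Computes κ v fun x y => ((v x y).1, (v x (Function.extend b (φ y) y)).2) := by
  induction κ with
  | zero =>
    refine ⟨fun _ => ⟨Classical.arbitrary α, fun _ _ => Classical.arbitrary _⟩, fun x => ?_⟩
    funext y
    have : Function.extend b (φ y) y = y := by
      funext a
      rw [Function.extend_apply']
      rintro ⟨i, -⟩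
      exact i.elim0
    simp [runSteps, this]
  | succ κ ih =>
    refine ((ih (b := fun a => b a.castSucc) (hb.comp (Fin.castSucc_injective κ))
      (fun y a => φ y a.castSucc) (fun y a u => by rw [hφ])).trans (computes_step _ (b (Fin.last κ))
        fun y w => ((w (y (b (Fin.last κ)))).1, (w (φ y (Fin.last κ))).2))).congr fun x y => ?_
    simp only [Function.update_eq_self, hφ, extend_castSucc_update hb]

/-- The block is reduced along one coordinate per round. The hypothesis `hred` is the associativity
that allows partial results to be merged, and `hred₁` covers the empty block. Every cell ends up
with the result for its block. -/
theorem computes_block_reduce {X α P W : Type} {F : ℕ} [DecidableEq α] {κ : ℕ} {b : Fin κ → α}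
    (hb : Function.Injective b) (hne : Nonempty α) (hW : Nonempty W) (hP : Nonempty P)
    (v : X → (α → Fin F) → P × W)
    (red : Multiset W → W) (hred : ∀ s : Multiset (Multiset W), red (s.map red) = red s.join)
    (hred₁ : ∀ w, red {w} = w) :
    Computes κ v fun x y =>
      ((v x y).1, red (Finset.univ.val.map fun z => (v x (Function.extend b z y)).2)) := by
  induction κ with
  | zero =>
    refine ⟨fun _ => ⟨Classical.arbitrary α, fun _ _ => Classical.arbitrary _⟩, fun x => ?_⟩
    funext y
    have : ∀ z, Function.extend b z y = y := by
      intro z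
      funext a
      rw [Function.extend_apply']
      rintro ⟨i, -⟩
      exact i.elim0
    simp [runSteps, this, hred₁]
  | succ κ ih =>
    refine ((ih (b := fun a => b a.castSucc) (hb.comp (Fin.castSucc_injective κ))).trans
      (computes_step _ (b (Fin.last κ)) fun y w =>
        ((w (y (b (Fin.last κ)))).1,
          red (Finset.univ.val.map fun u => (w u).2)))).congr fun x y => ?_
    simp only [Function.update_eq_self, Prod.mk.injEq, true_and]
    set f : (Fin (κ + 1) → Fin F) → W := fun z => (v x (Function.extend b z y)).2 with hf
    have h1 : ∀ u : Fin F, ∀ z : Fin κ → Fin F, (v x (Function.extend (fun a => b a.castSucc) z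
        (Function.update y (b (Fin.last κ)) u))).2 = f (Fin.snoc z u) := by
      intro u z
      have := extend_castSucc_update hb (Fin.snoc z u : Fin (κ + 1) → Fin F) y
      simp only [Fin.snoc_castSucc, Fin.snoc_last] at this
      rw [this]
    simp only [h1]
    -- The inner multisets are the fibres over the last coordinate; `Fin.snoc` reassembles them into
    -- all points of the block.
    have h2 := hred (Finset.univ.val.map fun u : Fin F =>
      Finset.univ.val.map fun z : Fin κ → Fin F => f (Fin.snoc z u))
    rw [Multiset.map_map] at h2
    refine h2.trans ?_
    congr 1
    change Multiset.bind _ _ = _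
    have h3 := Multiset.map_univ_val_equiv (Fin.snocEquiv fun _ : Fin (κ + 1) => Fin F)
    rw [← h3, Multiset.map_map, ← Finset.univ_product_univ, Finset.product_val]
    rw [show (Finset.univ.val ×ˢ Finset.univ.val : Multiset (Fin F × (Fin κ → Fin F))) =
      Finset.univ.val.bind fun u => Finset.univ.val.map (Prod.mk u) from rfl, Multiset.map_bind]
    simp only [Multiset.map_map]
    rfl

/-! ### Grids with five blocks of `κ` coordinates and one extra coordinate -/

/-- Coordinates of the grid: five blocks of `κ` coordinates and an extra one. -/
abbrev BlockCoord (κ : ℕ) : Type := Option (Fin 5 × Fin κ)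

/-- The number that is written in block `b`, in base `F`. -/
def blockIndex {κ F : ℕ} (y : BlockCoord κ → Fin F) (b : Fin 5) : ℕ :=
  (finFunctionFinEquiv fun a => y (some (b, a))).val

theorem blockIndex_lt {κ F : ℕ} (y : BlockCoord κ → Fin F) (b : Fin 5) : blockIndex y b < F ^ κ :=
  Fin.isLt _

/-- A state whose values depend on the numbers in the blocks and on the extra coordinate. -/
def liftState {κ F : ℕ} {W : Type} (g : (Fin 5 → ℕ) → Fin F → W) (y : BlockCoord κ → Fin F) : W :=
  g (blockIndex y) (y none)

theorem block_injective {κ : ℕ} (b : Fin 5) :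
    Function.Injective fun a : Fin κ => (some (b, a) : BlockCoord κ) := by
  intro a a' h
  simpa using h

theorem blockIndex_extend {κ F : ℕ} (y : BlockCoord κ → Fin F) (b : Fin 5) (z : Fin κ → Fin F) :
    blockIndex (Function.extend (fun a : Fin κ => (some (b, a) : BlockCoord κ)) z y) =
      Function.update (blockIndex y) b (finFunctionFinEquiv z).val := by
  funext b'
  by_cases h : b' = b
  · subst h
    rw [Function.update_self, blockIndex]
    congr 2
    funext a
    exact (block_injective b').extend_apply z y a
  · rw [Function.update_of_ne h, blockIndex, blockIndex]
    congr 2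
    funext a
    apply Function.extend_apply'
    rintro ⟨a', ha⟩
    simp only [Option.some.injEq, Prod.mk.injEq] at ha
    exact h ha.1.symm

theorem extend_block_none {κ F : ℕ} (y : BlockCoord κ → Fin F) (b : Fin 5) (z : Fin κ → Fin F) :
    Function.extend (fun a : Fin κ => (some (b, a) : BlockCoord κ)) z y none = y none := by
  apply Function.extend_apply'
  rintro ⟨a', ha⟩
  simp at ha

theorem computes_line {X W : Type} {κ F : ℕ} (g : X → (Fin 5 → ℕ) → Fin F → W)
    (op : (Fin 5 → ℕ) → Fin F → (Fin F → W) → W) :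
    Computes 1 (fun x => liftState (κ := κ) (g x))
      (fun x => liftState fun i c => op i c (g x i)) := by
  refine (computes_step _ none fun y w => op (blockIndex y) (y none) w).congr fun x y => ?_
  have : ∀ u, blockIndex (Function.update y none u) = blockIndex y := by
    intro u
    funext b
    simp [blockIndex]
  simp [liftState, this]

theorem computes_lookup {X P W : Type} [Nonempty P] [Nonempty W] {κ F : ℕ}
    (g : X → (Fin 5 → ℕ) → Fin F → P × W) (b : Fin 5) (φ : (Fin 5 → ℕ) → ℕ)
    (hφ : ∀ i j, φ (Function.update i b j) = φ i)
    (hlt : ∀ i, (∀ b', i b' < F ^ κ) → φ i < F ^ κ) :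
    Computes κ (fun x => liftState (κ := κ) (g x))
      (fun x => liftState fun i c => ((g x i c).1, (g x (Function.update i b (φ i)) c).2)) := by
  refine (computes_block_lookup (block_injective b) ⟨none⟩ ‹_› ‹_› _
    (fun y => finFunctionFinEquiv.symm ⟨φ (blockIndex y), hlt _ (blockIndex_lt y)⟩)
    fun y a u => ?_).congr fun x y => ?_
  · congr 2
    -- Changing one digit is a special case of overwriting the whole block, to which `hφ` applies.
    have : Function.update y (some (b, a)) u = Function.extend
        (fun a : Fin κ => (some (b, a) : BlockCoord κ))
        (Function.update (fun a => y (some (b, a))) a u) y := by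
      funext d
      by_cases h : ∃ a', (some (b, a') : BlockCoord κ) = d
      · obtain ⟨a', rfl⟩ := h
        rw [(block_injective b).extend_apply]
        by_cases h : a' = a
        · subst h; simp
        · rw [Function.update_of_ne h, Function.update_of_ne (by simpa using h)]
      · rw [Function.extend_apply' _ _ _ h, Function.update_of_ne]
        rintro rfl
        exact h ⟨a, rfl⟩
    rw [this, blockIndex_extend, hφ]
  · simp only [liftState, blockIndex_extend, extend_block_none, Equiv.apply_symm_apply]

theorem computes_reduce {X P W : Type} [Nonempty P] [Nonempty W] {κ F : ℕ}
    (g : X → (Fin 5 → ℕ) → Fin F → P × W) (b : Fin 5)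
    (red : Multiset W → W) (hred : ∀ s : Multiset (Multiset W), red (s.map red) = red s.join)
    (hred₁ : ∀ w, red {w} = w) :
    Computes κ (fun x => liftState (κ := κ) (g x))
      (fun x => liftState fun i c => ((g x i c).1,
        red ((Multiset.range (F ^ κ)).map fun j => (g x (Function.update i b j) c).2))) := by
  refine (computes_block_reduce (block_injective b) ⟨none⟩ ‹_› ‹_› _ red hred hred₁).congr
    fun x y => ?_
  simp only [liftState, blockIndex_extend, extend_block_none]
  congr 2
  have h1 := Multiset.map_univ_val_equiv (finFunctionFinEquiv (m := F) (n := κ))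
  have h2 : Multiset.range (F ^ κ) = (Finset.univ : Finset (Fin (F ^ κ))).val.map Fin.val := by
    have := congrArg Finset.val (Fin.map_valEmbedding_univ (n := F ^ κ))
    rw [Nat.Iio_eq_range] at this
    exact this.symm
  rw [h2, ← h1, Multiset.map_map, Multiset.map_map]
  rfl

theorem computes_sum {X P W : Type} [Nonempty P] [AddCommMonoid W] {κ F : ℕ}
    (g : X → (Fin 5 → ℕ) → Fin F → P × W) (b : Fin 5) :
    Computes κ (fun x => liftState (κ := κ) (g x))
      (fun x => liftState fun i c => ((g x i c).1,
        ∑ j ∈ Finset.range (F ^ κ), (g x (Function.update i b j) c).2)) :=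
  computes_reduce g b Multiset.sum (fun _ => Multiset.sum_join.symm) Multiset.sum_singleton

/-- The maximum of residues, as natural numbers. -/
def residueMax {M : ℕ} (s : Multiset (ZMod M)) : ZMod M := ((s.map ZMod.val).sup : ℕ)

theorem val_residueMax {M : ℕ} [NeZero M] (s : Multiset (ZMod M)) :
    (residueMax s).val = (s.map ZMod.val).sup := by
  apply ZMod.val_cast_of_lt
  refine lt_of_le_of_lt (b := M - 1) ?_ (Nat.sub_lt (NeZero.pos M) one_pos)
  rw [Multiset.sup_le]
  intro a ha
  obtain ⟨w, -, rfl⟩ := Multiset.mem_map.1 ha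
  exact Nat.le_sub_one_of_lt (ZMod.val_lt w)

/-- The maximum of canonical representatives is again below `M`, so merging partial maxima loses
nothing. -/
theorem computes_max {X P : Type} [Nonempty P] {M κ F : ℕ} [NeZero M]
    (g : X → (Fin 5 → ℕ) → Fin F → P × ZMod M) (b : Fin 5) :
    Computes κ (fun x => liftState (κ := κ) (g x))
      (fun x => liftState fun i c => ((g x i c).1,
        (((Finset.range (F ^ κ)).sup fun j => (g x (Function.update i b j) c).2.val : ℕ) :
          ZMod M))) := by
  refine (computes_reduce g b residueMax (fun s => ?_) (fun w => ?_)).congr fun x y => ?_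
  · have : ∀ s : Multiset (Multiset (ZMod M)),
        ((s.map residueMax).map ZMod.val).sup = (s.join.map ZMod.val).sup := by
      intro s
      induction s using Multiset.induction with
      | empty => simp
      | cons a s ih =>
        rw [Multiset.join_cons, Multiset.map_add, Multiset.sup_add, Multiset.map_cons,
          Multiset.map_cons, Multiset.sup_cons, ih, val_residueMax]
    rw [residueMax, this, residueMax]
  · simp [residueMax]
  · simp only [liftState, residueMax, Multiset.map_map]
    rfl

/-! ### Integer weights with the same signs -/

/-- Dirichlet's pigeonhole argument: among `Q ^ card + 1` multiples of the vector `a`, two have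
fractional parts in the same cube of side `1 / Q`, and their difference is nearly integral. -/
theorem exists_simultaneous_approximation {ι : Type*} [Fintype ι] (a : ι → ℝ) {Q : ℕ} (hQ : 0 < Q) :
    ∃ q : ℕ, 0 < q ∧ q ≤ Q ^ Fintype.card ι ∧ ∃ P : ι → ℤ, ∀ i, |q * a i - P i| < 1 / Q := by
  classical
  have hQ' : (0 : ℝ) < Q := by exact_mod_cast hQ
  let g : Fin (Q ^ Fintype.card ι + 1) → ι → Fin Q := fun t i =>
    ⟨⌊(Q : ℝ) * Int.fract (t.val * a i)⌋₊, by
      rw [Nat.floor_lt (by have := Int.fract_nonneg ((t.val : ℝ) * a i); positivity)]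
      exact mul_lt_of_lt_one_right hQ' (Int.fract_lt_one _)⟩
  obtain ⟨t₁, t₂, hne, hg⟩ := Fintype.exists_ne_map_eq_of_card_lt g (by simp)
  wlog hlt : t₁ < t₂ generalizing t₁ t₂
  · exact this t₂ t₁ hne.symm hg.symm (lt_of_le_of_ne (not_lt.1 hlt) hne.symm)
  refine ⟨t₂ - t₁, Nat.sub_pos_of_lt hlt, by omega,
    fun i => ⌊t₂.val * a i⌋ - ⌊t₁.val * a i⌋, fun i => ?_⟩
  have h1 : ⌊(Q : ℝ) * Int.fract (t₁.val * a i)⌋₊ = ⌊(Q : ℝ) * Int.fract (t₂.val * a i)⌋₊ :=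
    congrArg Fin.val (congrFun hg i)
  have e1 := Int.fract_nonneg ((t₁.val : ℝ) * a i)
  have e2 := Int.fract_nonneg ((t₂.val : ℝ) * a i)
  have l1 := Nat.floor_le (a := (Q : ℝ) * Int.fract (t₁.val * a i)) (by positivity)
  have l2 := Nat.floor_le (a := (Q : ℝ) * Int.fract (t₂.val * a i)) (by positivity)
  have u1 := Nat.lt_floor_add_one ((Q : ℝ) * Int.fract (t₁.val * a i))
  have u2 := Nat.lt_floor_add_one ((Q : ℝ) * Int.fract (t₂.val * a i))
  rw [h1] at l1 u1
  have h3 : ((t₂.val - t₁.val : ℕ) : ℝ) * a i - ((⌊t₂.val * a i⌋ - ⌊t₁.val * a i⌋ : ℤ) : ℝ) =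
      Int.fract (t₂.val * a i) - Int.fract (t₁.val * a i) := by
    rw [Nat.cast_sub hlt.le, Int.fract, Int.fract]
    push_cast
    ring
  rw [h3, abs_lt]
  have h4 : (Q : ℝ) * (1 / Q) = 1 := by field_simp
  constructor <;> nlinarith

theorem sign_eq_sign_of_mul {x y c : ℝ} (hc : 0 < c) (h : x = c * y) :
    SignType.sign x = SignType.sign y := by
  rw [h, sign_mul, sign_pos hc, one_mul]

/-- Real weights can be replaced by integer weights of bounded size without changing the signs of
sums of at most `M` weights. -/
theorem exists_integer_weights_aux {ι : Type*} [Fintype ι] (M n : ℕ) :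
    ∀ a : ι → ℝ, (Finset.univ.filter fun i => a i ≠ 0).card ≤ n →
    ∃ W : ι → ℤ, (∀ i, |W i| + 1 ≤ (((M + 2) ^ (Fintype.card ι + 2)) ^ n : ℕ)) ∧
      ∀ s : Multiset ι, s.card ≤ M →
        SignType.sign (s.map W).sum = SignType.sign (s.map a).sum := by
  classical
  induction n with
  | zero =>
    intro a ha
    have h0 : ∀ i, a i = 0 := by simpa [Finset.filter_eq_empty_iff] using ha
    refine ⟨fun _ => 0, by simp, fun s _ => ?_⟩
    simp [h0]
  | succ n ih =>
    intro a ha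
    by_cases hz : ∀ i, a i = 0
    · refine ⟨fun _ => 0, fun i => ?_, fun s _ => by simp [hz]⟩
      have : 0 < ((M + 2) ^ (Fintype.card ι + 2)) ^ (n + 1) := by positivity
      simp only [abs_zero, zero_add]
      exact_mod_cast this
    push Not at hz
    obtain ⟨j, hj⟩ := hz
    obtain ⟨i₀, -, hmax⟩ := Finset.exists_max_image Finset.univ (fun i => |a i|) ⟨j, Finset.mem_univ _⟩
    have hα : 0 < |a i₀| := (abs_pos.2 hj).trans_le (hmax j (Finset.mem_univ _))
    obtain ⟨q, hq0, hq, P, hP⟩ :=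
      exists_simultaneous_approximation (fun i => a i / |a i₀|) (Q := M + 1) (by omega)
    have hq0' : (0 : ℝ) < q := by exact_mod_cast hq0
    have hM1 : (1 : ℝ) / ((M + 1 : ℕ) : ℝ) ≤ 1 := by
      rw [div_le_one (by positivity)]
      push_cast
      linarith [(Nat.cast_nonneg M : (0 : ℝ) ≤ M)]
    have hPabs : ∀ i, |P i| ≤ q := by
      intro i
      have h1 : |(q : ℝ) * (a i / |a i₀|)| ≤ q := by
        rw [abs_mul, abs_div, abs_abs, Nat.abs_cast]
        exact mul_le_of_le_one_right hq0'.le ((div_le_one hα).2 (hmax i (Finset.mem_univ _)))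
      have h2 : |(P i : ℝ)| < q + 1 := by
        have := abs_sub_abs_le_abs_sub (P i : ℝ) (q * (a i / |a i₀|))
        rw [abs_sub_comm] at this
        linarith [hP i]
      have h3 : |P i| < q + 1 := by exact_mod_cast h2
      omega
    -- Integral entries leave no remainder. Hence zeros of `a` remain zeros of the remainder `a'`,
    -- and the largest entry `i₀`, which becomes `q` or `-q`, is a new one: the support shrinks.
    have hint : ∀ i, ∀ z : ℤ, (q : ℝ) * (a i / |a i₀|) = z → (q : ℝ) * (a i / |a i₀|) - P i = 0 := by
      intro i z hz
      have := (hP i).trans_le hM1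
      rw [hz] at this ⊢
      have h : |z - P i| < 1 := by exact_mod_cast this
      have : z - P i = 0 := Int.abs_lt_one_iff.1 h
      exact_mod_cast this
    set a' : ι → ℝ := fun i => q * (a i / |a i₀|) - P i with ha'
    have hsupp : (Finset.univ.filter fun i => a' i ≠ 0).card ≤ n := by
      have : (Finset.univ.filter fun i => a' i ≠ 0) ⊂ Finset.univ.filter fun i => a i ≠ 0 := by
        refine Finset.ssubset_iff_of_subset ?_ |>.2 ⟨i₀, ?_, ?_⟩
        · intro i hi
          simp only [Finset.mem_filter, Finset.mem_univ, true_and] at hi ⊢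
          intro h
          exact hi (hint i 0 (by simp [h]))
        · simpa using abs_pos.1 hα
        · simp only [Finset.mem_filter, Finset.mem_univ, true_and, not_not]
          rcases lt_or_gt_of_ne (abs_pos.1 hα) with h | h
          · refine hint i₀ (-q) ?_
            rw [abs_of_neg h, div_neg, div_self h.ne]
            push_cast; ring
          · refine hint i₀ q ?_
            rw [abs_of_pos h, div_self h.ne']
            push_cast; ring
      have := Finset.card_lt_card this
      omega
    obtain ⟨W', hW', hsign⟩ := ih a' hsupp
    set B := ((M + 2) ^ (Fintype.card ι + 2)) ^ n with hB
    have hB1 : 1 ≤ B := Nat.one_le_iff_ne_zero.2 (by positivity)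
    have hW'' : ∀ i, |W' i| ≤ (B : ℤ) - 1 := fun i => by have := hW' i; omega
    -- The factor exceeds every sum of at most `M` weights `W'`, so the sum of `P` decides the sign
    -- and `W'` only breaks ties.
    refine ⟨fun i => P i * (M * (B - 1) + 1 : ℤ) + W' i, fun i => ?_, fun s hs => ?_⟩
    · have h1 : |P i * (M * (B - 1) + 1 : ℤ) + W' i| ≤ q * (M * (B - 1) + 1) + (B - 1) := by
        refine (abs_add_le _ _).trans (add_le_add ?_ (hW'' i))
        have h0 : (0 : ℤ) ≤ M * (B - 1) + 1 := by
          have : (0 : ℤ) ≤ B - 1 := by omega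
          positivity
        rw [abs_mul, abs_of_nonneg h0]
        exact mul_le_mul_of_nonneg_right (hPabs i) h0
      have h2 : (q : ℤ) * (M * (B - 1) + 1) + B ≤ ((M + 1) ^ Fintype.card ι * (M + 1) + 1) * B := by
        have hq' : (q : ℤ) ≤ (M + 1) ^ Fintype.card ι := by exact_mod_cast hq
        have hMB : (M * ((B : ℤ) - 1) + 1) ≤ (M + 1) * B := by
          have : (1 : ℤ) ≤ B := by exact_mod_cast hB1
          have hM : (0 : ℤ) ≤ M := by positivity
          nlinarith
        have h0 : (0 : ℤ) ≤ M * (B - 1) + 1 := by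
          have : (0 : ℤ) ≤ B - 1 := by omega
          positivity
        have := mul_le_mul hq' hMB h0 (by positivity)
        linarith
      have h3 : (M + 1) ^ Fintype.card ι * (M + 1) + 1 ≤ (M + 2) ^ (Fintype.card ι + 2) := by
        have e1 : (M + 1) ^ Fintype.card ι ≤ (M + 2) ^ Fintype.card ι :=
          Nat.pow_le_pow_left (by omega) _
        have e2 : 1 ≤ (M + 2) ^ Fintype.card ι := Nat.one_le_iff_ne_zero.2 (by positivity)
        calc (M + 1) ^ Fintype.card ι * (M + 1) + 1
            ≤ (M + 2) ^ Fintype.card ι * (M + 1) + (M + 2) ^ Fintype.card ι :=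
              add_le_add (Nat.mul_le_mul_right _ e1) e2
          _ = (M + 2) ^ (Fintype.card ι + 1) := by ring
          _ ≤ _ := Nat.pow_le_pow_right (by omega) (by omega)
      have h4 : (((M + 1) ^ Fintype.card ι * (M + 1) + 1) * B : ℤ) ≤
          (((M + 2) ^ (Fintype.card ι + 2)) ^ (n + 1) : ℕ) := by
        rw [pow_succ, ← hB, mul_comm B]
        exact_mod_cast Nat.mul_le_mul_right B h3
      linarith
    · have e1 : (s.map fun i => P i * (M * (B - 1) + 1 : ℤ) + W' i).sum =
          (s.map P).sum * (M * (B - 1) + 1) + (s.map W').sum := by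
        rw [Multiset.sum_map_add, Multiset.sum_map_mul_right]
      have e2 : (s.map a').sum = q / |a i₀| * (s.map a).sum - ((s.map P).sum : ℤ) := by
        rw [ha', Multiset.sum_map_sub, ← Multiset.sum_map_mul_left]
        congr 1
        · congr 1
          refine Multiset.map_congr rfl fun i _ => by ring
        · have := map_multiset_sum (Int.castAddHom ℝ) (s.map P)
          rw [Multiset.map_map] at this
          exact this.symm
      have b1 : |(s.map W').sum| ≤ M * (B - 1) := by
        refine (Multiset.abs_sum_le_sum_abs).trans ?_
        refine (Multiset.sum_le_card_nsmul _ ((B : ℤ) - 1) ?_).trans ?_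
        · intro x hx
          simp only [Multiset.mem_map] at hx
          obtain ⟨_, ⟨i, -, rfl⟩, rfl⟩ := hx
          exact hW'' i
        · rw [nsmul_eq_mul]
          refine mul_le_mul_of_nonneg_right ?_ (by omega)
          simpa using hs
      -- At most `M` remainders below `1 / (M + 1)`: they cannot outweigh a nonzero integer sum of
      -- `P`. If that sum is zero, the remainders sum to a positive multiple of the original sum.
      have b2 : |(s.map a').sum| < 1 := by
        refine (Multiset.abs_sum_le_sum_abs).trans_lt ?_
        refine (Multiset.sum_le_card_nsmul _ ((1 : ℝ) / ((M + 1 : ℕ) : ℝ)) ?_).trans_lt ?_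
        · intro x hx
          simp only [Multiset.mem_map] at hx
          obtain ⟨_, ⟨i, -, rfl⟩, rfl⟩ := hx
          exact (hP i).le
        · rw [nsmul_eq_mul, mul_one_div, div_lt_one (by positivity)]
          simp only [Multiset.card_map, Nat.cast_lt]
          omega
      have hc : (0 : ℝ) < q / |a i₀| := by positivity
      rw [e1]
      obtain ⟨b1l, b1u⟩ := abs_le.1 b1
      obtain ⟨b2l, b2u⟩ := abs_lt.1 b2
      have hMB : (0 : ℤ) ≤ M * (B - 1) := by
        have : (0 : ℤ) ≤ B - 1 := by omega
        positivity
      rcases lt_trichotomy (s.map P).sum 0 with h | h | h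
      · have hr : ((s.map P).sum : ℝ) ≤ -1 := by exact_mod_cast (by omega : (s.map P).sum ≤ -1)
        rw [sign_neg (by nlinarith), sign_neg]
        by_contra hn
        have := mul_nonneg hc.le (not_lt.1 hn)
        linarith
      · rw [h, zero_mul, zero_add, hsign s hs, e2, h]
        exact sign_eq_sign_of_mul hc (by simp)
      · have hr : (1 : ℝ) ≤ ((s.map P).sum : ℤ) := by exact_mod_cast h
        rw [sign_pos (by nlinarith), sign_pos]
        by_contra hn
        have := mul_nonpos_of_nonneg_of_nonpos hc.le (not_lt.1 hn)
        linarith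

/-- Only the polynomial size of the exponent matters, so the base `M + 2` is crudely bounded by `2 ^
(M + 2)`. -/
theorem exists_integer_weights {ι : Type*} [Fintype ι] (M : ℕ) (a : ι → ℝ) :
    ∃ W : ι → ℤ, (∀ i, |W i| < 2 ^ ((M + 2) * ((Fintype.card ι + 2) * Fintype.card ι))) ∧
      ∀ s : Multiset ι, s.card ≤ M →
        SignType.sign (s.map W).sum = SignType.sign (s.map a).sum := by
  classical
  obtain ⟨W, hW, hs⟩ := exists_integer_weights_aux M (Fintype.card ι) a (Finset.card_le_univ _)
  refine ⟨W, fun i => ?_, hs⟩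
  have h1 : ((M + 2) ^ (Fintype.card ι + 2)) ^ Fintype.card ι ≤
      2 ^ ((M + 2) * ((Fintype.card ι + 2) * Fintype.card ι)) := by
    rw [← pow_mul, pow_mul 2]
    exact Nat.pow_le_pow_left Nat.lt_two_pow_self.le _
  have h2 : ((((M + 2) ^ (Fintype.card ι + 2)) ^ Fintype.card ι : ℕ) : ℤ) ≤
      2 ^ ((M + 2) * ((Fintype.card ι + 2) * Fintype.card ι)) := by exact_mod_cast h1
  have := hW i
  omega

/-! ### Signs of sums from residues -/

/-- The contribution of level `r` to the search for the most significant level at which the sign of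
a sum of at most `n` integers is visible. -/
noncomputable def levelCode {M : ℕ} (n r : ℕ) (z : ZMod M) : ℕ :=
  if r = 0 ∨ 0 < z.valMinAbs ∨ z.valMinAbs ≤ -n then
    3 * r + ((SignType.sign z.valMinAbs : ℤ) + 2).toNat
  else 0

/-- The sign that is recorded in a level code. -/
def codeSign (c : ℕ) : ℤ := ((c + 2) % 3 : ℕ) - 1

theorem sign_cases (x : ℤ) : (SignType.sign x : ℤ) = -1 ∧ x < 0 ∨ (SignType.sign x : ℤ) = 0 ∧ x = 0 ∨
    (SignType.sign x : ℤ) = 1 ∧ 0 < x := by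
  rcases lt_trichotomy x 0 with h | h | h
  · left; rw [sign_neg h]; exact ⟨rfl, h⟩
  · right; left; rw [h, sign_zero]; exact ⟨rfl, rfl⟩
  · right; right; rw [sign_pos h]; exact ⟨rfl, h⟩

theorem levelCode_le {M : ℕ} (n r : ℕ) (z : ZMod M) : levelCode n r z ≤ 3 * r + 3 := by
  unfold levelCode
  split_ifs
  · rcases sign_cases z.valMinAbs with h | h | h <;> omega
  · omega

theorem valMinAbs_intCast_of_abs_lt {M : ℕ} [NeZero M] {a : ℤ} (h : 2 * |a| < M) :
    ((a : ℤ) : ZMod M).valMinAbs = a := by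
  rw [ZMod.valMinAbs_spec]
  have := abs_lt.1 (show |2 * a| < M by rw [abs_mul]; simpa using h)
  exact ⟨rfl, by constructor <;> linarith [this.1, this.2]⟩

/-- Let `A r` be the sum of the `W j / 2 ^ r`, rounded down. If `0 < A r` or `A r ≤ -n`, it has the
sign of the full sum, because the rounding errors total less than `n * 2 ^ r`. Descending from the
top level, where `A R` lies between `-n` and `0`, each step at most doubles the value and adds at
most `n`. So down to and including the first decisive level, `A r` is at most `2 * n` in absolute
value, and its residue reveals it. Level `0` is always decisive, as `A 0` is the sum itself. -/
theorem codeSign_sup_levelCode {β : Type*} {M n R : ℕ} [NeZero M] (hM : 4 * n < M) {J : Finset β}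
    (hJ : J.Nonempty) (hcard : J.card ≤ n) {W : β → ℤ} (hW : ∀ j ∈ J, |W j| < 2 ^ R) :
    codeSign ((Finset.range (R + 1)).sup fun r =>
      levelCode n r (((∑ j ∈ J, W j / 2 ^ r : ℤ)) : ZMod M)) = SignType.sign (∑ j ∈ J, W j) := by
  classical
  set A : ℕ → ℤ := fun r => ∑ j ∈ J, W j / 2 ^ r with hA
  have hcard' : (J.card : ℤ) ≤ n := by exact_mod_cast hcard
  have hpos : 1 ≤ J.card := hJ.card_pos
  have hstep : ∀ r, 2 * A (r + 1) ≤ A r ∧ A r ≤ 2 * A (r + 1) + n := by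
    intro r
    have key : ∀ j, 2 * (W j / 2 ^ (r + 1)) ≤ W j / 2 ^ r ∧
        W j / 2 ^ r ≤ 2 * (W j / 2 ^ (r + 1)) + 1 := by
      intro j
      have : W j / 2 ^ (r + 1) = W j / 2 ^ r / 2 := by
        rw [pow_succ, ← Int.ediv_ediv_of_nonneg (by positivity)]
      rw [this]
      omega
    constructor
    · simp only [hA]
      rw [Finset.mul_sum]
      exact Finset.sum_le_sum fun j _ => (key j).1
    · have : A r ≤ ∑ j ∈ J, (2 * (W j / 2 ^ (r + 1)) + 1) :=
        Finset.sum_le_sum fun j _ => (key j).2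
      rw [Finset.sum_add_distrib, ← Finset.mul_sum] at this
      simp only [Finset.sum_const, nsmul_eq_mul, mul_one] at this
      simp only [hA] at this ⊢
      linarith
  have htop : -(n : ℤ) ≤ A R ∧ A R ≤ 0 := by
    have key : ∀ j ∈ J, -1 ≤ W j / 2 ^ R ∧ W j / 2 ^ R ≤ 0 := by
      intro j hj
      obtain ⟨h1, h2⟩ := abs_lt.1 (hW j hj)
      have hp : (0 : ℤ) < 2 ^ R := by positivity
      constructor
      · rw [Int.le_ediv_iff_mul_le hp]; linarith
      · have := Int.ediv_lt_of_lt_mul hp (by linarith : W j < 1 * 2 ^ R)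
        omega
    constructor
    · have : ∑ j ∈ J, (-1 : ℤ) ≤ A R := Finset.sum_le_sum fun j hj => (key j hj).1
      simp at this
      linarith
    · exact Finset.sum_nonpos fun j hj => (key j hj).2
  have hsgn : ∀ r, (0 < A r → 0 < ∑ j ∈ J, W j) ∧ (A r ≤ -n → ∑ j ∈ J, W j < 0) := by
    intro r
    have hp : (0 : ℤ) < 2 ^ r := by positivity
    constructor
    · intro h
      have : A r * 2 ^ r ≤ ∑ j ∈ J, W j := by
        simp only [hA]
        rw [Finset.sum_mul]
        exact Finset.sum_le_sum fun j _ => Int.ediv_mul_le _ hp.ne'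
      have := mul_pos h hp
      linarith
    · intro h
      have : ∑ j ∈ J, W j < ∑ j ∈ J, (W j / 2 ^ r + 1) * 2 ^ r :=
        Finset.sum_lt_sum_of_nonempty hJ fun j _ => Int.lt_ediv_add_one_mul_self _ hp
      refine this.trans_le ?_
      rw [← Finset.sum_mul, Finset.sum_add_distrib]
      simp only [Finset.sum_const, nsmul_eq_mul, mul_one]
      simp only [hA] at h
      exact mul_nonpos_of_nonpos_of_nonneg (by linarith) hp.le
  set dec : ℕ → Prop := fun r => r = 0 ∨ 0 < A r ∨ A r ≤ -n with hdec
  obtain ⟨r₀, hr₀, hmax⟩ := Finset.exists_max_image ((Finset.range (R + 1)).filter dec) id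
    ⟨0, by simp [hdec]⟩
  simp only [Finset.mem_filter, Finset.mem_range, id, and_imp] at hr₀ hmax
  have hund : ∀ r, r₀ < r → r ≤ R → -(n : ℤ) < A r ∧ A r ≤ 0 := by
    intro r h1 h2
    have h3 : ¬ dec r := fun h => absurd (hmax r (by omega) h) (by omega)
    simp only [hdec, not_or, not_lt, not_le] at h3
    exact ⟨h3.2.2, h3.2.1⟩
  have hval : ∀ r, r₀ ≤ r → r ≤ R → ((A r : ℤ) : ZMod M).valMinAbs = A r := by
    intro r h1 h2
    apply valMinAbs_intCast_of_abs_lt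
    have : |A r| ≤ 2 * n := by
      rcases eq_or_lt_of_le h2 with rfl | h2
      · rw [abs_le]; omega
      · have e1 := hund (r + 1) (by omega) (by omega)
        have e2 := hstep r
        rw [abs_le]; omega
    omega
  have hsup : ((Finset.range (R + 1)).sup fun r => levelCode n r ((A r : ℤ) : ZMod M)) =
      3 * r₀ + ((SignType.sign (A r₀) : ℤ) + 2).toNat := by
    apply le_antisymm
    · rw [Finset.sup_le_iff]
      intro r hr
      rw [Finset.mem_range] at hr
      rcases lt_trichotomy r r₀ with h | h | h
      -- Below `r₀` the residues may have wrapped around, but the code is at most `3 * r + 3 ≤ 3 *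
      -- r₀` and cannot win.
      · have := levelCode_le n r ((A r : ℤ) : ZMod M)
        rcases sign_cases (A r₀) with h | h | h <;> omega
      · subst h
        rw [levelCode, hval r le_rfl (by omega)]
        split_ifs <;> omega
      · have := hund r h (by omega)
        rw [levelCode, hval r h.le (by omega), if_neg (by omega)]
        omega
    · refine le_trans (le_of_eq ?_) (Finset.le_sup (Finset.mem_range.2 hr₀.1))
      rw [levelCode, hval r₀ le_rfl (by omega), if_pos hr₀.2]
  rw [hsup]
  have hfin : (SignType.sign (A r₀) : ℤ) = SignType.sign (∑ j ∈ J, W j) := by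
    rcases hr₀.2 with h | h | h
    · simp [hA, h]
    · rw [sign_pos h, sign_pos ((hsgn r₀).1 h)]
    · rw [sign_neg (by omega), sign_neg ((hsgn r₀).2 h)]
  rw [← hfin, codeSign]
  rcases sign_cases (A r₀) with h | h | h <;> omega

/-! ### Rounded softmax attention from signs of integer sums -/

/-- By monotonicity the inputs rounded to at least `τ` form an up-set, nonempty and bounded below
because rounding moves points by a bounded amount. It is a half-line, closed or open according to
the rounding mode. -/
theorem IsRounding.exists_threshold {p : ℕ} {ρ : ℝ → ℝ} (hρ : IsRounding p ρ) (τ : ℝ) :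
    ∃ θ : ℝ, (∀ x, τ ≤ ρ x ↔ θ ≤ x) ∨ (∀ x, τ ≤ ρ x ↔ θ < x) := by
  set U : Set ℝ := {x | τ ≤ ρ x} with hU
  have hpow : ((2 : ℝ) ^ p)⁻¹ ≤ 1 := inv_le_one_of_one_le₀ (one_le_pow₀ (by norm_num))
  have hne : U.Nonempty := by
    refine ⟨τ + 1, ?_⟩
    have := (abs_lt.1 ((hρ.2 (τ + 1)).2)).1
    simp only [hU, Set.mem_ofPred_eq]
    linarith
  have hbdd : BddBelow U := by
    refine ⟨τ - 1, fun x hx => ?_⟩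
    have := (abs_lt.1 ((hρ.2 x).2)).2
    simp only [hU, Set.mem_ofPred_eq] at hx
    linarith
  have hup : ∀ x, sInf U < x → x ∈ U := by
    intro x hx
    obtain ⟨y, hy, hyx⟩ := exists_lt_of_csInf_lt hne hx
    exact le_trans hy (hρ.1 hyx.le)
  refine ⟨sInf U, ?_⟩
  by_cases h : sInf U ∈ U
  · left
    exact fun x => ⟨fun hx => csInf_le hbdd hx, fun hx => le_trans h (hρ.1 hx)⟩
  · right
    refine fun x => ⟨fun hx => lt_of_le_of_ne (csInf_le hbdd hx) ?_, hup x⟩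
    rintro rfl
    exact h hx

/-- Distinct multiples of `2⁻ᵖ` are at least `2⁻ᵖ` apart, so `ρ` fixes integers, in particular the
end points `2 ^ p` and `-2 ^ p`; monotonicity does the rest. -/
theorem IsRounding.abs_le {p : ℕ} {ρ : ℝ → ℝ} (hρ : IsRounding p ρ) {x : ℝ} (hx : |x| ≤ 2 ^ p) :
    |ρ x| ≤ 2 ^ p := by
  have hfix : ∀ z : ℤ, ρ z = z := by
    intro z
    obtain ⟨⟨t, ht⟩, h⟩ := hρ.2 z
    have hp : (0 : ℝ) < 2 ^ p := by positivity
    have h1 : |(t : ℝ) - z * 2 ^ p| < 1 := by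
      rw [← ht, ← sub_mul, abs_mul, abs_of_pos hp]
      calc _ < ((2 : ℝ) ^ p)⁻¹ * 2 ^ p := mul_lt_mul_of_pos_right h hp
        _ = 1 := inv_mul_cancel₀ hp.ne'
    have h2 : |t - z * 2 ^ p| < 1 := by exact_mod_cast h1
    have h3 : t = z * 2 ^ p := by have := Int.abs_lt_one_iff.1 h2; omega
    have h4 : ρ z * 2 ^ p = z * 2 ^ p := by rw [ht, h3]; push_cast; ring
    exact mul_right_cancel₀ hp.ne' h4
  have h1 := hfix (2 ^ p)
  have h2 := hfix (-2 ^ p)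
  push_cast at h1 h2
  rw [_root_.abs_le] at hx ⊢
  exact ⟨h2 ▸ hρ.1 hx.1, h1 ▸ hρ.1 hx.2⟩

/-- A unary description: the rounded value, in units of `2⁻ᵖ`, is the bottom of its range plus the
number of thresholds it reaches. -/
theorem IsRounding.mul_eq_count {p : ℕ} {ρ : ℝ → ℝ} (hρ : IsRounding p ρ) {x : ℝ}
    (hx : |x| ≤ 2 ^ p) : ∃ z : ℤ, ρ x * 2 ^ p = z ∧ |z| ≤ 4 ^ p ∧
      z = -4 ^ p + ((Finset.range (2 * 4 ^ p)).filter fun t : ℕ =>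
        (-4 ^ p + t + 1 : ℝ) / 2 ^ p ≤ ρ x).card := by
  obtain ⟨⟨z, hz⟩, -⟩ := hρ.2 x
  have hp : (0 : ℝ) < 2 ^ p := by positivity
  have h4 : (4 : ℝ) ^ p = 2 ^ p * 2 ^ p := by rw [← mul_pow]; norm_num
  have habs : |z| ≤ 4 ^ p := by
    have : |(z : ℝ)| ≤ 4 ^ p := by
      rw [← hz, abs_mul, abs_of_pos hp, h4]
      exact mul_le_mul_of_nonneg_right (hρ.abs_le hx) hp.le
    exact_mod_cast this
  refine ⟨z, hz, habs, ?_⟩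
  have : ((Finset.range (2 * 4 ^ p)).filter fun t : ℕ => (-4 ^ p + t + 1 : ℝ) / 2 ^ p ≤ ρ x) =
      Finset.range (z + 4 ^ p).toNat := by
    ext t
    rw [Finset.mem_filter, Finset.mem_range, Finset.mem_range, div_le_iff₀ hp, hz]
    have : (-4 ^ p + t + 1 : ℝ) ≤ z ↔ (-4 ^ p + t + 1 : ℤ) ≤ z := by
      rw [← Int.cast_le (R := ℝ)]; push_cast; rfl
    rw [this]
    have h5 : ((4 ^ p : ℕ) : ℤ) = 4 ^ p := by push_cast; rfl
    have := _root_.abs_le.1 habs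
    rw [← h5] at *
    generalize (4 ^ p : ℕ) = P at *
    omega
  rw [this, Finset.card_range]
  have := _root_.abs_le.1 habs
  omega

/-- The number of bits of the integer weights that replace the weights of an attention head. -/
def attentionBits (m n p : ℕ) : ℕ :=
  (n + 2) * (((2 * (m * 16 ^ p) + 1) * (2 * 4 ^ p + 1) + 2) *
    ((2 * (m * 16 ^ p) + 1) * (2 * 4 ^ p + 1)))

/-- Multiplying by the positive denominator turns the comparison with `θ` into the sign of a sum of
`exp(s) * (v - θ)`. These weights depend only on the pair `(s, v)`, which ranges over a finite set,
so a single choice of integers serves every `J`. -/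
theorem exists_threshold_weights {p : ℕ} {ρ : ℝ → ℝ} (hρ : IsRounding p ρ) (m n : ℕ) (τ : ℝ) :
    ∃ (W : ℝ → ℝ → ℤ) (D : ℤ → Prop), (∀ s v, |W s v| < 2 ^ attentionBits m n p) ∧
      ∀ {β : Type} (J : Finset β), J.Nonempty → J.card ≤ n → ∀ s v : β → ℝ,
        (∀ j ∈ J, |s j| ≤ m * 4 ^ p ∧ ∃ a : ℤ, s j * 4 ^ p = a) →
        (∀ j ∈ J, IsFixedPoint p (v j)) →
        (τ ≤ ρ ((∑ j ∈ J, Real.exp (s j) * v j) / ∑ j ∈ J, Real.exp (s j)) ↔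
          D (SignType.sign (∑ j ∈ J, W (s j) (v j)))) := by
  classical
  obtain ⟨θ, hθ⟩ := hρ.exists_threshold τ
  -- All possible pairs: a score is a product of `p`-bit numbers summed over `m` terms, hence a
  -- multiple of `4⁻ᵖ`, with numerator at most `m * 16 ^ p`; a value has denominator `2 ^ p` and
  -- numerator at most `4 ^ p`.
  set S : Finset (ℝ × ℝ) := ((Finset.Icc (-(m * 16 ^ p : ℤ)) (m * 16 ^ p)) ×ˢ
    (Finset.Icc (-(4 ^ p : ℤ)) (4 ^ p))).image
      fun ab => ((ab.1 : ℝ) / 4 ^ p, (ab.2 : ℝ) / 2 ^ p) with hS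
  have hScard : Fintype.card S ≤ (2 * (m * 16 ^ p) + 1) * (2 * 4 ^ p + 1) := by
    rw [Fintype.card_coe]
    refine Finset.card_image_le.trans ?_
    rw [Finset.card_product, Int.card_Icc, Int.card_Icc]
    apply le_of_eq
    congr 1
    · have : ((m * 16 ^ p : ℕ) : ℤ) = m * 16 ^ p := by push_cast; rfl
      rw [← this]; omega
    · have : ((4 ^ p : ℕ) : ℤ) = 4 ^ p := by push_cast; rfl
      rw [← this]; omega
  obtain ⟨W, hW, hsign⟩ := exists_integer_weights n
    (fun y : S => Real.exp y.1.1 * (y.1.2 - θ))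
  -- A closed half-line asks for a nonnegative sum, an open one for a positive sum.
  refine ⟨fun s v => if h : (s, v) ∈ S then W ⟨_, h⟩ else 0,
    fun z => if ∀ x, τ ≤ ρ x ↔ θ ≤ x then 0 ≤ z else 0 < z, fun s v => ?_, ?_⟩
  · dsimp only
    split_ifs with h
    · refine (hW _).trans_le (pow_le_pow_right₀ (by norm_num) ?_)
      exact Nat.mul_le_mul_left _ (Nat.mul_le_mul (by omega) hScard)
    · simp
  · intro β J hJ hcard s v hs hv
    have hmem : ∀ j ∈ J, (s j, v j) ∈ S := by
      intro j hj
      obtain ⟨h1, a, ha⟩ := hs j hj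
      obtain ⟨h2, b, hb⟩ := hv j hj
      have hp : (0 : ℝ) < 2 ^ p := by positivity
      have hp4 : (0 : ℝ) < 4 ^ p := by positivity
      refine Finset.mem_image.2 ⟨(a, b), Finset.mem_product.2 ⟨?_, ?_⟩, ?_⟩
      · have : |(a : ℝ)| ≤ m * 16 ^ p := by
          rw [← ha, abs_mul, abs_of_pos hp4]
          calc _ ≤ (m * 4 ^ p : ℝ) * 4 ^ p := mul_le_mul_of_nonneg_right h1 hp4.le
            _ = _ := by rw [mul_assoc, ← mul_pow]; norm_num
        have : |a| ≤ m * 16 ^ p := by exact_mod_cast this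
        exact Finset.mem_Icc.2 (abs_le.1 this)
      · have : |(b : ℝ)| ≤ 4 ^ p := by
          rw [← hb, abs_mul, abs_of_pos hp]
          calc _ ≤ (2 : ℝ) ^ p * 2 ^ p := mul_le_mul_of_nonneg_right h2 hp.le
            _ = _ := by rw [← mul_pow]; norm_num
        have : |b| ≤ 4 ^ p := by exact_mod_cast this
        exact Finset.mem_Icc.2 (abs_le.1 this)
      · simp only
        rw [← ha, ← hb, mul_div_cancel_right₀ _ hp4.ne', mul_div_cancel_right₀ _ hp.ne']
    have hsum : (∑ j ∈ J, if h : (s j, v j) ∈ S then W ⟨_, h⟩ else 0) =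
        ((J.attach.val.map fun j => (⟨_, hmem j.1 j.2⟩ : S)).map W).sum := by
      rw [Multiset.map_map, ← Finset.sum_attach]
      refine Finset.sum_congr rfl fun j _ => ?_
      rw [dif_pos (hmem j.1 j.2)]
      rfl
    have hsum' : ∑ j ∈ J, Real.exp (s j) * (v j - θ) =
        ((J.attach.val.map fun j => (⟨_, hmem j.1 j.2⟩ : S)).map
          fun y : S => Real.exp y.1.1 * (y.1.2 - θ)).sum := by
      rw [Multiset.map_map, ← Finset.sum_attach]
      rfl
    rw [hsum, hsign _ (by rw [Multiset.card_map]; exact (Finset.card_attach (s := J)).trans_le hcard), ← hsum']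
    have hden : 0 < ∑ j ∈ J, Real.exp (s j) := Finset.sum_pos (fun j _ => Real.exp_pos _) hJ
    have hrw : ∑ j ∈ J, Real.exp (s j) * (v j - θ) =
        ∑ j ∈ J, Real.exp (s j) * v j - θ * ∑ j ∈ J, Real.exp (s j) := by
      rw [Finset.mul_sum, ← Finset.sum_sub_distrib]
      exact Finset.sum_congr rfl fun j _ => by ring
    split_ifs with hc
    · rw [hc, le_div_iff₀ hden, ← sub_nonneg, ← hrw]
      generalize (∑ j ∈ J, Real.exp (s j) * (v j - θ)) = x
      rcases lt_trichotomy x 0 with h | h | h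
      · simp [sign_neg h, h.not_ge]
      · simp [h]
      · simp [sign_pos h, h.le]
    · rw [(hθ.resolve_left hc), lt_div_iff₀ hden, ← sub_pos, ← hrw]
      generalize (∑ j ∈ J, Real.exp (s j) * (v j - θ)) = x
      rcases lt_trichotomy x 0 with h | h | h
      · simp [sign_neg h, h.not_gt]
      · simp [h]
      · simp [sign_pos h, h]

/-- The rounded output of an attention head is determined by the signs of sums of integer weights,
one weight for every attended position. -/
theorem exists_attention_weights {p : ℕ} {ρ : ℝ → ℝ} (hρ : IsRounding p ρ) (m n : ℕ) :
    ∃ (W : ℕ → ℝ → ℝ → ℤ) (D : ℕ → ℤ → Prop),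
      (∀ t s v, |W t s v| < 2 ^ attentionBits m n p) ∧
      ∀ {β : Type} (J : Finset β), J.Nonempty → J.card ≤ n → ∀ s v : β → ℝ,
        (∀ j ∈ J, |s j| ≤ m * 4 ^ p ∧ ∃ a : ℤ, s j * 4 ^ p = a) →
        (∀ j ∈ J, IsFixedPoint p (v j)) →
        ∃ z : ℤ, ρ ((∑ j ∈ J, Real.exp (s j) * v j) / ∑ j ∈ J, Real.exp (s j)) * 2 ^ p = z ∧
          |z| ≤ 4 ^ p ∧
          open Classical in
          z = -4 ^ p + ((Finset.range (2 * 4 ^ p)).filter fun t =>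
            D t (SignType.sign (∑ j ∈ J, W t (s j) (v j)))).card := by
  classical
  choose W D hW hD using fun t : ℕ =>
    exists_threshold_weights hρ m n ((-4 ^ p + t + 1 : ℝ) / 2 ^ p)
  refine ⟨W, D, hW, fun J hJ hcard s v hs hv => ?_⟩
  have hbound : |(∑ j ∈ J, Real.exp (s j) * v j) / ∑ j ∈ J, Real.exp (s j)| ≤ 2 ^ p := by
    have hden : 0 < ∑ j ∈ J, Real.exp (s j) := Finset.sum_pos (fun j _ => Real.exp_pos _) hJ
    rw [abs_div, abs_of_pos hden, div_le_iff₀ hden]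
    refine (Finset.abs_sum_le_sum_abs _ _).trans ?_
    rw [Finset.mul_sum]
    refine Finset.sum_le_sum fun j hj => ?_
    rw [abs_mul, Real.abs_exp, mul_comm]
    exact mul_le_mul_of_nonneg_right (hv j hj).1 (Real.exp_pos _).le
  obtain ⟨z, h1, h2, h3⟩ := hρ.mul_eq_count hbound
  refine ⟨z, h1, h2, h3.trans ?_⟩
  rw [Finset.filter_congr fun t _ => hD t J hJ hcard s v hs hv]

/-! ### Simulation of a layer -/

/-- The blocks index the query position (0), key position (1), threshold (2), level (3) and head
(4); the extra coordinate indexes the entries of a row. The cost is one lookup, three sums and one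
maximum over blocks, interleaved with six rounds on lines. -/
theorem computes_layer {X : Type} {κ F M : ℕ} [NeZero M] (cell : X → ℕ → Fin F → ZMod M)
    (term : ℕ → ℕ → ℕ → ℕ → ℕ → Fin F → (Fin F → ZMod M) → (Fin F → ZMod M) → ZMod M)
    (lev : ℕ → ZMod M → ZMod M) (test : ℕ → ZMod M → ZMod M) (post : ℕ → ZMod M → ZMod M)
    (upd : ℕ → Fin F → ZMod M → ZMod M → ZMod M) :
    Computes (5 * κ + 6) (fun x => liftState (κ := κ) fun i c => (cell x (i 0) c, (0 : ZMod M)))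
      (fun x => liftState fun i c =>
        (upd (i 0) c (cell x (i 0) c) (∑ h ∈ Finset.range (F ^ κ), post h
          (∑ t ∈ Finset.range (F ^ κ), test t
            (((Finset.range (F ^ κ)).sup fun r => (lev r
              (∑ j ∈ Finset.range (F ^ κ),
                term (i 0) j t r h c (cell x (i 0)) (cell x j))).val : ℕ) : ZMod M))), 0)) := by
  have h1 := computes_line (κ := κ) (fun x i c => (cell x (i 0) c, (0 : ZMod M)))
    fun _ c u => ((u c).1, (u c).1)
  -- Reading at block 0 := block 1 brings the value of the key position next to that of the query
  -- position.
  have h2 := h1.trans (computes_lookup _ 0 (fun i => i 1) (by simp) fun i hi => hi 1)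
  have h3 := h2.trans (computes_line _ fun i c u =>
    ((u c).1, term (i 0) (i 1) (i 2) (i 3) (i 4) c (fun c' => (u c').1) fun c' => (u c').2))
  have h4 := h3.trans (computes_sum _ 1)
  have h5 := h4.trans (computes_line _ fun i c u => ((u c).1, lev (i 3) (u c).2))
  have h6 := h5.trans (computes_max _ 3)
  have h7 := h6.trans (computes_line _ fun i c u => ((u c).1, test (i 2) (u c).2))
  have h8 := h7.trans (computes_sum _ 2)
  have h9 := h8.trans (computes_line _ fun i c u => ((u c).1, post (i 4) (u c).2))
  have h10 := h9.trans (computes_sum _ 4)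
  have h11 := h10.trans (computes_line _ fun i c u => (upd (i 0) c (u c).1 (u c).2, 0))
  have e : 1 + κ + 1 + κ + 1 + κ + 1 + κ + 1 + κ + 1 = 5 * κ + 6 := by ring
  rw [e] at h11
  refine h11.congr fun x y => ?_
  simp only [liftState, Function.update_self, ne_eq, Function.update_of_ne,
    show (0 : Fin 5) ≠ 1 by decide, show (0 : Fin 5) ≠ 2 by decide, show (0 : Fin 5) ≠ 3 by decide,
    show (0 : Fin 5) ≠ 4 by decide, show (2 : Fin 5) ≠ 1 by decide,
    show (2 : Fin 5) ≠ 3 by decide, show (3 : Fin 5) ≠ 1 by decide, show (4 : Fin 5) ≠ 1 by decide,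
    show (4 : Fin 5) ≠ 3 by decide, show (4 : Fin 5) ≠ 2 by decide, not_false_eq_true]

theorem sum_range_dite_le {A : Type*} [AddCommMonoid A] {N B : ℕ} (i : Fin N) (hB : i.val < B)
    (f : Fin N → A) :
    ∑ j ∈ Finset.range B, (if hj : j ≤ i.val then f ⟨j, lt_of_le_of_lt hj i.isLt⟩ else 0) =
      ∑ j ∈ Finset.Iic i, f j := by
  symm
  apply Finset.sum_of_injOn Fin.val Fin.val_injective.injOn
  · intro j hj
    have : j ≤ i := by simpa using hj
    simp only [Finset.coe_range, Set.mem_Iio]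
    exact lt_of_le_of_lt this hB
  · intro j _ hj
    rw [dif_neg]
    intro h
    exact hj ⟨⟨j, lt_of_le_of_lt h i.isLt⟩, Finset.mem_coe.2 (Finset.mem_Iic.2 h), rfl⟩
  · intro j hj
    rw [dif_pos (show j.val ≤ i.val from (Finset.mem_Iic.1 hj : j ≤ i))]

theorem sum_range_dite_lt {A : Type*} [AddCommMonoid A] {H B : ℕ} (hB : H ≤ B) (f : Fin H → A) :
    ∑ h ∈ Finset.range B, (if hh : h < H then f ⟨h, hh⟩ else 0) = ∑ h, f h := by
  symm
  apply Finset.sum_of_injOn Fin.val Fin.val_injective.injOn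
  · intro j _
    simp only [Finset.coe_range, Set.mem_Iio]
    exact j.isLt.trans_le hB
  · intro j _ hj
    rw [dif_neg]
    intro h
    exact hj ⟨⟨j, h⟩, by simp, rfl⟩
  · intro j _
    rw [dif_pos j.isLt]

/-! ### Attention heads in integer arithmetic -/

section Transformer

variable {N m L H : ℕ} (T : CausalTransformer N m L H) (ρ : ℝ → ℝ)

/-- The output of an attention head, before rounding, on the embeddings `Y`. -/
noncomputable def CausalTransformer.attention (l : Fin L) (h : Fin H) (Y : Fin N → Fin m → ℝ)
    (i : Fin N) (c : Fin m) : ℝ :=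
  causalAttention (fun j => T.query l h j (Y j)) (fun j => T.key l h j (Y j))
    (fun j => T.value l h j (Y j)) i c

theorem CausalTransformer.embedding_succ (X : Fin N → ℝ) {l : ℕ} (hl : l < L) (i : Fin N)
    (c : Fin m) : T.embedding ρ X (l + 1) i c = T.embedding ρ X l i c +
      ∑ h, ρ (T.attention ⟨l, hl⟩ h (T.embedding ρ X l) i c) := by
  simp only [CausalTransformer.embedding, dif_pos hl]
  rfl

/-- The change of an embedding during the first `l` layers, in units of the last place. -/
noncomputable def CausalTransformer.increment (p : ℕ) (X : Fin N → ℝ) (l : ℕ) (i : Fin N)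
    (c : Fin m) : ℤ :=
  ⌊(T.embedding ρ X l i c - T.embedding ρ X 0 i c) * 2 ^ p⌋

/-- The weights that determine the rounded outputs of the attention heads. -/
structure AttentionWeights (ρ : ℝ → ℝ) (m n p : ℕ) where
  W : ℕ → ℝ → ℝ → ℤ
  D : ℕ → ℤ → Prop
  lt : ∀ t s v, |W t s v| < 2 ^ attentionBits m n p
  spec : ∀ {β : Type} (J : Finset β), J.Nonempty → J.card ≤ n → ∀ s v : β → ℝ,
        (∀ j ∈ J, |s j| ≤ m * 4 ^ p ∧ ∃ a : ℤ, s j * 4 ^ p = a) →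
        (∀ j ∈ J, IsFixedPoint p (v j)) →
        ∃ z : ℤ, ρ ((∑ j ∈ J, Real.exp (s j) * v j) / ∑ j ∈ J, Real.exp (s j)) * 2 ^ p = z ∧
          |z| ≤ 4 ^ p ∧
          open Classical in
          z = -4 ^ p + ((Finset.range (2 * 4 ^ p)).filter fun t =>
            D t (SignType.sign (∑ j ∈ J, W t (s j) (v j)))).card

theorem IsRounding.nonempty_attentionWeights {p : ℕ} {ρ : ℝ → ℝ} (hρ : IsRounding p ρ) (m n : ℕ) :
    Nonempty (AttentionWeights ρ m n p) := by
  obtain ⟨W, D, h1, h2⟩ := exists_attention_weights hρ m n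
  exact ⟨⟨W, D, h1, h2⟩⟩

theorem IsFixedPoint.sum_mul {p m : ℕ} {x y : Fin m → ℝ} (hx : ∀ d, IsFixedPoint p (x d))
    (hy : ∀ d, IsFixedPoint p (y d)) :
    |∑ d, x d * y d| ≤ m * 4 ^ p ∧ ∃ a : ℤ, (∑ d, x d * y d) * 4 ^ p = a := by
  have h4 : (4 : ℝ) ^ p = 2 ^ p * 2 ^ p := by rw [← mul_pow]; norm_num
  constructor
  · refine (Finset.abs_sum_le_sum_abs _ _).trans ?_
    refine (Finset.sum_le_sum (g := fun _ => (4 : ℝ) ^ p) fun d _ => ?_).trans (by simp)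
    rw [abs_mul, h4]
    exact mul_le_mul (hx d).1 (hy d).1 (abs_nonneg _) (by positivity)
  · choose a ha using fun d => (hx d).2
    choose b hb using fun d => (hy d).2
    refine ⟨∑ d, a d * b d, ?_⟩
    rw [Finset.sum_mul]
    push_cast
    refine Finset.sum_congr rfl fun d _ => ?_
    rw [← ha, ← hb, h4]
    ring

/-- The score of position `j` for the query of position `i`. -/
noncomputable def CausalTransformer.score (l : Fin L) (h : Fin H) (i j : Fin N)
    (yi yj : Fin m → ℝ) : ℝ :=
  ∑ d, T.query l h i yi d * T.key l h j yj d

-- By causality row `i` attends to at most `n` positions when `i < n`, so weights made for sums of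
-- `n` terms suffice even if the context is longer.
open Classical in
theorem CausalTransformer.HasPrecision.rho_attention {T : CausalTransformer N m L H} {p n : ℕ}
    (hT : T.HasPrecision p) {ρ : ℝ → ℝ} (A : AttentionWeights ρ m n p) (l : Fin L) (h : Fin H)
    (Y : Fin N → Fin m → ℝ) (i : Fin N) (hi : i.val < n) (c : Fin m) :
    ∃ z : ℤ, ρ (T.attention l h Y i c) * 2 ^ p = z ∧ |z| ≤ 4 ^ p ∧
      z = -4 ^ p + ((Finset.range (2 * 4 ^ p)).filter fun t =>
        A.D t (SignType.sign (∑ j ∈ Finset.Iic i,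
          A.W t (T.score l h i j (Y i) (Y j)) (T.value l h j (Y j) c)))).card := by
  refine A.spec (Finset.Iic i) ⟨i, by simp⟩ (by simpa using hi)
    (fun j => T.score l h i j (Y i) (Y j)) (fun j => T.value l h j (Y j) c)
    (fun j _ => IsFixedPoint.sum_mul (fun d => (hT l h i (Y i) d).1) fun d => (hT l h j (Y j) d).2.1)
    fun j _ => (hT l h j (Y j) c).2.2

/-- Each head adds an integral number of units `2⁻ᵖ`, at most `4 ^ p` in size. So the floor in
`increment` is exact, and a modulus of polynomial size can store the increments. -/
theorem CausalTransformer.HasPrecision.increment_spec {T : CausalTransformer N m L H} {p n : ℕ}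
    (hT : T.HasPrecision p) {ρ : ℝ → ℝ} (A : AttentionWeights ρ m n p) (X : Fin N → ℝ) {l : ℕ}
    (hl : l ≤ L) (i : Fin N) (hi : i.val < n) (c : Fin m) :
    T.embedding ρ X l i c = T.embedding ρ X 0 i c + T.increment ρ p X l i c / 2 ^ p ∧
      |T.increment ρ p X l i c| ≤ l * H * 4 ^ p := by
  have hp : (0 : ℝ) < 2 ^ p := by positivity
  suffices h : ∃ z : ℤ, (T.embedding ρ X l i c - T.embedding ρ X 0 i c) * 2 ^ p = z ∧
      |z| ≤ l * H * 4 ^ p by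
    obtain ⟨z, hz, hz'⟩ := h
    have : T.increment ρ p X l i c = z := by rw [CausalTransformer.increment, hz, Int.floor_intCast]
    rw [this]
    refine ⟨?_, hz'⟩
    rw [← hz]
    field_simp
    ring
  induction l with
  | zero => exact ⟨0, by simp⟩
  | succ l ih =>
    obtain ⟨z, hz, hz'⟩ := ih (by omega)
    choose a ha ha' _ using fun h =>
      hT.rho_attention A ⟨l, hl⟩ h (T.embedding ρ X l) i hi c
    refine ⟨z + ∑ h, a h, ?_, ?_⟩
    · rw [T.embedding_succ ρ X hl]
      push_cast
      rw [← hz, ← Finset.sum_congr rfl fun h _ => ha h, ← Finset.sum_mul]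
      ring
    · refine (abs_add_le _ _).trans ?_
      have : |∑ h, a h| ≤ H * 4 ^ p := by
        refine (Finset.abs_sum_le_sum_abs _ _).trans ?_
        refine (Finset.sum_le_sum fun h _ => ha' h).trans (by simp)
      push_cast
      linarith

-- The recursion that the grid evaluates: integers only, with the softmax reduced to signs of
-- integer sums.
open Classical in
theorem CausalTransformer.HasPrecision.increment_succ {T : CausalTransformer N m L H} {p n : ℕ}
    (hT : T.HasPrecision p) {ρ : ℝ → ℝ} (A : AttentionWeights ρ m n p) (X : Fin N → ℝ) {l : ℕ}
    (hl : l < L) (i : Fin N) (hi : i.val < n) (c : Fin m) :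
    T.increment ρ p X (l + 1) i c = T.increment ρ p X l i c + ∑ h : Fin H,
      ((((Finset.range (2 * 4 ^ p)).filter fun t =>
        A.D t (SignType.sign (∑ j ∈ Finset.Iic i,
          A.W t (T.score ⟨l, hl⟩ h i j (T.embedding ρ X l i) (T.embedding ρ X l j))
            (T.value ⟨l, hl⟩ h j (T.embedding ρ X l j) c)))).card : ℤ) - 4 ^ p) := by
  have hp : (0 : ℝ) < 2 ^ p := by positivity
  choose a ha _ ha' using fun h => hT.rho_attention A ⟨l, hl⟩ h (T.embedding ρ X l) i hi c
  have h1 : ∀ h : Fin H, ((((Finset.range (2 * 4 ^ p)).filter fun t =>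
        A.D t (SignType.sign (∑ j ∈ Finset.Iic i,
          A.W t (T.score ⟨l, hl⟩ h i j (T.embedding ρ X l i) (T.embedding ρ X l j))
            (T.value ⟨l, hl⟩ h j (T.embedding ρ X l j) c)))).card : ℤ) - 4 ^ p) = a h := by
    intro h
    rw [ha' h]
    ring
  rw [Finset.sum_congr rfl fun h _ => h1 h]
  have h2 := (hT.increment_spec A X hl.le i hi c).1
  have h3 := (hT.increment_spec A X (Nat.succ_le_of_lt hl) i hi c).1
  have h4 := T.embedding_succ ρ X hl i c
  have h5 : (∑ h, ρ (T.attention ⟨l, hl⟩ h (T.embedding ρ X l) i c)) * 2 ^ p =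
      ((∑ h, a h : ℤ) : ℝ) := by
    rw [Finset.sum_mul, Finset.sum_congr rfl fun h _ => ha h]
    push_cast; rfl
  have h6 : (T.increment ρ p X (l + 1) i c : ℝ) = T.increment ρ p X l i c + (∑ h, a h : ℤ) := by
    rw [← h5]
    rw [h3, h2] at h4
    field_simp at h4
    linarith
  exact_mod_cast h6

end Transformer

/-! ### Embeddings stored in grid cells -/

section Simulation

variable {N m L H : ℕ} (T : CausalTransformer N m L H) (ρ : ℝ → ℝ) {σ : ℕ}
  (code : Option (Fin σ) → ℝ) (p F M n : ℕ)

/-- The embeddings of an input sequence of tokens. -/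
noncomputable abbrev CausalTransformer.tokenEmbedding (tok : Fin N → Fin σ) : ℕ → Fin N → Fin m → ℝ :=
  T.embedding ρ fun j => code (some (tok j))

/-- The grid cell with number `c` for the position `i`: the first `m` cells hold the increments of
the embedding, the others hold the token. -/
noncomputable def CausalTransformer.cell (tok : Fin N → Fin σ) (l i : ℕ) (c : Fin F) : ZMod M :=
  if hi : i < N ∧ i < n then
    if hc : c.val < m then
      (T.increment ρ p (fun j => code (some (tok j))) l ⟨i, hi.1⟩ ⟨c.val, hc⟩ : ZMod M)
    else ((tok ⟨i, hi.1⟩).val : ZMod M)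
  else 0

/-- The embedding that is represented by the cells of one position. -/
noncomputable def rowEmbedding {σ : ℕ} (code : Option (Fin σ) → ℝ) (p : ℕ) {F M m : ℕ} (hm : m < F)
    (u : Fin F → ZMod M) (d : Fin m) : ℝ :=
  (if d.val = 0 then
    if h : (u ⟨m, hm⟩).val < σ then code (some ⟨(u ⟨m, hm⟩).val, h⟩) else 0
  else 0) + ((u ⟨d.val, d.isLt.trans hm⟩).valMinAbs : ℝ) / 2 ^ p

variable {T ρ code p F M n}

/-- Increments are below `M / 2` in absolute value and tokens below `M`, so the residues lose
nothing. The token occupies cell `m`, whence `m < F`. -/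
theorem rowEmbedding_cell [NeZero M] (hT : T.HasPrecision p) (A : AttentionWeights ρ m n p)
    (hm : m < F) (tok : Fin N → Fin σ) (htok : ∀ i : Fin N, i.val < n → (tok i).val < M)
    (hM : 2 * (L * H * 4 ^ p) < M)
    {l : ℕ} (hl : l ≤ L) (i : Fin N) (hi : i.val < n) :
    rowEmbedding code p hm (T.cell ρ code p F M n tok l i.val) = T.tokenEmbedding ρ code tok l i := by
  funext d
  have hc : ∀ c : Fin F, T.cell ρ code p F M n tok l i.val c = if hc : c.val < m then
      (T.increment ρ p (fun j => code (some (tok j))) l i ⟨c.val, hc⟩ : ZMod M)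
      else ((tok i).val : ZMod M) := by
    intro c
    rw [CausalTransformer.cell, dif_pos ⟨i.isLt, hi⟩]
  obtain ⟨h1, h2⟩ := hT.increment_spec A (fun j => code (some (tok j))) hl i hi d
  have hval : (((tok i).val : ℕ) : ZMod M).val = (tok i).val := ZMod.val_cast_of_lt (htok i hi)
  have htok' : T.cell ρ code p F M n tok l i.val ⟨m, hm⟩ = ((tok i).val : ZMod M) := by
    rw [hc, dif_neg (lt_irrefl m)]
  have hd : T.cell ρ code p F M n tok l i.val ⟨d.val, d.isLt.trans hm⟩ =
      (T.increment ρ p (fun j => code (some (tok j))) l i d : ZMod M) := by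
    rw [hc, dif_pos d.isLt]
  rw [rowEmbedding, CausalTransformer.tokenEmbedding, h1, htok', hd]
  congr 1
  · simp only [CausalTransformer.embedding, hval, (tok i).isLt, dif_pos]
  · congr 2
    apply valMinAbs_intCast_of_abs_lt
    have hlH : (l * H * 4 ^ p : ℤ) ≤ L * H * 4 ^ p := by gcongr
    have : ((2 * (L * H * 4 ^ p) : ℕ) : ℤ) < M := by exact_mod_cast hM
    push_cast at this
    linarith

-- Blocks count up to `F ^ κ`, beyond the true ranges of positions, heads, thresholds and levels;
-- indices out of range contribute zero. Only the first `n` positions are simulated, and by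
-- causality they do not depend on later ones.
open Classical in
theorem computes_layers {X : Type} {κ : ℕ} [NeZero M] (hT : T.HasPrecision p)
    (A : AttentionWeights ρ m n p)
    (hm : m < F) (tok : X → Fin N → Fin σ) (htok : ∀ x, ∀ i : Fin N, i.val < n → (tok x i).val < M)
    (hM : 2 * (L * H * 4 ^ p) < M) (hnM : 4 * n < M) (hRM : 3 * attentionBits m n p + 3 < M)
    (hn : n ≤ F ^ κ) (hHB : H ≤ F ^ κ) (hpB : 2 * 4 ^ p ≤ F ^ κ) (hRB : attentionBits m n p < F ^ κ) :
    Computes (L * (5 * κ + 6))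
      (fun x => liftState (κ := κ) fun i c =>
        (T.cell ρ code p F M n (tok x) 0 (i 0) c, (0 : ZMod M)))
      (fun x => liftState (κ := κ) fun i c =>
        (T.cell ρ code p F M n (tok x) L (i 0) c, (0 : ZMod M))) := by
  have : Nonempty (BlockCoord κ) := ⟨none⟩
  refine Computes.iterate (v := fun l x => liftState (κ := κ) fun i c =>
        (T.cell ρ code p F M n (tok x) l (i 0) c, (0 : ZMod M))) fun l hl => ?_
  refine (computes_layer (fun x i c => T.cell ρ code p F M n (tok x) l i c)
    (fun i j t r h c ui uj => if hh : i < N ∧ h < H ∧ c.val < m then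
      if hj : j ≤ i then
        ((A.W t (T.score ⟨l, hl⟩ ⟨h, hh.2.1⟩ ⟨i, hh.1⟩ ⟨j, lt_of_le_of_lt hj hh.1⟩
          (rowEmbedding code p hm ui) (rowEmbedding code p hm uj))
          (T.value ⟨l, hl⟩ ⟨h, hh.2.1⟩ ⟨j, lt_of_le_of_lt hj hh.1⟩ (rowEmbedding code p hm uj)
            ⟨c.val, hh.2.2⟩) / 2 ^ r : ℤ) : ZMod M)
      else 0
    else 0)
    (fun r z => if r < attentionBits m n p + 1 then (levelCode n r z : ZMod M) else 0)
    (fun t z => if t < 2 * 4 ^ p ∧ A.D t (codeSign z.val) then 1 else 0)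
    (fun h z => if h < H then z - 4 ^ p else 0)
    (fun i c z z' => if i < N ∧ i < n ∧ c.val < m then z + z' else z)).congr fun x y => ?_
  simp only [liftState]
  generalize blockIndex y 0 = i
  generalize y none = c
  refine Prod.ext ?_ rfl
  dsimp only
  by_cases hh : i < N ∧ i < n ∧ c.val < m
  · obtain ⟨hiN, hin, hcm⟩ := hh
    rw [if_pos ⟨hiN, hin, hcm⟩]
    have hcell : ∀ l, T.cell ρ code p F M n (tok x) l i c =
        (T.increment ρ p (fun j => code (some (tok x j))) l ⟨i, hiN⟩ ⟨c.val, hcm⟩ : ZMod M) := by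
      intro l
      rw [CausalTransformer.cell, dif_pos ⟨hiN, hin⟩, dif_pos hcm]
    rw [hcell, hcell, hT.increment_succ A _ hl _ hin]
    push_cast
    congr 1
    rw [← sum_range_dite_lt hHB]
    refine Finset.sum_congr rfl fun h _ => ?_
    by_cases hh : h < H
    · rw [if_pos hh, dif_pos hh]
      congr 1
      rw [Finset.card_filter]
      push_cast
      have hsub : Finset.range (2 * 4 ^ p) ⊆ Finset.range (F ^ κ) := Finset.range_subset_range.2 hpB
      rw [← Finset.sum_subset hsub fun t _ ht => by
        rw [Finset.mem_range] at ht; rw [if_neg fun h => ht h.1]]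
      refine Finset.sum_congr rfl fun t ht => ?_
      have ht' := Finset.mem_range.1 ht
      have hsum : ∀ r, (∑ j ∈ Finset.range (F ^ κ), (if hh : i < N ∧ h < H ∧ c.val < m then
          if hj : j ≤ i then
          ((A.W t (T.score ⟨l, hl⟩ ⟨h, hh.2.1⟩ ⟨i, hh.1⟩ ⟨j, lt_of_le_of_lt hj hh.1⟩
            (rowEmbedding code p hm fun c => T.cell ρ code p F M n (tok x) l i c)
            (rowEmbedding code p hm fun c => T.cell ρ code p F M n (tok x) l j c))
            (T.value ⟨l, hl⟩ ⟨h, hh.2.1⟩ ⟨j, lt_of_le_of_lt hj hh.1⟩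
              (rowEmbedding code p hm fun c => T.cell ρ code p F M n (tok x) l j c)
              ⟨c.val, hh.2.2⟩) / 2 ^ r : ℤ) : ZMod M)
          else 0 else 0)) =
          ((∑ j ∈ Finset.Iic (⟨i, hiN⟩ : Fin N),
            A.W t (T.score ⟨l, hl⟩ ⟨h, hh⟩ ⟨i, hiN⟩ j
              (T.tokenEmbedding ρ code (tok x) l ⟨i, hiN⟩) (T.tokenEmbedding ρ code (tok x) l j))
            (T.value ⟨l, hl⟩ ⟨h, hh⟩ j (T.tokenEmbedding ρ code (tok x) l j) ⟨c.val, hcm⟩) / 2 ^ r : ℤ) :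
            ZMod M) := by
        intro r
        push_cast
        rw [← sum_range_dite_le (⟨i, hiN⟩ : Fin N) (hin.trans_le hn)]
        refine Finset.sum_congr rfl fun j _ => ?_
        rw [dif_pos ⟨hiN, hh, hcm⟩]
        by_cases hj : j ≤ i
        · rw [dif_pos hj, dif_pos hj]
          have e1 := rowEmbedding_cell (code := code) hT A hm (tok x) (htok x) hM hl.le ⟨i, hiN⟩ hin
          have e2 := rowEmbedding_cell (code := code) hT A hm (tok x) (htok x) hM hl.le
            ⟨j, lt_of_le_of_lt hj hiN⟩ (lt_of_le_of_lt hj hin)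
          rw [← e1, ← e2]
        · rw [dif_neg hj, dif_neg hj]
      -- Padding levels add only zeros to the maximum, and genuine codes stay below `M`.
      have hsup : ∀ f : ℕ → ZMod M, ((Finset.range (F ^ κ)).sup fun r =>
          (if r < attentionBits m n p + 1 then (levelCode n r (f r) : ZMod M) else 0 : ZMod M).val) =
          (Finset.range (attentionBits m n p + 1)).sup fun r => levelCode n r (f r) := by
        intro f
        apply le_antisymm
        · rw [Finset.sup_le_iff]
          intro r _
          split_ifs with hr
          · rw [ZMod.val_cast_of_lt (lt_of_le_of_lt (levelCode_le _ _ _) (by omega))]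
            exact Finset.le_sup (f := fun r => levelCode n r (f r)) (Finset.mem_range.2 hr)
          · simp
        · rw [Finset.sup_le_iff]
          intro r hr
          have hr' := Finset.mem_range.1 hr
          have := Finset.le_sup (f := fun r => (if r < attentionBits m n p + 1 then
            (levelCode n r (f r) : ZMod M) else 0 : ZMod M).val)
            (Finset.mem_range.2 (show r < F ^ κ by omega))
          refine le_trans (le_of_eq ?_) this
          rw [if_pos hr', ZMod.val_cast_of_lt (lt_of_le_of_lt (levelCode_le _ _ _) (by omega))]
      simp only [hsum]
      rw [hsup, ZMod.val_cast_of_lt, codeSign_sup_levelCode hnM ⟨⟨i, hiN⟩, by simp⟩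
        (by simpa using hin) fun j _ => A.lt _ _ _]
      · simp only [ht', true_and]
      · refine lt_of_le_of_lt (b := 3 * attentionBits m n p + 3) (Finset.sup_le fun r hr => ?_) hRM
        have := levelCode_le n r (((∑ j ∈ Finset.Iic (⟨i, hiN⟩ : Fin N),
            A.W t (T.score ⟨l, hl⟩ ⟨h, hh⟩ ⟨i, hiN⟩ j
              (T.tokenEmbedding ρ code (tok x) l ⟨i, hiN⟩) (T.tokenEmbedding ρ code (tok x) l j))
            (T.value ⟨l, hl⟩ ⟨h, hh⟩ j (T.tokenEmbedding ρ code (tok x) l j) ⟨c.val, hcm⟩) / 2 ^ r : ℤ) :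
            ZMod M))
        have := Finset.mem_range.1 hr
        omega
    · rw [if_neg hh, dif_neg hh]
  · rw [if_neg hh]
    unfold CausalTransformer.cell
    split_ifs with h1 h2
    · exact absurd ⟨h1.1, h1.2, h2⟩ hh
    · rfl
    · rfl

end Simulation

/-! ### Hopping through a sequence of blocks -/

theorem findOne_eq_some {N : ℕ} {A : Type*} {X : Fin N → A} {i j j' : Fin N} (hj' : j'.val + 1 = j.val)
    (hji : j ≤ i) (hX : X j' = X i) (hmax : ∀ l : Fin N, j ≤ l → l < i → X l ≠ X i) :
    findOne X i = some j := by
  classical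
  unfold findOne
  simp only
  split_ifs with h
  · rw [Option.some.injEq]
    apply le_antisymm
    · refine Finset.max'_le _ _ _ fun j₂ hj₂ => ?_
      simp only [Finset.mem_filter, Finset.mem_univ, true_and] at hj₂
      obtain ⟨h1, j₂', h2, h3⟩ := hj₂
      by_contra hlt
      rw [not_le] at hlt
      refine hmax j₂' ?_ ?_ h3
      · rw [Fin.le_def]; rw [Fin.lt_def] at hlt; omega
      · rw [Fin.lt_def]; rw [Fin.le_def] at h1; omega
    · apply Finset.le_max'
      simp only [Finset.mem_filter, Finset.mem_univ, true_and]
      exact ⟨hji, j', hj', hX⟩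
  · exfalso
    apply h
    refine ⟨j, ?_⟩
    simp only [Finset.mem_filter, Finset.mem_univ, true_and]
    exact ⟨hji, j', hj', hX⟩

/-- The map that is listed in block `t`: `f` in the first `R` blocks, then the identity. -/
def blockMap (R : ℕ) (f : ℕ → ℕ) (t i : ℕ) : ℕ := if t < R then f i else i

/-- The token at position `P` if state `i` (with the parity of its block) is written as `2 * i` or
`2 * i + 1`. There are `k` blocks, each of which lists the `S` pairs of a state and its image. -/
def seqToken (S R k : ℕ) (f : ℕ → ℕ) (P : ℕ) : ℕ :=
  if P < 2 * S * k then
    if P % 2 = 0 then 2 * (P % (2 * S) / 2) + P / (2 * S) % 2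
    else 2 * blockMap R f (P / (2 * S)) (P % (2 * S) / 2) + (P / (2 * S) + 1) % 2
  else (k - 1) % 2

theorem blockMap_lt {S R : ℕ} {f : ℕ → ℕ} (hf : ∀ i < S, f i < S) (t : ℕ) {i : ℕ} (hi : i < S) :
    blockMap R f t i < S := by
  unfold blockMap
  split_ifs
  · exact hf i hi
  · exact hi

theorem blockMap_inj {S R : ℕ} {f : ℕ → ℕ} (hinj : Set.InjOn f (Set.Iio S)) (t : ℕ) {i j : ℕ}
    (hi : i < S) (hj : j < S) (h : blockMap R f t i = blockMap R f t j) : i = j := by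
  unfold blockMap at h
  split_ifs at h
  · exact hinj hi hj h
  · exact h

theorem seqToken_lt {S R k : ℕ} {f : ℕ → ℕ} (hS : 0 < S) (hf : ∀ i < S, f i < S) (P : ℕ) :
    seqToken S R k f P < 2 * S := by
  have h1 : P % (2 * S) / 2 < S := by have := Nat.mod_lt P (show 0 < 2 * S by omega); omega
  have h2 := blockMap_lt (R := R) hf (P / (2 * S)) h1
  unfold seqToken
  split_ifs <;> omega

theorem block_position_lt {S k t a : ℕ} (ht : t < k) (ha : a < 2 * S) : t * (2 * S) + a < 2 * S * k := by
  have := Nat.mul_le_mul_right (2 * S) (Nat.succ_le_of_lt ht)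
  rw [Nat.succ_mul] at this
  rw [mul_comm (2 * S) k]
  omega

theorem seqToken_even {S R k : ℕ} (f : ℕ → ℕ) {t i : ℕ} (ht : t < k) (hi : i < S) :
    seqToken S R k f (t * (2 * S) + 2 * i) = 2 * i + t % 2 := by
  have hS : 0 < 2 * S := by omega
  have h1 : (t * (2 * S) + 2 * i) % (2 * S) = 2 * i := by
    rw [add_comm, Nat.add_mul_mod_self_right]; exact Nat.mod_eq_of_lt (by omega)
  have h2 : (t * (2 * S) + 2 * i) / (2 * S) = t := by
    rw [add_comm, Nat.add_mul_div_right _ _ hS, Nat.div_eq_of_lt (by omega), zero_add]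
  have h3 : (t * (2 * S) + 2 * i) % 2 = 0 := by
    rw [show t * (2 * S) + 2 * i = 2 * (t * S + i) by ring]; exact Nat.mul_mod_right _ _
  rw [seqToken, if_pos (block_position_lt ht (by omega)), if_pos h3, h1, h2]
  omega

theorem seqToken_odd {S R k : ℕ} (f : ℕ → ℕ) {t i : ℕ} (ht : t < k) (hi : i < S) :
    seqToken S R k f (t * (2 * S) + (2 * i + 1)) = 2 * blockMap R f t i + (t + 1) % 2 := by
  have hS : 0 < 2 * S := by omega
  have h1 : (t * (2 * S) + (2 * i + 1)) % (2 * S) = 2 * i + 1 := by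
    rw [add_comm, Nat.add_mul_mod_self_right]; exact Nat.mod_eq_of_lt (by omega)
  have h2 : (t * (2 * S) + (2 * i + 1)) / (2 * S) = t := by
    rw [add_comm, Nat.add_mul_div_right _ _ hS, Nat.div_eq_of_lt (by omega), zero_add]
  have h3 : ¬ (t * (2 * S) + (2 * i + 1)) % 2 = 0 := by
    rw [show t * (2 * S) + (2 * i + 1) = 2 * (t * S + i) + 1 by ring]; omega
  rw [seqToken, if_pos (block_position_lt ht (by omega)), if_neg h3, h1, h2]
  congr 3
  omega

theorem exists_block_position {S k P : ℕ} (hP : P < 2 * S * k) : ∃ t < k, ∃ i < S,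
    P = t * (2 * S) + 2 * i ∨ P = t * (2 * S) + (2 * i + 1) := by
  have hS : 0 < 2 * S := Nat.pos_of_ne_zero fun h => by simp [h] at hP
  have h1 := Nat.div_add_mod P (2 * S)
  have h2 := Nat.mod_lt P hS
  refine ⟨P / (2 * S), Nat.div_lt_of_lt_mul hP, P % (2 * S) / 2, by omega, ?_⟩
  rw [mul_comm] at h1
  omega

theorem block_le_of_lt {S t t' a a' : ℕ} (ha' : a' < 2 * S)
    (h : t * (2 * S) + a ≤ t' * (2 * S) + a') : t ≤ t' := by
  by_contra hlt
  have := Nat.mul_le_mul_right (2 * S) (Nat.succ_le_of_lt (not_le.1 hlt))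
  rw [Nat.succ_mul] at this
  omega

/-- The states that are visited by hopping. -/
def hopState (R k : ℕ) (f : ℕ → ℕ) : ℕ → ℕ
  | 0 => 0
  | t + 1 => blockMap R f (k - (t + 1)) (hopState R k f t)

theorem hopState_lt {S R k : ℕ} {f : ℕ → ℕ} (hS : 0 < S) (hf : ∀ i < S, f i < S) (t : ℕ) :
    hopState R k f t < S := by
  induction t with
  | zero => exact hS
  | succ t ih => exact blockMap_lt hf _ ih

theorem hopState_of_le {R k : ℕ} (f : ℕ → ℕ) {t : ℕ} (ht : t + R ≤ k) : hopState R k f t = 0 := by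
  induction t with
  | zero => rfl
  | succ t ih => rw [hopState, ih (by omega), blockMap, if_neg (by omega)]

theorem hopState_add {R k : ℕ} (f : ℕ → ℕ) (hR : R ≤ k) {u : ℕ} (hu : u ≤ R) :
    hopState R k f (k - R + u) = f^[u] 0 := by
  induction u with
  | zero => exact hopState_of_le f (by omega)
  | succ u ih =>
    rw [← add_assoc, hopState, ih (by omega), blockMap, if_pos (by omega), Function.iterate_succ_apply']

section Hop

variable {N S R k : ℕ} {f : ℕ → ℕ} {A : Type*} {X : Fin N → A} {sym : ℕ → A}

/-- Between `j` and `i` only blocks `t` and `t + 1` occur. Sources carry the parity of their block,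
so a matching source lies in block `t` and sits just before `j`. Images carry the opposite parity,
so a matching image lies in block `t + 1` and, by injectivity of `f`, is `i` itself. -/
theorem findOne_block (hsym : Set.InjOn sym (Set.Iio (2 * S))) (hf : ∀ i < S, f i < S)
    (hinj : Set.InjOn f (Set.Iio S))
    (hX : ∀ P : Fin N, P.val ≤ 2 * S * k → X P = sym (seqToken S R k f P.val))
    {t g : ℕ} (ht : t < k) (hg : g < S) {i j : Fin N}
    (hi : X i = sym (2 * g + t % 2))
    (hpos : (i.val = (t + 1) * (2 * S) ∧ t + 1 = k) ∨ ∃ i₀ < S, i.val = (t + 1) * (2 * S) + (2 * i₀ + 1) ∧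
      t + 1 < k ∧ g = blockMap R f (t + 1) i₀)
    (hj : j.val = t * (2 * S) + (2 * g + 1)) : findOne X i = some j := by
  have hS : 0 < S := by omega
  have hik : i.val ≤ 2 * S * k := by
    rcases hpos with ⟨h, h'⟩ | ⟨i₀, h1, h2, h3, -⟩
    · rw [h, h', mul_comm]
    · rw [h2]; exact (block_position_lt h3 (by omega)).le
  have hti : (t + 1) * (2 * S) ≤ i.val := by
    rcases hpos with ⟨h, h'⟩ | ⟨i₀, h1, h2, h3, -⟩ <;> omega
  rw [Nat.succ_mul] at hti
  have hjN := j.isLt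
  refine findOne_eq_some (j' := ⟨t * (2 * S) + 2 * g, by omega⟩) (by simp only; omega) ?_ ?_ ?_
  · rw [Fin.le_def]; omega
  · rw [hX _ (block_position_lt ht (by omega)).le, hi]
    dsimp only
    rw [seqToken_even f ht hg]
  · intro l hjl hli heq
    rw [Fin.le_def] at hjl
    rw [Fin.lt_def] at hli
    rw [hX l (by omega), hi] at heq
    have heq' := hsym (seqToken_lt hS hf _) (by simp only [Set.mem_Iio]; omega) heq
    obtain ⟨t', ht', i', hi', h⟩ := exists_block_position (show l.val < 2 * S * k by omega)
    have htt' : t ≤ t' := by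
      rcases h with h | h <;>
      · rw [hj, h] at hjl
        exact block_le_of_lt (by omega) hjl
    have ht't : t' ≤ t + 1 := by
      rcases hpos with ⟨h2, h'⟩ | ⟨i₀, h1, h2, h3, -⟩
      · omega
      · rcases h with h | h <;>
        · rw [h, h2] at hli
          exact block_le_of_lt (by omega) hli.le
    rcases h with h | h
    · rw [h, seqToken_even f ht' hi'] at heq'
      have : t' = t := by omega
      subst this
      omega
    · rw [h, seqToken_odd f ht' hi'] at heq'
      have : t' = t + 1 := by omega
      subst this
      rcases hpos with ⟨h2, h'⟩ | ⟨i₀, h1, h2, h3, h4⟩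
      · omega
      · have h5 : blockMap R f (t + 1) i' = blockMap R f (t + 1) i₀ := by omega
        have := blockMap_inj hinj _ hi' h1 h5
        subst this
        omega

/-- The final position carries state `0` with the parity of the last block, and each hop lands on
the image of the current state one block further left. The first `k - R` hops cross identity blocks,
the last `R` apply `f`. The summand `1` is the parity of images in block `0`. -/
theorem hop_seqToken (hsym : Set.InjOn sym (Set.Iio (2 * S))) (hf : ∀ i < S, f i < S)
    (hinj : Set.InjOn f (Set.Iio S))
    (hX : ∀ P : Fin N, P.val ≤ 2 * S * k → X P = sym (seqToken S R k f P.val))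
    (hS : 0 < S) (hR : R ≤ k) (hk : 0 < k) (i : Fin N) (hi : i.val = 2 * S * k) :
    hop k X i = some (sym (2 * f^[R] 0 + 1)) := by
  have hN : 2 * S * k < N := hi ▸ i.isLt
  have key : ∀ t, t < k → ∃ j : Fin N,
      j.val = (k - (t + 1)) * (2 * S) + (2 * hopState R k f t + 1) ∧
      findHop X (t + 1) i = some j := by
    intro t
    induction t with
    | zero =>
      intro _
      have hlt : (k - (0 + 1)) * (2 * S) + (2 * hopState R k f 0 + 1) < N :=
        (block_position_lt (k := k) (by omega) (by have := hopState_lt (R := R) (k := k) hS hf 0; omega)).trans hN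
      refine ⟨⟨_, hlt⟩, rfl, ?_⟩
      simp only [findHop, Option.bind_some]
      refine findOne_block (t := k - 1) (g := 0) hsym hf hinj hX (by omega) hS ?_ (Or.inl ⟨?_, by omega⟩) ?_
      · rw [hX i hi.le, hi, seqToken, if_neg (lt_irrefl _)]
        congr 1
        omega
      · rw [hi, Nat.sub_add_cancel hk, mul_comm]
      · simp [hopState]
    | succ t ih =>
      intro ht
      obtain ⟨j, hj, hfind⟩ := ih (by omega)
      have hst := hopState_lt (R := R) (k := k) hS hf t
      have hst' := hopState_lt (R := R) (k := k) hS hf (t + 1)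
      have hlt : (k - (t + 1 + 1)) * (2 * S) + (2 * hopState R k f (t + 1) + 1) < N :=
        (block_position_lt (k := k) (by omega) (by omega)).trans hN
      refine ⟨⟨_, hlt⟩, rfl, ?_⟩
      rw [findHop, hfind, Option.bind_some]
      have e1 : k - (t + 1 + 1) + 1 = k - (t + 1) := by omega
      refine findOne_block (t := k - (t + 1 + 1)) (g := hopState R k f (t + 1)) hsym hf hinj hX
        (by omega) hst' ?_ (Or.inr ⟨hopState R k f t, hst, ?_, by omega, ?_⟩) rfl
      · rw [hX j (by rw [hj]; exact (block_position_lt (by omega) (by omega)).le), hj,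
          seqToken_odd f (by omega) hst]
        congr 1
        simp only [hopState]
        omega
      · rw [hj, e1]
      · rw [e1]; rfl
  obtain ⟨j, hj, hfind⟩ := key (k - 1) (by omega)
  rw [Nat.sub_add_cancel hk] at hj hfind
  have hst := hopState_lt (R := R) (k := k) hS hf (k - 1)
  rw [hop, hfind, Option.map_some, hX j (by rw [hj]; exact (block_position_lt (by omega) (by omega)).le),
    hj, seqToken_odd f (by omega) hst]
  have h1 : blockMap R f (k - k) (hopState R k f (k - 1)) = f^[R] 0 := by
    rw [← hopState_add (k := k) f hR le_rfl, Nat.sub_add_cancel hR]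
    obtain ⟨k', rfl⟩ : ∃ k', k = k' + 1 := ⟨k - 1, by omega⟩
    rfl
  rw [h1, Nat.sub_self]

end Hop

/-! ### Walking along the half-edges of a union of cycles -/

/-- The other half of the edge of a half-edge. -/
def flipEdge (i : ℕ) : ℕ := if i % 2 = 0 then i + 1 else i - 1

theorem flipEdge_flipEdge (i : ℕ) : flipEdge (flipEdge i) = i := by
  unfold flipEdge; split_ifs <;> omega

theorem flipEdge_lt {n i : ℕ} (hi : i < 2 * n) : flipEdge i < 2 * n := by
  unfold flipEdge; split_ifs <;> omega

/-- The word at an input position. -/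
def inputWord {n p : ℕ} (x : Fin (2 * n) → Word p) (i : ℕ) : Word p :=
  if h : i < 2 * n then x ⟨i, h⟩ else 0

/-- The half-edge at the far end of the edge that follows the half-edge `i`: the partner of the
other half-edge with the same endpoint. -/
def nextHalfEdge {n p : ℕ} (x : Fin (2 * n) → Word p) (i : ℕ) : ℕ :=
  ∑ j ∈ Finset.range (2 * n),
    if i < 2 * n ∧ i ≠ j ∧ inputWord x i = inputWord x j then flipEdge j else 0

section Walk

variable {n p : ℕ} {x : Fin (2 * n) → Word p} {V B Γ : Type*} [AddCommGroup Γ] {G : SimpleGraph V}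
  {vert : ℕ → V} {side : V → B} {pos : V → Γ} {e : Γ}

/-- The half-edges below `2 * n` are those of the graph `G`, whose vertices are arranged in cycles
with the steps `e` and `-e`. -/
structure HalfEdges (x : Fin (2 * n) → Word p) (G : SimpleGraph V) (vert : ℕ → V) (side : V → B)
    (pos : V → Γ) (e : Γ) : Prop where
  word : ∀ i < 2 * n, ∀ j < 2 * n, inputWord x i = inputWord x j ↔ vert i = vert j
  adj_flip : ∀ i < 2 * n, G.Adj (vert (flipEdge i)) (vert i)
  inj : ∀ i < 2 * n, ∀ j < 2 * n, vert i = vert j → vert (flipEdge i) = vert (flipEdge j) → i = j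
  exists_of_adj : ∀ a b, G.Adj a b → ∃ i < 2 * n, vert i = a ∧ vert (flipEdge i) = b
  adj : ∀ a b, G.Adj a b ↔ side a = side b ∧ (pos b = pos a + e ∨ pos b = pos a - e)
  ext : ∀ a b, side a = side b → pos a = pos b → a = b
  surj : ∀ a g, ∃ b, side a = side b ∧ pos b = g
  two : e ≠ -e

/-- The vertex of `i` has the two neighbours at `pos + d` and `pos - d`, distinct because `d ≠ -d`.
The edge of `i` leads to the second, so the only other half-edge there belongs to the edge towards
the first. The direction `d` persists. -/
theorem HalfEdges.next_spec (h : HalfEdges x G vert side pos e) {i : ℕ} (hi : i < 2 * n) {d : Γ}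
    (hd : d = e ∨ d = -e) (hdi : pos (vert i) = pos (vert (flipEdge i)) + d) :
    nextHalfEdge x i < 2 * n ∧ vert (flipEdge (nextHalfEdge x i)) = vert i ∧
      side (vert (nextHalfEdge x i)) = side (vert i) ∧
      pos (vert (nextHalfEdge x i)) = pos (vert i) + d := by
  have hdd : d ≠ -d := by
    rcases hd with rfl | rfl
    · exact h.two
    · rw [neg_neg]; exact h.two.symm
  obtain ⟨b, hb1, hb2⟩ := h.surj (vert i) (pos (vert i) + d)
  have hadj : G.Adj (vert i) b := by
    rw [h.adj]
    refine ⟨hb1, ?_⟩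
    rcases hd with rfl | rfl
    · exact Or.inl hb2
    · exact Or.inr (by rw [hb2, sub_eq_add_neg])
  obtain ⟨j, hj, hj1, hj2⟩ := h.exists_of_adj _ _ hadj
  have hij : i ≠ j := by
    rintro rfl
    rw [← hj2, hdi] at hb2
    apply hdd
    rw [eq_neg_iff_add_eq_zero]
    rw [add_assoc] at hb2
    exact (left_eq_add.1 hb2)
  have huniq : ∀ l < 2 * n, i ≠ l → vert i = vert l → l = j := by
    intro l hl hil hv
    have hadj' := (h.adj_flip l hl).symm
    rw [← hv, h.adj] at hadj'
    have hpos : pos (vert (flipEdge l)) = pos (vert i) + d ∨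
        pos (vert (flipEdge l)) = pos (vert (flipEdge i)) := by
      rw [hdi]
      rcases hd with rfl | rfl
      · rcases hadj'.2 with h1 | h1
        · left; rw [h1, hdi]
        · right; rw [h1, hdi]; abel
      · rcases hadj'.2 with h1 | h1
        · right; rw [h1, hdi]; abel
        · left; rw [h1, hdi]; abel
    rcases hpos with h1 | h1
    · refine h.inj l hl j hj (hv.symm.trans hj1.symm) (h.ext _ _ ?_ ?_)
      · rw [hj2, ← hadj'.1, hb1]
      · rw [hj2, h1, hb2]
    · refine absurd (h.inj i hi l hl hv (h.ext _ _ ?_ h1.symm)) hil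
      rw [← hadj'.1]
      exact ((h.adj _ _).1 (h.adj_flip i hi)).1
  have hnext : nextHalfEdge x i = flipEdge j := by
    -- Exactly one term of the defining sum is selected; a sum is used because the grid can evaluate
    -- it.
    rw [nextHalfEdge, Finset.sum_eq_single_of_mem j (Finset.mem_range.2 hj), if_pos]
    · exact ⟨hi, hij, (h.word i hi j hj).2 hj1.symm⟩
    · intro l hl hlj
      rw [Finset.mem_range] at hl
      rw [if_neg]
      rintro ⟨-, h1, h2⟩
      exact hlj (huniq l hl h1 ((h.word i hi l hl).1 h2))
  rw [hnext, flipEdge_flipEdge, hj2]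
  exact ⟨flipEdge_lt hj, hj1, hb1.symm, hb2⟩

theorem HalfEdges.exists_direction (h : HalfEdges x G vert side pos e) {i : ℕ} (hi : i < 2 * n) :
    ∃ d, (d = e ∨ d = -e) ∧ pos (vert i) = pos (vert (flipEdge i)) + d := by
  rcases ((h.adj _ _).1 (h.adj_flip i hi)).2 with h1 | h1
  · exact ⟨e, Or.inl rfl, h1⟩
  · exact ⟨-e, Or.inr rfl, by rw [h1, sub_eq_add_neg]⟩

theorem HalfEdges.next_lt (h : HalfEdges x G vert side pos e) : ∀ i < 2 * n,
    nextHalfEdge x i < 2 * n := by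
  intro i hi
  obtain ⟨d, hd, hdi⟩ := h.exists_direction hi
  exact (h.next_spec hi hd hdi).1

/-- The successor reveals the vertex of `i` and the direction of travel, hence both ends of the edge
of `i`. -/
theorem HalfEdges.next_injOn (h : HalfEdges x G vert side pos e) :
    Set.InjOn (nextHalfEdge x) (Set.Iio (2 * n)) := by
  intro i hi j hj hij
  obtain ⟨d, hd, hdi⟩ := h.exists_direction hi
  obtain ⟨d', hd', hdj⟩ := h.exists_direction hj
  obtain ⟨-, h1, -, h2⟩ := h.next_spec hi hd hdi
  obtain ⟨-, h1', -, h2'⟩ := h.next_spec hj hd' hdj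
  rw [hij] at h1 h2
  have hv : vert i = vert j := h1.symm.trans h1'
  have hdd : d = d' := by rw [h2', hv] at h2; exact (add_left_cancel h2).symm
  refine h.inj i hi j hj hv (h.ext _ _ ?_ ?_)
  · rw [((h.adj _ _).1 (h.adj_flip i hi)).1, ((h.adj _ _).1 (h.adj_flip j hj)).1, hv]
  · rw [hv, hdj, hdd] at hdi
    exact (add_right_cancel hdi).symm

theorem HalfEdges.iterate_spec (h : HalfEdges x G vert side pos e) {i : ℕ} (hi : i < 2 * n) {d : Γ}
    (hd : d = e ∨ d = -e) (hdi : pos (vert i) = pos (vert (flipEdge i)) + d) (t : ℕ) :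
    (nextHalfEdge x)^[t] i < 2 * n ∧ side (vert ((nextHalfEdge x)^[t] i)) = side (vert i) ∧
      pos (vert ((nextHalfEdge x)^[t] i)) = pos (vert i) + t • d ∧
      pos (vert ((nextHalfEdge x)^[t] i)) = pos (vert (flipEdge ((nextHalfEdge x)^[t] i))) + d := by
  induction t with
  | zero => simpa using ⟨hi, hdi⟩
  | succ t ih =>
    obtain ⟨h1, h2, h3, h4⟩ := ih
    rw [Function.iterate_succ_apply']
    obtain ⟨e1, e2, e3, e4⟩ := h.next_spec h1 hd h4
    refine ⟨e1, e3.trans h2, ?_, ?_⟩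
    · rw [e4, h3, succ_nsmul, add_assoc]
    · rw [e4, e2]

/-- After `t` steps the position has moved by `t • d` on the same side, with the same direction;
vertex and direction determine the half-edge. -/
theorem HalfEdges.iterate_eq_iff (h : HalfEdges x G vert side pos e) {i : ℕ} (hi : i < 2 * n)
    (t : ℕ) : (nextHalfEdge x)^[t] i = i ↔ t • e = 0 := by
  obtain ⟨d, hd, hdi⟩ := h.exists_direction hi
  obtain ⟨h1, h2, h3, h4⟩ := h.iterate_spec hi hd hdi t
  have hed : t • e = 0 ↔ t • d = 0 := by
    rcases hd with rfl | rfl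
    · rfl
    · rw [smul_neg, neg_eq_zero]
  rw [hed]
  constructor
  · intro heq
    rw [heq] at h3
    exact left_eq_add.1 h3
  · intro h0
    rw [h0, add_zero] at h3
    refine h.inj _ h1 i hi (h.ext _ _ h2 h3) (h.ext _ _ ?_ ?_)
    · rw [((h.adj _ _).1 (h.adj_flip _ h1)).1, h2, ((h.adj _ _).1 (h.adj_flip i hi)).1]
    · rw [h3, hdi] at h4
      exact (add_right_cancel h4).symm

end Walk

theorem SerializesGraph.halfEdges {n p : ℕ} {G : SimpleGraph (Fin n)} {x : Fin (2 * n) → Word p}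
    (hx : SerializesGraph G x) (hp : n ≤ 2 ^ p) {B Γ : Type*} [AddCommGroup Γ] {side : Fin n → B}
    {pos : Fin n → Γ} {e : Γ}
    (adj : ∀ a b, G.Adj a b ↔ side a = side b ∧ (pos b = pos a + e ∨ pos b = pos a - e))
    (ext : ∀ a b, side a = side b → pos a = pos b → a = b)
    (surj : ∀ a g, ∃ b, side a = side b ∧ pos b = g) (two : e ≠ -e) (hn : 0 < n) :
    (∀ ι, (x ι).val < n) ∧ ∃ vert, HalfEdges x G vert side pos e := by
  obtain ⟨u, v, hinj, hrange, hw⟩ := hx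
  let vert : ℕ → Fin n := fun i => if h : i / 2 < n then
    if i % 2 = 0 then u ⟨i / 2, h⟩ else v ⟨i / 2, h⟩ else ⟨0, hn⟩
  have he : ∀ j : Fin n, vert (2 * j.val) = u j := fun j => by
    have h1 : 2 * j.val / 2 = j.val := by omega
    simp [vert, h1]
  have ho : ∀ j : Fin n, vert (2 * j.val + 1) = v j := fun j => by
    have h1 : (2 * j.val + 1) / 2 = j.val := by omega
    have h2 : (2 * j.val + 1) % 2 = 1 := by omega
    simp [vert, h1, h2]
  have fe : ∀ j : ℕ, flipEdge (2 * j) = 2 * j + 1 := fun j => by simp [flipEdge]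
  have fo : ∀ j : ℕ, flipEdge (2 * j + 1) = 2 * j := fun j => by
    unfold flipEdge; split_ifs <;> omega
  have hcases : ∀ i < 2 * n, ∃ j : Fin n, i = 2 * j.val ∨ i = 2 * j.val + 1 := by
    intro i hi
    exact ⟨⟨i / 2, by omega⟩, by simp only; omega⟩
  have hword : ∀ i, ∀ hi : i < 2 * n, x ⟨i, hi⟩ = ((vert i).val : Word p) := by
    intro i hi
    obtain ⟨j, rfl | rfl⟩ := hcases i hi
    · rw [he]; exact (hw j).1
    · rw [ho]; exact (hw j).2
  have hval : ∀ a : Fin n, ((a.val : ℕ) : Word p).val = a.val := fun a =>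
    ZMod.val_cast_of_lt (a.isLt.trans_le hp)
  have huv : ∀ j, G.Adj (u j) (v j) := by
    intro j
    rw [← SimpleGraph.mem_edgeSet, ← hrange]
    exact ⟨j, rfl⟩
  refine ⟨fun ι => ?_, vert, ?_, ?_, ?_, ?_, adj, ext, surj, two⟩
  · have := hword ι.val ι.isLt
    rw [Fin.eta] at this
    rw [this, hval]
    exact Fin.isLt _
  · intro i hi j hj
    rw [inputWord, inputWord, dif_pos hi, dif_pos hj, hword i hi, hword j hj]
    constructor
    · intro h
      have := congrArg ZMod.val h
      rw [hval, hval] at this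
      exact Fin.ext this
    · intro h; rw [h]
  · intro i hi
    obtain ⟨j, rfl | rfl⟩ := hcases i hi
    · rw [fe, he, ho]; exact (huv j).symm
    · rw [fo, he, ho]; exact huv j
  · intro i hi i' hi' h1 h2
    obtain ⟨j, rfl | rfl⟩ := hcases i hi <;> obtain ⟨j', rfl | rfl⟩ := hcases i' hi'
    · rw [fe, fe, ho, ho] at h2
      rw [he, he] at h1
      rw [hinj (show s(u j, v j) = s(u j', v j') by rw [h1, h2])]
    · rw [fe, fo, ho, he] at h2
      rw [he, ho] at h1
      have hjj := hinj (show s(u j, v j) = s(u j', v j') by rw [h1, h2]; exact Sym2.eq_swap)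
      subst hjj
      exact absurd h1 (huv j).ne
    · rw [fe, fo, ho, he] at h2
      rw [he, ho] at h1
      have hjj := hinj (show s(u j, v j) = s(u j', v j') by rw [h1, h2]; exact Sym2.eq_swap)
      subst hjj
      exact absurd h2 (huv j).ne
    · rw [fo, fo, he, he] at h2
      rw [ho, ho] at h1
      rw [hinj (show s(u j, v j) = s(u j', v j') by rw [h1, h2])]
  · intro a b hab
    have hmem : s(a, b) ∈ Set.range fun j => s(u j, v j) := by
      rw [hrange]; exact hab
    obtain ⟨j, hj⟩ := hmem
    simp only [Sym2.eq_iff] at hj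
    rcases hj with ⟨h1, h2⟩ | ⟨h1, h2⟩
    · exact ⟨2 * j.val, by omega, by rw [he, h1], by rw [fe, ho, h2]⟩
    · exact ⟨2 * j.val + 1, by omega, by rw [ho, h2], by rw [fo, he, h1]⟩

theorem cycleGraph_adj_iff {l : ℕ} [NeZero l] (hl : 3 ≤ l) (a b : Fin l) :
    (SimpleGraph.cycleGraph l).Adj a b ↔ b = a + 1 ∨ b = a - 1 := by
  obtain ⟨m, rfl⟩ : ∃ m, l = m + 2 := ⟨l - 2, by omega⟩
  rw [SimpleGraph.cycleGraph_adj]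
  constructor
  · rintro (h | h)
    · right; rw [← h]; abel
    · left; rw [← h]; abel
  · rintro (h | h)
    · right; rw [h]; abel
    · left; rw [h]; abel

theorem fin_nsmul_one_eq_zero_iff {l : ℕ} [NeZero l] (t : ℕ) : t • (1 : Fin l) = 0 ↔ l ∣ t := by
  have h : ∀ t : ℕ, (t • (1 : Fin l)).val = t % l := by
    intro t
    induction t with
    | zero => simp
    | succ t ih => rw [succ_nsmul, Fin.val_add, ih, Fin.val_one', ← Nat.add_mod]
  rw [Fin.ext_iff, h, Fin.val_zero, Nat.dvd_iff_mod_eq_zero]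

theorem fin_one_ne_neg_one {l : ℕ} [NeZero l] (hl : 3 ≤ l) : (1 : Fin l) ≠ -1 := by
  intro h
  have h2 : (2 : ℕ) • (1 : Fin l) = 0 := by
    rw [two_nsmul]
    nth_rewrite 1 [h]
    exact neg_add_cancel 1
  rw [fin_nsmul_one_eq_zero_iff] at h2
  exact absurd (Nat.le_of_dvd (by norm_num) h2) (by omega)

/-- Walking along half of the vertices leads back to the start in the case of two cycles, and only
then. -/
theorem SerializesGraph.walk {n p : ℕ} {G : SimpleGraph (Fin n)} {x : Fin (2 * n) → Word p}
    (hx : SerializesGraph G x) (hp : n ≤ 2 ^ p) (hn : 6 ≤ n)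
    (hG : Nonempty (G ≃g SimpleGraph.cycleGraph n) ∨
      Nonempty (G ≃g (SimpleGraph.cycleGraph (n / 2) ⊕g SimpleGraph.cycleGraph (n / 2)))) :
    (∀ ι, (x ι).val < n) ∧ (∀ i < 2 * n, nextHalfEdge x i < 2 * n) ∧
      Set.InjOn (nextHalfEdge x) (Set.Iio (2 * n)) ∧
      (Nonempty (G ≃g SimpleGraph.cycleGraph n) → (nextHalfEdge x)^[n / 2] 0 ≠ 0) ∧
      (Nonempty (G ≃g (SimpleGraph.cycleGraph (n / 2) ⊕g SimpleGraph.cycleGraph (n / 2))) →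
        (nextHalfEdge x)^[n / 2] 0 = 0) := by
  have : NeZero n := ⟨by omega⟩
  have : NeZero (n / 2) := ⟨by omega⟩
  have one : ∀ φ : G ≃g SimpleGraph.cycleGraph n, (∀ ι, (x ι).val < n) ∧
      ∃ vert, HalfEdges x G vert (fun _ => ()) φ (1 : Fin n) := by
    intro φ
    refine hx.halfEdges hp (fun a b => ?_) (fun a b _ h => φ.injective h)
      (fun a g => ⟨φ.symm g, rfl, φ.apply_symm_apply g⟩) (fin_one_ne_neg_one (by omega)) (by omega)
    rw [← φ.map_adj_iff, cycleGraph_adj_iff (by omega)]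
    simp
  -- Here `side` names the cycle and `pos` the place on it. From `6 ≤ n` each cycle has length at
  -- least `3`, so its two directions differ.
  have two : ∀ φ : G ≃g (SimpleGraph.cycleGraph (n / 2) ⊕g SimpleGraph.cycleGraph (n / 2)),
      (∀ ι, (x ι).val < n) ∧ ∃ vert, HalfEdges x G vert (fun a => (φ a).isLeft)
        (fun a => (φ a).elim id id) (1 : Fin (n / 2)) := by
    intro φ
    refine hx.halfEdges hp (fun a b => ?_) (fun a b h h' => φ.injective ?_) (fun a g => ?_)
      (fin_one_ne_neg_one (by omega)) (by omega)
    · rw [← φ.map_adj_iff]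
      rcases φ a with c | c <;> rcases φ b with d | d <;>
        simp [cycleGraph_adj_iff (show 3 ≤ n / 2 by omega)]
    · revert h h'
      rcases φ a with c | c <;> rcases φ b with d | d <;> simp
    · rcases h : φ a with c | c
      · exact ⟨φ.symm (Sum.inl g), by simp, by simp⟩
      · exact ⟨φ.symm (Sum.inr g), by simp, by simp⟩
  refine ⟨?_, ?_, ?_, ?_, ?_⟩
  · rcases hG with ⟨⟨φ⟩⟩ | ⟨⟨φ⟩⟩
    · exact (one φ).1
    · exact (two φ).1
  · rcases hG with ⟨⟨φ⟩⟩ | ⟨⟨φ⟩⟩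
    · exact (one φ).2.choose_spec.next_lt
    · exact (two φ).2.choose_spec.next_lt
  · rcases hG with ⟨⟨φ⟩⟩ | ⟨⟨φ⟩⟩
    · exact (one φ).2.choose_spec.next_injOn
    · exact (two φ).2.choose_spec.next_injOn
  · rintro ⟨φ⟩
    rw [Ne, (one φ).2.choose_spec.iterate_eq_iff (by omega), fin_nsmul_one_eq_zero_iff]
    intro h
    exact absurd (Nat.le_of_dvd (by omega) h) (by omega)
  · rintro ⟨φ⟩
    rw [(two φ).2.choose_spec.iterate_eq_iff (by omega), fin_nsmul_one_eq_zero_iff]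

/-! ### The protocol for distinguishing cycles -/

/-- The cell with number `i` in the first block and zeros elsewhere. -/
def blockPlace {κ F : ℕ} (hF : 0 < F) (i : ℕ) (hi : i < F ^ κ) : BlockCoord κ → Fin F
  | none => ⟨0, hF⟩
  | some (b, a) => finFunctionFinEquiv.symm ⟨if b = 0 then i else 0, by split_ifs <;> omega⟩ a

theorem blockIndex_blockPlace {κ F : ℕ} (hF : 0 < F) (i : ℕ) (hi : i < F ^ κ) (b : Fin 5) :
    blockIndex (blockPlace hF i hi) b = if b = 0 then i else 0 := by
  unfold blockIndex
  have : (fun a => blockPlace hF i hi (some (b, a))) = finFunctionFinEquiv.symm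
      ⟨if b = 0 then i else 0, by split_ifs <;> omega⟩ := rfl
  rw [this, Equiv.apply_symm_apply]

theorem eq_of_blockIndex_eq {κ F : ℕ} {y y' : BlockCoord κ → Fin F}
    (h : ∀ b, blockIndex y b = blockIndex y' b) (h' : y none = y' none) : y = y' := by
  funext d
  match d with
  | none => exact h'
  | some (b, a) => exact congrFun (finFunctionFinEquiv.injective (Fin.ext (h b))) a

theorem blockPlace_injective {κ F nin : ℕ} (hF : 0 < F) (hnin : nin ≤ F ^ κ) :
    Function.Injective fun ι : Fin nin =>
      blockPlace (κ := κ) hF ι.val (ι.isLt.trans_le hnin) := by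
  intro ι ι' h
  have := congrFun (congrArg blockIndex h) 0
  simp only [blockIndex_blockPlace, if_true] at this
  exact Fin.ext this

/-- An input word as a residue modulo `M`, zero outside of the input. -/
noncomputable def wordResidue {n p : ℕ} (M : ℕ) (x : Fin (2 * n) → Word p) (i : ℕ) : ZMod M :=
  if i < 2 * n then ((inputWord x i).val : ZMod M) else 0

theorem gridInit_blockPlace {n p κ F M : ℕ} (hF : 0 < F) (hn : 2 * n ≤ F ^ κ)
    (x : Fin (2 * n) → Word p) :
    gridInit (fun ι : Fin (2 * n) => blockPlace (κ := κ) hF ι.val (ι.isLt.trans_le hn))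
      (fun w => ((0 : ZMod M), (w.val : ZMod M))) (0, 0) x =
    liftState fun i c => (0, if i 1 = 0 ∧ i 2 = 0 ∧ i 3 = 0 ∧ i 4 = 0 ∧ c.val = 0 then
      wordResidue M x (i 0) else 0) := by
  funext y
  by_cases h : ∃ ι : Fin (2 * n), blockPlace (κ := κ) hF ι.val (ι.isLt.trans_le hn) = y
  · obtain ⟨ι, rfl⟩ := h
    rw [gridInit_place (blockPlace_injective hF hn) _ _ x ι]
    simp only [liftState, blockIndex_blockPlace]
    simp [blockPlace, wordResidue, inputWord, ι.isLt]
  · rw [gridInit_of_forall_ne _ _ _ fun ι hι => h ⟨ι, hι⟩]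
    simp only [liftState, Prod.mk.injEq, true_and]
    symm
    split_ifs with h1
    · rw [wordResidue, if_neg]
      intro hlt
      refine h ⟨⟨_, hlt⟩, eq_of_blockIndex_eq (fun b => ?_) (Fin.ext h1.2.2.2.2.symm)⟩
      rw [blockIndex_blockPlace]
      obtain ⟨h1, h2, h3, h4, -⟩ := h1
      fin_cases b
      · rfl
      · exact h1.symm
      · exact h2.symm
      · exact h3.symm
      · exact h4.symm
    · rfl

/-- A token depends on a single value of `f`, so a cell needs to fetch only that one. -/
theorem seqToken_congr (S R k : ℕ) (f : ℕ → ℕ) (P : ℕ) :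
    seqToken S R k f P = seqToken S R k (fun _ => f (P % (2 * S) / 2)) P := by
  unfold seqToken blockMap
  rfl

/-- Cells outside the loaded ones read at index zero of the extra coordinate and of blocks 1 to 4,
so that afterwards every cell knows the word selected by its block 0. -/
theorem computes_spread {X : Type} {n p κ F M : ℕ} (hF : 0 < F)
    (inp : X → Fin (2 * n) → Word p) :
    Computes (1 + κ + κ + κ + κ)
      (fun x => liftState (κ := κ) (F := F) fun i c => ((0 : ZMod M),
        if i 1 = 0 ∧ i 2 = 0 ∧ i 3 = 0 ∧ i 4 = 0 ∧ c.val = 0 then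
          wordResidue M (inp x) (i 0) else 0))
      (fun x => liftState fun i _ => (0, wordResidue M (inp x) (i 0))) := by
  have hB : 0 < F ^ κ := by positivity
  have h1 := computes_line (κ := κ) (F := F) (fun x i c => ((0 : ZMod M),
        if i 1 = 0 ∧ i 2 = 0 ∧ i 3 = 0 ∧ i 4 = 0 ∧ c.val = 0 then
          wordResidue M (inp x) (i 0) else 0)) fun _ _ u => ((0 : ZMod M), (u ⟨0, hF⟩).2)
  have h2 := h1.trans (computes_lookup _ 1 (fun _ => 0) (fun _ _ => rfl) fun _ _ => hB)
  have h3 := h2.trans (computes_lookup _ 2 (fun _ => 0) (fun _ _ => rfl) fun _ _ => hB)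
  have h4 := h3.trans (computes_lookup _ 3 (fun _ => 0) (fun _ _ => rfl) fun _ _ => hB)
  have h5 := h4.trans (computes_lookup _ 4 (fun _ => 0) (fun _ _ => rfl) fun _ _ => hB)
  refine h5.congr fun x y => ?_
  simp [liftState]

/-- All pairs of half-edges are compared in parallel. Labels below `M` make equality of residues the
same as equality of words. -/
theorem computes_next {X : Type} {n p κ F M : ℕ} [NeZero M] (hn : 2 * n ≤ F ^ κ)
    (inp : X → Fin (2 * n) → Word p) (hval : ∀ x ι, (inp x ι).val < M) :
    Computes (1 + κ + 1 + κ)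
      (fun x => liftState (κ := κ) (F := F) fun i _ => ((0 : ZMod M), wordResidue M (inp x) (i 0)))
      (fun x => liftState fun i _ =>
        (wordResidue M (inp x) (i 0), (nextHalfEdge (inp x) (i 0) : ZMod M))) := by
  have h1 := computes_line (κ := κ) (F := F)
    (fun x i _ => ((0 : ZMod M), wordResidue M (inp x) (i 0))) fun _ c u => ((u c).2, (u c).2)
  have h2 := h1.trans (computes_lookup _ 0 (fun i => i 1) (by simp) fun i hi => hi 1)
  have h3 := h2.trans (computes_line _ fun i c u => ((u c).1,
    if i 0 < 2 * n ∧ i 1 < 2 * n ∧ i 0 ≠ i 1 ∧ (u c).1 = (u c).2 then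
      (flipEdge (i 1) : ZMod M) else 0))
  have h4 := h3.trans (computes_sum _ 1)
  refine h4.congr fun x y => ?_
  simp only [liftState, Function.update_self, ne_eq, Function.update_of_ne,
    show (0 : Fin 5) ≠ 1 by decide, not_false_eq_true, Prod.mk.injEq, true_and]
  generalize blockIndex y 0 = i
  rw [nextHalfEdge]
  push_cast
  rw [← Finset.sum_subset (Finset.range_subset_range.2 hn) fun j _ hj => by
    rw [Finset.mem_range] at hj; rw [if_neg fun h => hj h.2.1]]
  refine Finset.sum_congr rfl fun j hj => ?_
  have hj' := Finset.mem_range.1 hj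
  have hiff : i < 2 * n → (wordResidue M (inp x) i = wordResidue M (inp x) j ↔
      inputWord (inp x) i = inputWord (inp x) j) := by
    intro hi
    have hv : ∀ i < 2 * n, (inputWord (inp x) i).val < M := by
      intro i hi
      rw [inputWord, dif_pos hi]
      exact hval x _
    rw [wordResidue, wordResidue, if_pos hi, if_pos hj']
    constructor
    · intro h
      have := congrArg ZMod.val h
      rw [ZMod.val_cast_of_lt (hv i hi), ZMod.val_cast_of_lt (hv j hj')] at this
      exact ZMod.val_injective _ this
    · intro h; rw [h]
  by_cases hi : i < 2 * n
  · simp only [hi, hj', true_and, hiff hi]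
  · simp only [hi, false_and, if_false]

/-- The sequence of tokens for an input of the protocol. -/
def inputTokens {n p : ℕ} (N R k : ℕ) {σ : ℕ} (hσ : 0 < σ) (x : Fin (2 * n) → Word p)
    (P : Fin N) : Fin σ :=
  ⟨seqToken (2 * n) R k (nextHalfEdge x) P.val % σ, Nat.mod_lt _ hσ⟩

theorem CausalTransformer.cell_zero {N m L H : ℕ} (T : CausalTransformer N m L H) (ρ : ℝ → ℝ)
    {σ : ℕ} (code : Option (Fin σ) → ℝ) (p F M n : ℕ) (tok : Fin N → Fin σ) (i : ℕ) (c : Fin F) :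
    T.cell ρ code p F M n tok 0 i c = if hi : i < N ∧ i < n then
      if c.val < m then 0 else ((tok ⟨i, hi.1⟩).val : ZMod M) else 0 := by
  unfold CausalTransformer.cell
  congr 1
  ext hi
  split_ifs
  · simp [CausalTransformer.increment]
  · rfl

/-- The address of the needed value depends on block 0, so it cannot be used to overwrite block 0.
The value is first re-indexed by block 1, and then block 1 is overwritten with that address. -/
theorem computes_tokens {X : Type} {N m L H : ℕ} (T : CausalTransformer N m L H) (ρ : ℝ → ℝ)
    {σ : ℕ} (hσ : 0 < σ) (code : Option (Fin σ) → ℝ) (p : ℕ) {n pw κ F M : ℕ} [NeZero M] (n' R k : ℕ)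
    (inp : X → Fin (2 * n) → Word pw) (hn : 0 < n) (hnM : 2 * n ≤ M)
    (hnext : ∀ x, ∀ i < 2 * n, nextHalfEdge (inp x) i < 2 * n) :
    Computes (κ + κ + 1)
      (fun x => liftState (κ := κ) (F := F) fun i _ =>
        (wordResidue M (inp x) (i 0), (nextHalfEdge (inp x) (i 0) : ZMod M)))
      (fun x => liftState fun i c =>
        (T.cell ρ code p F M n' (inputTokens N R k hσ (inp x)) 0 (i 0) c, 0)) := by
  have h1 := computes_lookup (κ := κ) (F := F) (fun x i _ =>
        (wordResidue M (inp x) (i 0), (nextHalfEdge (inp x) (i 0) : ZMod M)))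
        0 (fun i => i 1) (by simp) fun i hi => hi 1
  have h2 := h1.trans (computes_lookup _ 1 (fun i => i 0 % (2 * (2 * n)) / 2) (by simp) fun i hi =>
    lt_of_le_of_lt ((Nat.div_le_self _ _).trans (Nat.mod_le _ _)) (hi 0))
  have h3 := h2.trans (computes_line _ fun i c u =>
    (if i 0 < N ∧ i 0 < n' then if c.val < m then 0 else
      ((seqToken (2 * n) R k (fun _ => (u c).2.val) (i 0) % σ : ℕ) : ZMod M) else 0, (0 : ZMod M)))
  refine h3.congr fun x y => ?_
  simp only [liftState, Function.update_self]
  generalize blockIndex y 0 = i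
  rw [CausalTransformer.cell_zero]
  have hlt : i % (2 * (2 * n)) / 2 < 2 * n := by
    have := Nat.mod_lt i (show 0 < 2 * (2 * n) by omega)
    omega
  rw [ZMod.val_cast_of_lt ((hnext x _ hlt).trans_le hnM), ← seqToken_congr]
  simp only [inputTokens]
  split_ifs <;> rfl

/-- A transformer that computes `hop_k` yields a protocol that distinguishes one cycle from two
cycles, with a constant number of rounds for each layer. -/
theorem exists_cycle_protocol {N m L H p k σ : ℕ} {ρ : ℝ → ℝ} (hρ : IsRounding p ρ)
    {code : Option (Fin σ) → ℝ} (hcode : Function.Injective code)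
    {T : CausalTransformer N m L H} (hT : T.HasPrecision p) (hhop : T.ComputesHop ρ k code)
    {n F κ M q pw : ℕ} (hn : 6 ≤ n) (hk : n / 2 ≤ k) (hN : 2 * (2 * n) * k < N)
    (hσ : 2 * (2 * n) ≤ σ) (hm : m < F) (hnB : 2 * (2 * n) * k + 1 ≤ F ^ κ) (hHB : H ≤ F ^ κ)
    (hpB : 2 * 4 ^ p ≤ F ^ κ) (hRB : attentionBits m (2 * (2 * n) * k + 1) p < F ^ κ)
    (hq : F ^ (5 * κ + 1) ≤ q) (hLM : 2 * (L * H * 4 ^ p) < M)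
    (hnM : 4 * (2 * (2 * n) * k + 1) < M) (hRM : 3 * attentionBits m (2 * (2 * n) * k + 1) p + 3 < M)
    (hM : M * M ≤ 2 ^ pw) :
    ∃ π : MPCProtocol q pw, π.rounds = L * (5 * κ + 6) + 8 * κ + 7 ∧ π.RespectsMemory (2 * n) F ∧
      π.DistinguishesCycles F n := by
  classical
  have hF : 0 < F := by omega
  have : NeZero M := ⟨by omega⟩
  have hM1 : Fact (1 < M) := ⟨by omega⟩
  have hσ0 : 0 < σ := by omega
  have hnk : 2 * (2 * n) ≤ 2 * (2 * n) * k := Nat.le_mul_of_pos_right _ (by omega)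
  have hnB' : 2 * n ≤ F ^ κ := by omega
  have hpw : n ≤ 2 ^ pw := by
    have : M ≤ M * M := Nat.le_mul_of_pos_left _ (by omega)
    omega
  have hpw1 : Fact (1 < 2 ^ pw) := ⟨by omega⟩
  obtain ⟨A⟩ := hρ.nonempty_attentionWeights m (2 * (2 * n) * k + 1)
  -- Correctness is needed only on inputs with these properties, which both kinds of graph provide;
  -- the memory bounds hold for all inputs.
  let X : Type := {x : Fin (2 * n) → Word pw // (∀ ι, (x ι).val < n) ∧
    (∀ i < 2 * n, nextHalfEdge x i < 2 * n) ∧ Set.InjOn (nextHalfEdge x) (Set.Iio (2 * n))}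
  let inp : X → Fin (2 * n) → Word pw := fun x => x.1
  let tok : X → Fin N → Fin σ := fun x => inputTokens N (n / 2) k hσ0 (inp x)
  have htok : ∀ x, ∀ i : Fin N, (tok x i).val = seqToken (2 * n) (n / 2) k (nextHalfEdge (inp x)) i := by
    intro x i
    exact Nat.mod_eq_of_lt ((seqToken_lt (by omega) x.2.2.1 _).trans_le hσ)
  have htokM : ∀ x, ∀ i : Fin N, (tok x i).val < M := by
    intro x i
    rw [htok]
    have := seqToken_lt (R := n / 2) (k := k) (f := nextHalfEdge (inp x)) (by omega) x.2.2.1 i.val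
    omega
  -- The token `2 * 0 + 1`: the walk has returned to half-edge `0`.
  let target : ℝ := code (some ⟨1, by omega⟩)
  have h1 := (((computes_spread (κ := κ) (M := M) hF inp).trans
    (computes_next hnB' inp fun x ι => (x.2.1 ι).trans (by omega))).trans
    (computes_tokens T ρ hσ0 code p (2 * (2 * n) * k + 1) (n / 2) k inp (by omega) (by omega)
      fun x => x.2.2.1)).trans
    (computes_layers (code := code) hT A hm tok (fun x i _ => htokM x i) hLM hnM hRM hnB hHB hpB hRB)
  -- A line holds a whole row, so the output map is applied locally; only the verdict at the last
  -- position of the sequence is used.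
  have h2 := h1.trans (computes_line _ fun i c u => ((u c).1,
    if T.output ⟨2 * (2 * n) * k, hN⟩ (rowEmbedding code p hm fun c => (u c).1) = target then
      (1 : ZMod M) else 0))
  obtain ⟨S, hS⟩ := h2
  obtain ⟨e⟩ : Nonempty ((BlockCoord κ → Fin F) ↪ Fin q) := by
    apply Function.Embedding.nonempty_of_card_le
    simpa [mul_comm] using hq
  obtain ⟨enc⟩ : Nonempty (ZMod M × ZMod M ↪ Word pw) := by
    apply Function.Embedding.nonempty_of_card_le
    rw [Fintype.card_prod, ZMod.card, ZMod.card]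
    exact hM
  have hinv : ∀ w, Function.invFun enc (enc w) = w := Function.leftInverse_invFun enc.injective
  have hFB : F ^ κ ≤ q := (Nat.pow_le_pow_right hF (by omega)).trans hq
  let out : ZMod M × ZMod M → Word pw := fun w => if w.2 = 1 then 1 else 0
  set r := 1 + κ + κ + κ + κ + (1 + κ + 1 + κ) + (κ + κ + 1) + L * (5 * κ + 6) + 1 with hr
  let π : MPCProtocol q pw := gridProtocol S r e enc (Function.invFun enc)
    (fun ι : Fin (2 * n) => blockPlace (κ := κ) hF ι.val (ι.isLt.trans_le hnB'))
    (fun w => ((0 : ZMod M), (w.val : ZMod M))) (0, 0)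
    (blockPlace hF (2 * (2 * n) * k) (by omega)) out
  have hout : ∀ x : X, π.Outputs F (inp x)
      (if (nextHalfEdge (inp x))^[n / 2] 0 = 0 then 1 else 0) := by
    intro x
    have h := gridProtocol_outputs S r e enc (Function.invFun enc)
      (fun ι : Fin (2 * n) => blockPlace (κ := κ) hF ι.val (ι.isLt.trans_le hnB'))
      (fun w => ((0 : ZMod M), (w.val : ZMod M))) (0, 0)
      (blockPlace hF (2 * (2 * n) * k) (by omega)) out e.injective
      (blockPlace_injective hF hnB') hinv hF (hnB'.trans hFB) (inp x)
    rw [gridInit_blockPlace hF hnB', hS x] at h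
    convert h using 1
    simp only [liftState, blockIndex_blockPlace, if_true, out]
    have hrow := rowEmbedding_cell (code := code) hT A hm (tok x) (fun i _ => htokM x i) hLM le_rfl
      ⟨2 * (2 * n) * k, hN⟩ (Nat.lt_succ_self _)
    dsimp only at hrow
    have heval := hhop (tok x) ⟨2 * (2 * n) * k, hN⟩
    have hsym : Set.InjOn (fun i => if h : i < σ then (⟨i, h⟩ : Fin σ) else ⟨0, hσ0⟩)
        (Set.Iio (2 * (2 * n))) := by
      intro i hi j hj hij
      simp only [Set.mem_Iio] at hi hj
      simpa [hi.trans_le hσ, hj.trans_le hσ] using hij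
    have hhopv := hop_seqToken (X := tok x) (k := k) (f := nextHalfEdge (inp x)) hsym x.2.2.1 x.2.2.2 (fun P _ => by
      rw [dif_pos ((seqToken_lt (by omega) x.2.2.1 _).trans_le hσ)]
      exact Fin.ext (htok x P)) (by omega) hk (by omega) ⟨2 * (2 * n) * k, hN⟩ rfl
    have hf : (nextHalfEdge (inp x))^[n / 2] 0 < 2 * n := by
      rw [← hopState_add (k := k) _ hk le_rfl]
      exact hopState_lt (by omega) x.2.2.1 _
    have hcond : T.output ⟨2 * (2 * n) * k, hN⟩ (rowEmbedding code p hm fun c =>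
        T.cell ρ code p F M (2 * (2 * n) * k + 1) (tok x) L (2 * (2 * n) * k) c) = target ↔
        (nextHalfEdge (inp x))^[n / 2] 0 = 0 := by
      change T.output ⟨2 * (2 * n) * k, hN⟩ (rowEmbedding code p hm
        (T.cell ρ code p F M (2 * (2 * n) * k + 1) (tok x) L (2 * (2 * n) * k))) = target ↔ _
      rw [hrow]
      change T.eval ρ (fun j => code (some (tok x j))) ⟨2 * (2 * n) * k, hN⟩ = target ↔ _
      rw [heval, hhopv, hcode.eq_iff, Option.some.injEq, dif_pos (by omega), Fin.mk.injEq]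
      omega
    by_cases h0 : (nextHalfEdge (inp x))^[n / 2] 0 = 0
    · rw [if_pos h0, if_pos (hcond.2 h0), if_pos rfl]
    · rw [if_neg h0, if_neg fun h => h0 (hcond.1 h), if_neg zero_ne_one]
  refine ⟨π, ?_, ?_, 0, 1, zero_ne_one, fun G x hx => ⟨fun hG => ?_, fun hG => ?_⟩⟩
  · change r + 2 = _
    rw [hr]; ring
  · exact gridProtocol_respectsMemory _ _ _ _ _ _ _ _ _ _ e.injective
      (blockPlace_injective hF hnB') hF le_rfl (hnB'.trans hFB)
  · obtain ⟨w1, w2, w3, w4, -⟩ := hx.walk hpw hn (Or.inl hG)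
    have := hout ⟨x, w1, w2, w3⟩
    rwa [if_neg (w4 hG)] at this
  · obtain ⟨w1, w2, w3, -, w5⟩ := hx.walk hpw hn (Or.inr hG)
    have := hout ⟨x, w1, w2, w3⟩
    rwa [if_pos (w5 hG)] at this

/-! ### Transformers without attention -/

/-- With `m = 0` the embedding is empty, and with `H = 0` the layers change nothing, so positions
never communicate. -/
theorem CausalTransformer.embedding_eq_of_eq {N m L H : ℕ} (T : CausalTransformer N m L H)
    (ρ : ℝ → ℝ) (hmH : m * H = 0) {X X' : Fin N → ℝ} {i : Fin N} (h : X i = X' i) (l : ℕ) :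
    T.embedding ρ X l i = T.embedding ρ X' l i := by
  rcases Nat.mul_eq_zero.1 hmH with rfl | rfl
  · exact Subsingleton.elim _ _
  · induction l with
    | zero => simp [CausalTransformer.embedding, h]
    | succ l ih => simp [CausalTransformer.embedding, ih]

theorem findHop_eq_some_self {N : ℕ} {A : Type*} {X : Fin N → A} {i : Fin N}
    (h : findOne X i = some i) (k : ℕ) : findHop X k i = some i := by
  induction k with
  | zero => rfl
  | succ k ih => rw [findHop, ih, Option.bind_some, h]

theorem findHop_succ_eq_none {N : ℕ} {A : Type*} {X : Fin N → A} {i : Fin N}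
    (h : findOne X i = none) (k : ℕ) : findHop X (k + 1) i = none := by
  induction k with
  | zero => simp [findHop, h]
  | succ k ih => rw [findHop, ih]; rfl

/-- At position `1`, whether the first token equals the second decides between a token and `⊥`, so
attention is needed. Excluding zero lets a bound on `m * H` bound each factor. -/
theorem CausalTransformer.ComputesHop.mul_ne_zero {N m L H k σ : ℕ} {T : CausalTransformer N m L H}
    {ρ : ℝ → ℝ} {code : Option (Fin σ) → ℝ} (hcode : Function.Injective code)
    (hT : T.ComputesHop ρ k code) (hN : 2 ≤ N) (hσ : 2 ≤ σ) (hk : 1 ≤ k) : m * H ≠ 0 := by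
  intro hmH
  let i₀ : Fin N := ⟨0, by omega⟩
  let i₁ : Fin N := ⟨1, by omega⟩
  let s₀ : Fin σ := ⟨0, by omega⟩
  let s₁ : Fin σ := ⟨1, by omega⟩
  let X : Fin N → Fin σ := fun _ => s₀
  let X' : Fin N → Fin σ := fun i => if i = i₀ then s₁ else s₀
  have hne : i₁ ≠ i₀ := by simp [i₀, i₁]
  have h1 : hop k X i₁ = some s₀ := by
    have : findHop X k i₁ = some i₁ := findHop_eq_some_self
      (findOne_eq_some (X := X) (i := i₁) (j := i₁) (j' := i₀) rfl le_rfl rfl fun l h1 h2 => absurd h2 h1.not_gt) k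
    rw [hop, this]; rfl
  have h2 : hop k X' i₁ = none := by
    have hfind : findOne X' i₁ = none := by
      classical
      unfold findOne
      simp only
      rw [dif_neg]
      rintro ⟨j, hj⟩
      simp only [Finset.mem_filter, Finset.mem_univ, true_and] at hj
      obtain ⟨h1, j', h2, h3⟩ := hj
      have : j' = i₀ := Fin.ext (by rw [Fin.le_def] at h1; simp only [i₁] at h1; simp only [i₀]; omega)
      subst this
      simp [X', hne, s₀, s₁] at h3
    have : findHop X' k i₁ = none := by
      obtain ⟨k, rfl⟩ : ∃ k', k = k' + 1 := ⟨k - 1, by omega⟩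
      exact findHop_succ_eq_none hfind k
    rw [hop, this]; rfl
  have e1 := hT X i₁
  have e2 := hT X' i₁
  rw [h1] at e1
  rw [h2] at e2
  have : code (some (X i₁)) = code (some (X' i₁)) := by simp [X, X', hne]
  rw [CausalTransformer.eval, T.embedding_eq_of_eq ρ hmH (X := fun j => code (some (X j)))
    (X' := fun j => code (some (X' j))) this] at e1
  have := hcode (e1.symm.trans e2)
  simp at this

/-! ### The choice of the parameters -/

theorem le_mul_pow {n x e : ℕ} (hn : 6 ≤ n) (c : ℕ) (hc : c ≤ 6) (hx : x ≤ c * n ^ e) :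
    x ≤ n ^ (e + 1) := by
  refine hx.trans ?_
  rw [pow_succ, mul_comm]
  exact Nat.mul_le_mul_left _ (hc.trans hn)

theorem attentionBits_le {m P p n e₁ e₂ : ℕ} (hn : 6 ≤ n) (hm : m ≤ n ^ 2) (hP : P ≤ n ^ e₁)
    (hp : 2 ^ p ≤ n ^ e₂) : attentionBits m P p ≤ n ^ (e₁ + 12 * e₂ + 10) := by
  have pos : ∀ e, 1 ≤ n ^ e := fun e => Nat.one_le_iff_ne_zero.2 (by positivity)
  have h4 : 4 ^ p ≤ n ^ (2 * e₂) := by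
    calc 4 ^ p = (2 ^ p) ^ 2 := by rw [← pow_mul, mul_comm, pow_mul]; norm_num
      _ ≤ (n ^ e₂) ^ 2 := Nat.pow_le_pow_left hp 2
      _ = n ^ (2 * e₂) := by rw [← pow_mul, mul_comm]
  have h16 : 16 ^ p ≤ n ^ (4 * e₂) := by
    calc 16 ^ p = (2 ^ p) ^ 4 := by rw [← pow_mul, mul_comm, pow_mul]; norm_num
      _ ≤ (n ^ e₂) ^ 4 := Nat.pow_le_pow_left hp 4
      _ = n ^ (4 * e₂) := by rw [← pow_mul, mul_comm]
  have a1 : 2 * (m * 16 ^ p) + 1 ≤ n ^ (2 + 4 * e₂ + 1) := by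
    refine le_mul_pow hn 3 (by norm_num) ?_
    have := Nat.mul_le_mul hm h16
    rw [← pow_add] at this
    have := pos (2 + 4 * e₂)
    omega
  have a2 : 2 * 4 ^ p + 1 ≤ n ^ (2 * e₂ + 1) := by
    refine le_mul_pow hn 3 (by norm_num) ?_
    have := pos (2 * e₂)
    omega
  have a3 := Nat.mul_le_mul a1 a2
  rw [← pow_add] at a3
  have a4 : (2 * (m * 16 ^ p) + 1) * (2 * 4 ^ p + 1) + 2 ≤
      n ^ (2 + 4 * e₂ + 1 + (2 * e₂ + 1) + 1) := by
    refine le_mul_pow hn 3 (by norm_num) ?_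
    have := pos (2 + 4 * e₂ + 1 + (2 * e₂ + 1))
    omega
  have a5 : P + 2 ≤ n ^ (e₁ + 1) := by
    refine le_mul_pow hn 3 (by norm_num) ?_
    have := pos e₁
    omega
  refine (Nat.mul_le_mul a5 (Nat.mul_le_mul a4 a3)).trans (le_of_eq ?_)
  rw [← pow_add, ← pow_add]
  congr 1
  ring

/-- The protocol for a transformer whose parameters are polynomial in the number `n` of vertices. -/
theorem exists_cycle_protocol_of_le_pow {N m L H p k σ : ℕ} {ρ : ℝ → ℝ} (hρ : IsRounding p ρ)
    {code : Option (Fin σ) → ℝ} (hcode : Function.Injective code)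
    {T : CausalTransformer N m L H} (hT : T.HasPrecision p) (hhop : T.ComputesHop ρ k code)
    {n F q e₁ e₂ G : ℕ} (hG : G = e₁ + 12 * e₂ + 12) (hn : 6 ≤ n) (hk : n / 2 ≤ k)
    (hN : 2 * (2 * n) * k < N) (hσ : 2 * (2 * n) ≤ σ) (hm : m < F) (hF : n ≤ F ^ 2)
    (hNn : N ≤ n ^ e₁) (hp : 2 ^ p ≤ n ^ e₂) (hmn : m ≤ n ^ 2) (hHn : H ≤ n ^ 2) (hLn : L ≤ n ^ 2)
    (hq : F ^ (5 * (2 * G) + 1) ≤ q) :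
    ∃ π : MPCProtocol q (2 * G * (Nat.log 2 n + 1)),
      π.rounds = L * (5 * (2 * G) + 6) + 8 * (2 * G) + 7 ∧
      π.RespectsMemory (2 * n) F ∧ π.DistinguishesCycles F n := by
  have hFG : n ^ G ≤ F ^ (2 * G) := by
    rw [pow_mul]
    exact Nat.pow_le_pow_left hF G
  have hmono : ∀ e, e ≤ G → n ^ e ≤ n ^ G := fun e he => Nat.pow_le_pow_right (by omega) he
  have hlt : ∀ e, e < G → n ^ e < n ^ G := fun e he => Nat.pow_lt_pow_right (by omega) he
  have pos : ∀ e, 1 ≤ n ^ e := fun e => Nat.one_le_iff_ne_zero.2 (by positivity)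
  have h4 : 4 ^ p ≤ n ^ (2 * e₂) := by
    calc 4 ^ p = (2 ^ p) ^ 2 := by rw [← pow_mul, mul_comm, pow_mul]; norm_num
      _ ≤ (n ^ e₂) ^ 2 := Nat.pow_le_pow_left hp 2
      _ = n ^ (2 * e₂) := by rw [← pow_mul, mul_comm]
  have hbits := attentionBits_le hn hmn (show 2 * (2 * n) * k + 1 ≤ n ^ e₁ by omega) hp
  refine exists_cycle_protocol (M := n ^ G) hρ hcode hT hhop hn hk hN hσ hm ?_ ?_ ?_ ?_ hq ?_ ?_ ?_ ?_
  · exact ((Nat.succ_le_of_lt hN).trans hNn).trans ((hmono _ (by omega)).trans hFG)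
  · exact hHn.trans ((hmono _ (by omega)).trans hFG)
  · refine (le_mul_pow hn 2 (by norm_num) (Nat.mul_le_mul_left 2 h4)).trans
      ((hmono _ (by omega)).trans hFG)
  · exact (hbits.trans_lt (hlt _ (by omega))).trans_le hFG
  · have h1 := Nat.mul_le_mul (Nat.mul_le_mul hLn hHn) h4
    rw [← pow_add, ← pow_add] at h1
    exact (le_mul_pow hn 2 (by norm_num) (Nat.mul_le_mul_left 2 h1)).trans_lt (hlt _ (by omega))
  · have h1 : 2 * (2 * n) * k + 1 ≤ n ^ e₁ := by omega
    exact (le_mul_pow hn 4 (by norm_num) (Nat.mul_le_mul_left 4 h1)).trans_lt (hlt _ (by omega))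
  · refine (le_mul_pow (e := e₁ + 12 * e₂ + 10) hn 6 (by norm_num) ?_).trans_lt (hlt _ (by omega))
    have := pos (e₁ + 12 * e₂ + 10)
    omega
  · calc n ^ G * n ^ G = n ^ (2 * G) := by rw [← pow_add]; congr 1; ring
      _ ≤ (2 ^ (Nat.log 2 n + 1)) ^ (2 * G) :=
        Nat.pow_le_pow_left (Nat.lt_pow_succ_log_self (by norm_num) n).le _
      _ = _ := by rw [← pow_mul, mul_comm]

theorem log_bounds {n : ℕ} (hn : 2 ≤ n) :
    Real.log ((2 * n : ℕ) : ℝ) ≤ 2 * ((Nat.log 2 n + 1 : ℕ) : ℝ) ∧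
      ((Nat.log 2 n + 1 : ℕ) : ℝ) ≤ 2 * Real.log ((2 * n : ℕ) : ℝ) := by
  have hn' : (0 : ℝ) < n := by positivity
  have h2 := Real.log_two_gt_d9
  have h2' := Real.log_two_lt_d9
  have hmul : Real.log ((2 * n : ℕ) : ℝ) = Real.log 2 + Real.log n := by
    push_cast
    exact Real.log_mul (by norm_num) hn'.ne'
  have hlow : Real.log n ≤ (Nat.log 2 n + 1 : ℕ) * Real.log 2 := by
    rw [← Real.log_pow]
    apply Real.log_le_log hn'
    exact_mod_cast (Nat.lt_pow_succ_log_self (by norm_num) n).le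
  have hup : (Nat.log 2 n : ℝ) * Real.log 2 ≤ Real.log n := by
    rw [← Real.log_pow]
    apply Real.log_le_log (by positivity)
    exact_mod_cast Nat.pow_log_le_self 2 (by omega)
  rw [hmul]
  push_cast at *
  have h0 : (0 : ℝ) ≤ Nat.log 2 n := by positivity
  constructor <;> nlinarith

/-- With `n ≤ F ^ 2`, blocks of `2 * G` coordinates can index `n ^ G` objects. -/
theorem floor_rpow_sq {n : ℕ} {δ : ℝ} (hn : 1 ≤ n) (hδ : 1 / 2 ≤ δ) :
    n ≤ ⌊((2 * n : ℕ) : ℝ) ^ δ⌋₊ ^ 2 := by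
  set F := ⌊((2 * n : ℕ) : ℝ) ^ δ⌋₊ with hF
  have h1 : (1 : ℝ) ≤ ((2 * n : ℕ) : ℝ) := by exact_mod_cast (by omega : 1 ≤ 2 * n)
  have h2 : ((2 * n : ℕ) : ℝ) ^ (1 / 2 : ℝ) < F + 1 :=
    (Real.rpow_le_rpow_of_exponent_le h1 hδ).trans_lt (Nat.lt_floor_add_one _)
  have h3 : ((2 * n : ℕ) : ℝ) < (F + 1) ^ 2 := by
    have h4 : (((2 * n : ℕ) : ℝ) ^ (1 / 2 : ℝ)) ^ 2 = ((2 * n : ℕ) : ℝ) := by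
      rw [← Real.sqrt_eq_rpow, Real.sq_sqrt (by positivity)]
    rw [← h4]
    exact pow_lt_pow_left₀ h2 (by positivity) (by norm_num)
  have h5 : 2 * n < (F + 1) ^ 2 := by exact_mod_cast h3
  by_contra hlt
  rw [not_le] at hlt
  rcases F with _ | F
  · omega
  · nlinarith

-- The gap `ε / 2` between the exponents absorbs all constants; this leaves room for a row of `m`
-- entries and a token on one line.
open Filter in
theorem eventually_width (ε C D : ℝ) (hε₀ : 0 < ε) (hε₁ : ε < 1) (hC : 0 < C) (hD : 1 ≤ D) :
    ∀ᶠ n : ℕ in atTop, C * (D * n) ^ (1 - ε) + 2 ≤ ((2 * n : ℕ) : ℝ) ^ (1 - ε / 2) := by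
  have h1 : Tendsto (fun n : ℕ => ((2 * n : ℕ) : ℝ) ^ (ε / 2)) atTop atTop :=
    (tendsto_rpow_atTop (by linarith)).comp (tendsto_natCast_atTop_atTop.comp
      (tendsto_id.const_mul_atTop' (by norm_num)))
  filter_upwards [h1.eventually_ge_atTop (C * D + 2), eventually_ge_atTop 1] with n hn hn1
  have hn1' : (1 : ℝ) ≤ n := by exact_mod_cast hn1
  have h2n : (1 : ℝ) ≤ ((2 * n : ℕ) : ℝ) := by push_cast; linarith
  have e1 : (1 : ℝ) ≤ ((2 * n : ℕ) : ℝ) ^ (1 - ε) := Real.one_le_rpow h2n (by linarith)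
  have e2 : (D * n) ^ (1 - ε) ≤ D * ((2 * n : ℕ) : ℝ) ^ (1 - ε) := by
    rw [Real.mul_rpow (by linarith) (by linarith)]
    apply mul_le_mul
    · calc D ^ (1 - ε) ≤ D ^ (1 : ℝ) := Real.rpow_le_rpow_of_exponent_le hD (by linarith)
        _ = D := Real.rpow_one D
    · exact Real.rpow_le_rpow (by linarith) (by push_cast; linarith) (by linarith)
    · positivity
    · linarith
  calc C * (D * n) ^ (1 - ε) + 2
      ≤ C * (D * ((2 * n : ℕ) : ℝ) ^ (1 - ε)) + 2 * ((2 * n : ℕ) : ℝ) ^ (1 - ε) := by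
        have := mul_le_mul_of_nonneg_left e2 hC.le
        linarith
    _ = (C * D + 2) * ((2 * n : ℕ) : ℝ) ^ (1 - ε) := by ring
    _ ≤ ((2 * n : ℕ) : ℝ) ^ (ε / 2) * ((2 * n : ℕ) : ℝ) ^ (1 - ε) :=
        mul_le_mul_of_nonneg_right hn (by positivity)
    _ = _ := by rw [← Real.rpow_add (by linarith)]; congr 1; ring

theorem two_pow_le_pow {B : ℝ} {N p n e : ℕ} (hN : 1 ≤ N) (hNn : N ≤ n ^ e)
    (hp : (p : ℝ) ≤ B * Real.log N) : 2 ^ p ≤ n ^ (e * ⌈B⌉₊) := by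
  have hN' : (0 : ℝ) < N := by exact_mod_cast hN
  have hlog : 0 ≤ Real.log N := Real.log_nonneg (by exact_mod_cast hN)
  have h1 : ((2 ^ p : ℕ) : ℝ) ≤ ((N ^ ⌈B⌉₊ : ℕ) : ℝ) := by
    push_cast
    rw [← Real.log_le_log_iff (by positivity) (by positivity), Real.log_pow, Real.log_pow]
    calc (p : ℝ) * Real.log 2 ≤ p * 1 := by
          apply mul_le_mul_of_nonneg_left _ (by positivity)
          linarith [Real.log_two_lt_d9]
      _ ≤ B * Real.log N := by linarith
      _ ≤ _ := mul_le_mul_of_nonneg_right (Nat.le_ceil B) hlog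
  have h2 : 2 ^ p ≤ N ^ ⌈B⌉₊ := by exact_mod_cast h1
  refine h2.trans ?_
  rw [pow_mul]
  exact Nat.pow_le_pow_left hNn _

theorem le_pow_of_mul_rpow_le {a ξ D : ℝ} {N k n : ℕ} (ha : 0 < a) (hξ : 0 < ξ)
    (hk : a * (N : ℝ) ^ ξ ≤ k) (hkn : (k : ℝ) ≤ D * n) (hn : D / a ≤ n) (hn1 : 1 ≤ n) :
    N ≤ n ^ ⌈2 / ξ⌉₊ := by
  have hn1' : (1 : ℝ) ≤ n := by exact_mod_cast hn1
  have h1 : (N : ℝ) ^ ξ ≤ (n : ℝ) ^ (2 : ℝ) := by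
    have : (N : ℝ) ^ ξ ≤ D / a * n := by
      rw [div_mul_eq_mul_div, le_div_iff₀ ha]
      linarith
    refine this.trans ?_
    rw [Real.rpow_two, sq]
    exact mul_le_mul_of_nonneg_right hn (by linarith)
  have h2 : (N : ℝ) ≤ (n : ℝ) ^ (2 / ξ) := by
    have := Real.rpow_le_rpow (by positivity) h1 (show 0 ≤ 1 / ξ by positivity)
    rw [← Real.rpow_mul (by positivity), ← Real.rpow_mul (by positivity), mul_one_div_cancel hξ.ne',
      Real.rpow_one] at this
    rwa [mul_one_div] at this
  have h3 : (n : ℝ) ^ (2 / ξ) ≤ ((n ^ ⌈2 / ξ⌉₊ : ℕ) : ℝ) := by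
    push_cast
    rw [← Real.rpow_natCast]
    exact Real.rpow_le_rpow_of_exponent_le hn1' (Nat.le_ceil _)
  exact_mod_cast h2.trans h3

/-- From `ξ ≤ 1 / 2` follows `k ^ 2 ≤ b ^ 2 * N`, and the length `4 * n * k` is at most `8 * k ^ 2 /
D`. -/
theorem mul_lt_of_le_rpow {b ξ : ℝ} {N k n D : ℕ} (hb : 0 < b) (hξ : ξ ≤ 1 / 2) (hN : 1 ≤ N)
    (hk : (k : ℝ) ≤ b * (N : ℝ) ^ ξ) (hD : 8 * b ^ 2 < D) (hDn : n * D ≤ 2 * k) :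
    2 * (2 * n) * k < N := by
  have hN1 : (1 : ℝ) ≤ N := by exact_mod_cast hN
  have h1 : (k : ℝ) ≤ b * (N : ℝ) ^ (1 / 2 : ℝ) :=
    hk.trans (mul_le_mul_of_nonneg_left (Real.rpow_le_rpow_of_exponent_le hN1 hξ) hb.le)
  have h2 : (k : ℝ) ^ 2 ≤ b ^ 2 * N := by
    have h4 : ((N : ℝ) ^ (1 / 2 : ℝ)) ^ 2 = N := by
      rw [← Real.sqrt_eq_rpow, Real.sq_sqrt (by positivity)]
    rw [← h4, ← mul_pow]
    exact pow_le_pow_left₀ (by positivity) h1 2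
  have hD0 : (0 : ℝ) < D := lt_trans (by positivity) hD
  have h3 : (n : ℝ) * D ≤ 2 * k := by exact_mod_cast hDn
  have h5 : (2 * (2 * n) * k : ℝ) * D < N * D := by
    calc (2 * (2 * n) * k : ℝ) * D = 4 * k * (n * D) := by ring
      _ ≤ 4 * k * (2 * k) := mul_le_mul_of_nonneg_left h3 (by positivity)
      _ = 8 * (k : ℝ) ^ 2 := by ring
      _ ≤ 8 * (b ^ 2 * N) := by linarith
      _ = (8 * b ^ 2) * N := by ring
      _ < D * N := mul_lt_mul_of_pos_right hD (by linarith)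
      _ = N * D := by ring
  have h6 := lt_of_mul_lt_mul_right h5 hD0.le
  exact_mod_cast h6

theorem cycle_length_bounds {k D : ℕ} (hD : 8 ≤ D) (hk : 1 ≤ k / D) :
    2 * (k / D) * D ≤ 2 * k ∧ k ≤ D * (2 * (k / D)) ∧ 2 * (2 * (2 * (k / D))) ≤ k := by
  have h1 := Nat.div_mul_le_self k D
  have h2 := Nat.lt_mul_div_succ k (show 0 < D by omega)
  have h3 := Nat.mul_le_mul_left (k / D) hD
  have h4 := Nat.mul_le_mul_left D hk
  refine ⟨by linarith, ?_, by linarith⟩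
  calc k ≤ D * (k / D + 1) := h2.le
    _ = D * (k / D) + D * 1 := by ring
    _ ≤ D * (k / D) + D * (k / D) := Nat.add_le_add_left h4 _
    _ = D * (2 * (k / D)) := by ring

open Filter in
theorem mainTheorem6 (hconj : OneVersusTwoCycleConjecture)
    (ξ ε : ℝ) (hξ₀ : 0 < ξ) (hξ₁ : ξ ≤ 1 / 2) (hε₀ : 0 < ε) (hε₁ : ε < 1)
    (a b C B : ℝ) (ha : 0 < a) (hb : 0 < b) (hC : 0 < C) (hB : 0 < B) :
    ∃ c : ℝ, 0 < c ∧ ∃ N₀ : ℕ, ∀ N : ℕ, N₀ ≤ N →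
      ∀ k : ℕ, Even k → a * (N : ℝ) ^ ξ ≤ k → (k : ℝ) ≤ b * (N : ℝ) ^ ξ →
      ∀ m L H : ℕ, ((m * H : ℕ) : ℝ) ≤ C * (k : ℝ) ^ (1 - ε) →
      ∀ p : ℕ, (p : ℝ) ≤ B * Real.log N →
      ∀ ρ : ℝ → ℝ, IsRounding p ρ →
      ∀ (σ : ℕ), k + 3 ≤ σ →
      ∀ code : Option (Fin σ) → ℝ, Function.Injective code →
      ∀ T : CausalTransformer N m L H, T.HasPrecision p → T.ComputesHop ρ k code →
        c * Real.log k ≤ L := by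
  -- `D > 8 * b ^ 2` makes the sequence fit into the context, `D ≥ 8` makes its `4 * n` tokens fit
  -- into the alphabet.
  obtain ⟨D, hD⟩ : ∃ D : ℕ, D = 8 * ⌈b ^ 2⌉₊ + 8 := ⟨_, rfl⟩
  obtain ⟨e₁, he₁⟩ : ∃ e : ℕ, e = ⌈2 / ξ⌉₊ := ⟨_, rfl⟩
  obtain ⟨e₂, he₂⟩ : ∃ e : ℕ, e = e₁ * ⌈B⌉₊ := ⟨_, rfl⟩
  obtain ⟨G, hG⟩ : ∃ G : ℕ, G = e₁ + 12 * e₂ + 12 := ⟨_, rfl⟩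
  -- The dimension of the grid for `κ = 2 * G`: since `F ≤ 2 * n`, it has at most `(2 * n) ^ γ`
  -- cells.
  set γ : ℝ := ((5 * (2 * G) + 1 : ℕ) : ℝ) with hγ
  set δ : ℝ := 1 - ε / 2 with hδ
  have hγ0 : 0 < γ := by rw [hγ]; positivity
  have hG0 : (0 : ℝ) < G := by rw [hG]; positivity
  have hDb : 8 * b ^ 2 < D := by
    rw [hD]; push_cast
    linarith [Nat.le_ceil (b ^ 2)]
  have hD8 : 8 ≤ D := by omega
  have hD1 : (1 : ℝ) ≤ D := by exact_mod_cast (by omega : 1 ≤ D)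
  obtain ⟨c', hc', n₀, hn₀⟩ := hconj γ δ hγ0 (by rw [hδ]; linarith) (by rw [hδ]; linarith)
    1 2 1 1 (4 * G) one_pos two_pos one_pos one_pos (by positivity)
  have hev : ∀ᶠ n : ℕ in atTop, 6 ≤ n ∧ n₀ ≤ n ∧ D ≤ n ∧ C * D ≤ n ∧ D / a ≤ n ∧
      C * (D * n) ^ (1 - ε) + 2 ≤ ((2 * n : ℕ) : ℝ) ^ δ ∧
      ((8 * (2 * G) + 7 : ℕ) : ℝ) ≤ c' / 2 * Real.log n := by
    filter_upwards [eventually_ge_atTop 6, eventually_ge_atTop n₀, eventually_ge_atTop D,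
      tendsto_natCast_atTop_atTop.eventually_ge_atTop (C * D),
      tendsto_natCast_atTop_atTop.eventually_ge_atTop (D / a),
      eventually_width ε C D hε₀ hε₁ hC hD1,
      ((Real.tendsto_log_atTop.comp tendsto_natCast_atTop_atTop).const_mul_atTop
        (half_pos hc')).eventually_ge_atTop ((8 * (2 * G) + 7 : ℕ) : ℝ)] with n h1 h2 h3 h4 h5 h6 h7
    exact ⟨h1, h2, h3, h4, h5, h6, h7⟩
  obtain ⟨n₁, hn₁⟩ := eventually_atTop.1 hev
  have hevN : ∀ᶠ N : ℕ in atTop, ((D * (n₁ + 1) : ℕ) : ℝ) ≤ a * (N : ℝ) ^ ξ :=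
    (((tendsto_rpow_atTop hξ₀).comp tendsto_natCast_atTop_atTop).const_mul_atTop
      ha).eventually_ge_atTop _
  obtain ⟨N₁, hN₁⟩ := eventually_atTop.1 hevN
  set κ' : ℝ := ((5 * (2 * G) + 6 : ℕ) : ℝ) with hκ'
  have hκ0 : 0 < κ' := by rw [hκ']; positivity
  -- The `1` will give `L ≤ k`. The other term makes the rounds for layers cost less than `c' / 2 *
  -- log n`, by `k ≤ n ^ 2`; the remaining rounds are constant and fit into the other half.
  refine ⟨min 1 (c' / (4 * κ')), lt_min one_pos (by positivity), N₁ + 2, ?_⟩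
  intro N hN k _ hka hkb m L H hmH p hp ρ hρ σ hσ code hcode T hT hhop
  by_contra hlt
  rw [not_le] at hlt
  have hkD : D * (n₁ + 1) ≤ k := by exact_mod_cast (hN₁ N (by omega)).trans hka
  obtain ⟨n, hn⟩ : ∃ n : ℕ, n = 2 * (k / D) := ⟨_, rfl⟩
  have hkdiv : n₁ + 1 ≤ k / D := (Nat.le_div_iff_mul_le (by omega)).2 (by rw [mul_comm]; exact hkD)
  obtain ⟨f1, f2, f3, f4, f5, f6, f7⟩ := hn₁ n (by omega)
  obtain ⟨hnD, hkn, h4n⟩ : n * D ≤ 2 * k ∧ k ≤ D * n ∧ 2 * (2 * n) ≤ k :=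
    hn ▸ cycle_length_bounds hD8 (by omega)
  have hkn' : (k : ℝ) ≤ D * n := by exact_mod_cast hkn
  have hk1 : 1 ≤ k := by omega
  have hk1' : (1 : ℝ) ≤ k := by exact_mod_cast hk1
  have hn1' : (1 : ℝ) ≤ n := by exact_mod_cast (by omega : 1 ≤ n)
  have hkn2 : k ≤ n ^ 2 := hkn.trans (by rw [sq]; exact Nat.mul_le_mul_right _ f3)
  have hmH0 : m * H ≠ 0 := hhop.mul_ne_zero hcode (by omega) (by omega) hk1
  obtain ⟨hm0, hH0⟩ := Nat.mul_ne_zero_iff.1 hmH0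
  have hmHn : m * H ≤ n ^ 2 := by
    have : ((m * H : ℕ) : ℝ) ≤ ((n ^ 2 : ℕ) : ℝ) := by
      refine hmH.trans ?_
      calc C * (k : ℝ) ^ (1 - ε) ≤ C * (k : ℝ) ^ (1 : ℝ) := mul_le_mul_of_nonneg_left
            (Real.rpow_le_rpow_of_exponent_le hk1' (by linarith)) hC.le
        _ ≤ C * (D * n) := by rw [Real.rpow_one]; exact mul_le_mul_of_nonneg_left hkn' hC.le
        _ = C * D * n := by ring
        _ ≤ n * n := mul_le_mul_of_nonneg_right f4 (by linarith)
        _ = _ := by push_cast; ring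
    exact_mod_cast this
  have hmn : m ≤ m * H := Nat.le_mul_of_pos_right _ (Nat.pos_of_ne_zero hH0)
  have hHn : H ≤ m * H := Nat.le_mul_of_pos_left _ (Nat.pos_of_ne_zero hm0)
  have hlogk : Real.log k ≤ k := (Real.log_le_sub_one_of_pos (by linarith)).trans (by linarith)
  have hlogk0 : 0 ≤ Real.log k := Real.log_nonneg hk1'
  -- A polynomial bound on the depth, needed because increments grow with `L` and must stay below
  -- the modulus.
  have hLk : L ≤ k := by
    have h1 : (L : ℝ) ≤ k := by
      have := mul_le_mul_of_nonneg_right (min_le_left 1 (c' / (4 * κ'))) hlogk0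
      linarith
    exact_mod_cast h1
  set F : ℕ := ⌊((2 * n : ℕ) : ℝ) ^ δ⌋₊ with hF
  have h2n : (1 : ℝ) ≤ ((2 * n : ℕ) : ℝ) := by push_cast; linarith
  have hFle : (F : ℝ) ≤ ((2 * n : ℕ) : ℝ) ^ δ := Nat.floor_le (by positivity)
  have hmF : m < F := by
    apply Nat.lt_of_succ_le
    apply Nat.le_floor
    have h1 : (m : ℝ) ≤ C * (D * n) ^ (1 - ε) := by
      have h2 : (m : ℝ) ≤ ((m * H : ℕ) : ℝ) := by exact_mod_cast hmn
      refine (h2.trans hmH).trans (mul_le_mul_of_nonneg_left ?_ hC.le)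
      exact Real.rpow_le_rpow (by linarith) hkn' (by linarith)
    push_cast at f6 ⊢
    linarith
  have hNn : N ≤ n ^ e₁ := he₁ ▸ le_pow_of_mul_rpow_le ha hξ₀ hka hkn' f5 (by omega)
  set x : ℝ := ((2 * n : ℕ) : ℝ) ^ (1 + γ - δ) with hx
  have hx1 : 1 ≤ x := Real.one_le_rpow h2n (by rw [hδ]; linarith)
  have hFq : F ^ (5 * (2 * G) + 1) ≤ ⌈x⌉₊ := by
    have h1 : ((F ^ (5 * (2 * G) + 1) : ℕ) : ℝ) ≤ x := by
      push_cast
      have h2 : (F : ℝ) ≤ ((2 * n : ℕ) : ℝ) := by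
        refine hFle.trans ?_
        calc ((2 * n : ℕ) : ℝ) ^ δ ≤ ((2 * n : ℕ) : ℝ) ^ (1 : ℝ) :=
              Real.rpow_le_rpow_of_exponent_le h2n (by rw [hδ]; linarith)
          _ = _ := Real.rpow_one _
      calc (F : ℝ) ^ (5 * (2 * G) + 1) ≤ ((2 * n : ℕ) : ℝ) ^ (5 * (2 * G) + 1) :=
            pow_le_pow_left₀ (by positivity) h2 _
        _ = ((2 * n : ℕ) : ℝ) ^ γ := by rw [hγ, Real.rpow_natCast]
        _ ≤ x := Real.rpow_le_rpow_of_exponent_le h2n (by rw [hδ]; linarith)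
    exact_mod_cast h1.trans (Nat.le_ceil x)
  obtain ⟨π, hπ₁, hπ₂, hπ₃⟩ := exists_cycle_protocol_of_le_pow (F := F) (q := ⌈x⌉₊) (n := n) hρ hcode
    hT hhop hG f1 (by omega) (mul_lt_of_le_rpow hb hξ₁ (by omega) hkb hDb hnD) (by omega) hmF
    (floor_rpow_sq (by omega) (by rw [hδ]; linarith)) hNn
    (he₂ ▸ two_pow_le_pow (by omega) hNn hp) (hmn.trans hmHn) (hHn.trans hmHn) (hLk.trans hkn2) hFq
  obtain ⟨hlog1, hlog2⟩ := log_bounds (show 2 ≤ n by omega)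
  have hG1 : (1 : ℝ) ≤ G := by exact_mod_cast (by omega : 1 ≤ G)
  have hrounds := hn₀ n f2 ⟨k / D, by omega⟩ ⌈x⌉₊ F (2 * G * (Nat.log 2 n + 1))
    (by rw [one_mul]; exact Nat.le_ceil x)
    (by linarith [Nat.ceil_lt_add_one (show 0 ≤ x by linarith)])
    (by rw [one_mul]; exact hFle)
    (by
      rw [one_mul]
      refine hlog1.trans ?_
      rw [Nat.cast_mul]
      exact mul_le_mul_of_nonneg_right (by push_cast; linarith) (Nat.cast_nonneg _))
    (by
      have h1 := mul_le_mul_of_nonneg_left hlog2 (show (0 : ℝ) ≤ 2 * G by positivity)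
      rw [Nat.cast_mul, Nat.cast_mul, Nat.cast_ofNat]
      linarith)
    ((Nat.lt_pow_succ_log_self (by norm_num) n).le.trans (Nat.pow_le_pow_right (by norm_num)
      (Nat.le_mul_of_pos_left _ (by omega)))) π hπ₂ hπ₃
  rw [hπ₁] at hrounds
  have hr : c' * Real.log n ≤ L * κ' + ((8 * (2 * G) + 7 : ℕ) : ℝ) := by
    rw [hκ']
    push_cast at hrounds ⊢
    linarith
  have hlogkn : Real.log k ≤ 2 * Real.log n := by
    have h1 : (k : ℝ) ≤ (n : ℝ) ^ 2 := by exact_mod_cast hkn2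
    have := Real.log_le_log (by linarith) h1
    rwa [Real.log_pow] at this
  have hLlt : (L : ℝ) < c' / (4 * κ') * Real.log k :=
    hlt.trans_le (mul_le_mul_of_nonneg_right (min_le_right _ _) hlogk0)
  have hfin : (L : ℝ) * κ' < c' / 4 * Real.log k := by
    have := mul_lt_mul_of_pos_right hLlt hκ0
    have e : c' / (4 * κ') * Real.log k * κ' = c' / 4 * Real.log k := by
      field_simp
    linarith
  have : c' / 4 * Real.log k ≤ c' / 2 * Real.log n := by
    have := mul_le_mul_of_nonneg_left hlogkn (show 0 ≤ c' / 4 by positivity)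
    linarith
  linarith
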